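/- Let $p,q:\mathbb{R}\to\mathbb{C}$ be $\pi$-periodic functions that are of bounded variation on $[0,\pi]$, and put $Q(x)=\begin{pmatrix}p(x)&q(x)\\q(x)&-p(x)\end{pmatrix}$. For $t\in\mathbb{C}$ let $L_t(Q)$ be the operator in $L_2([0,\pi];\mathbb{C}^2)$ generated by the differential expression $$l(\mathbf{y},Q)=\begin{pmatrix}0&1\\-1&0\end{pmatrix}\mathbf{y}'+Q\mathbf{y}$$ and the boundary condition $\mathbf{y}(\pi)=e^{i\pi t}\mathbf{y}(0)$; its domain consists of the absolutely continuous $\mathbf{y}$ on $[0,\pi]$ that satisfy the boundary condition and have $l(\mathbf{y},Q)\in L_2([0,\pi];\mathbb{C}^2)$. Let $h\in(0,1/10)$ and $$D_h(0,1)=\{t\in\mathbb{C}:|\operatorname{Im}t|\le 2h,\ -h\le\operatorname{Re}t\le 2-h\}\setminus\bigl(\{|t|<h\}\cup\{|t-1|<h\}\bigr).$$ Then for every $t\in D_h(0,1)$ the eigenvalues of $L_t(Q)$, counted with algebraic multiplicity (the dimension of the space of eigenfunctions and associated functions), consist of two sequences $\{\lambda_{n,1}(t):n\in\mathbb{Z}\}$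 and $\{\lambda_{n,2}(t):n\in\mathbb{Z}\}$ that satisfy, as $|n|\to\infty$, $$\lambda_{n,1}(t)=2n+t+O\!\left(\tfrac1n\right),\qquad \lambda_{n,2}(t)=2n-t+O\!\left(\tfrac1n\right),$$ uniformly in $t\in D_h(0,1)$: there are constants $M$ and $N$, depending only on $p$, $q$ and $h$, such that $|\lambda_{n,1}(t)-(2n+t)|\le M/|n|$ and $|\lambda_{n,2}(t)-(2n-t)|\le M/|n|$ for all $t\in D_h(0,1)$ and all $n\in\mathbb{Z}$ with $|n|>N$. -/

import Mathlib

open MeasureTheory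

noncomputable section

namespace Dirac

/-- Lebesgue measure on `[0, π]`. -/
abbrev mu : Measure ℝ := volume.restrict (Set.Icc 0 Real.pi)

/-- The Hilbert space `L₂²[0, π]` of square integrable functions with values in `ℂ²`. -/
abbrev L2 : Type := Lp (EuclideanSpace ℂ (Fin 2)) 2 mu

/-- The matrix potential `Q = (p, q; q, -p)`. -/
def potential (p q : ℝ → ℂ) (x : ℝ) : Matrix (Fin 2) (Fin 2) ℂ :=
  !![p x, q x; q x, -p x]

/-- The differential expression `l(y, Q) = (0, 1; -1, 0) y' + Q y`. -/
def diffExpr (p q : ℝ → ℂ) (y : ℝ → Fin 2 → ℂ) (x : ℝ) : Fin 2 → ℂ :=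
  Matrix.mulVec !![0, 1; -1, 0] (deriv y x) + Matrix.mulVec (potential p q x) (y x)

/-- `y` is an absolutely continuous function on `[0, π]` with `y(π) = e^{iπt} y(0)`. -/
def IsAdmissible (t : ℂ) (y : ℝ → Fin 2 → ℂ) : Prop :=
  AbsolutelyContinuousOnInterval y 0 Real.pi ∧
    y Real.pi = Complex.exp (Complex.I * Real.pi * t) • y 0

theorem ae_differentiableAt {y : ℝ → Fin 2 → ℂ}
    (hy : AbsolutelyContinuousOnInterval y 0 Real.pi) :
    ∀ᵐ x ∂mu, DifferentiableAt ℝ y x := by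
  have h1 := hy.boundedVariationOn
  rw [Set.uIcc_of_le Real.pi_pos.le] at h1
  have h2 := h1.locallyBoundedVariationOn.ae_differentiableWithinAt measurableSet_Icc
  have h3 : ∀ᵐ x ∂mu, x ∈ Set.Ioo 0 Real.pi := by
    have h : mu = volume.restrict (Set.Ioo 0 Real.pi) :=
      (Measure.restrict_congr_set Ioo_ae_eq_Icc).symm
    rw [h]
    exact ae_restrict_mem measurableSet_Ioo
  filter_upwards [h2, h3] with x hx hx'
  exact hx.differentiableAt (Icc_mem_nhds hx'.1 hx'.2)

/-- The graph of `L_t(Q)`: the pairs `(f, g)` in `L₂²[0, π]` such that `f` has an absolutely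
continuous representative `y` with `y(π) = e^{iπt} y(0)` and `g = l(y, Q)` almost everywhere. -/
def graph (p q : ℝ → ℂ) (t : ℂ) : Submodule ℂ (L2 × L2) where
  carrier := {fg | ∃ y : ℝ → Fin 2 → ℂ, IsAdmissible t y ∧
    (∀ᵐ x ∂mu, (fg.1 x).ofLp = y x) ∧ (∀ᵐ x ∂mu, (fg.2 x).ofLp = diffExpr p q y x)}
  zero_mem' := by
    refine ⟨fun _ => 0, ⟨?_, by simp⟩, ?_, ?_⟩
    · exact (LipschitzWith.const (0 : Fin 2 → ℂ)).lipschitzOnWith.absolutelyContinuousOnInterval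
    · filter_upwards [Lp.coeFn_zero (EuclideanSpace ℂ (Fin 2)) 2 mu] with x hx
      exact congrArg WithLp.ofLp hx
    · filter_upwards [Lp.coeFn_zero (EuclideanSpace ℂ (Fin 2)) 2 mu] with x hx
      exact (congrArg WithLp.ofLp hx).trans (by simp [diffExpr])
  add_mem' := by
    rintro a b ⟨y, ⟨hy, hyb⟩, hy1, hy2⟩ ⟨z, ⟨hz, hzb⟩, hz1, hz2⟩
    refine ⟨y + z, ⟨hy.add hz, by simp [hyb, hzb]⟩, ?_, ?_⟩
    · filter_upwards [hy1, hz1, Lp.coeFn_add a.1 b.1] with x h1 h2 h3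
      rw [Prod.fst_add, h3, Pi.add_apply, WithLp.ofLp_add, h1, h2, Pi.add_apply]
    · filter_upwards [hy2, hz2, Lp.coeFn_add a.2 b.2, ae_differentiableAt hy,
        ae_differentiableAt hz] with x h1 h2 h3 h4 h5
      simp only [Prod.snd_add, h3, Pi.add_apply, WithLp.ofLp_add, h1, h2, diffExpr,
        deriv_add h4 h5, Matrix.mulVec_add]
      abel
  smul_mem' := by
    rintro c a ⟨y, ⟨hy, hyb⟩, hy1, hy2⟩
    refine ⟨c • y, ⟨hy.const_smul c, by simp [hyb, smul_comm c]⟩, ?_, ?_⟩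
    · filter_upwards [hy1, Lp.coeFn_smul c a.1] with x h1 h3
      rw [Prod.smul_fst, h3, Pi.smul_apply, WithLp.ofLp_smul, h1, Pi.smul_apply]
    · filter_upwards [hy2, Lp.coeFn_smul c a.2, ae_differentiableAt hy] with x h1 h3 h4
      simp only [Prod.smul_snd, h3, Pi.smul_apply, WithLp.ofLp_smul, h1, diffExpr,
        deriv_const_smul c h4, Matrix.mulVec_smul, smul_add]

/-- The operator `L_t(Q)` in `L₂²[0, π]` generated by `l(y, Q)` and `y(π) = e^{iπt} y(0)`.
Its graph is `graph p q t`, see `graph_operator`. -/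
def operator (p q : ℝ → ℂ) (t : ℂ) : L2 →ₗ.[ℂ] L2 := (graph p q t).toLinearPMap

theorem graph_functional (p q : ℝ → ℂ) (t : ℂ) :
    ∀ fg ∈ graph p q t, fg.1 = 0 → fg.2 = 0 := by
  rintro ⟨f, g⟩ ⟨y, ⟨hy, -⟩, h1, h2⟩ (rfl : f = 0)
  have hI : mu = volume.restrict (Set.Ioo 0 Real.pi) :=
    (Measure.restrict_congr_set Ioo_ae_eq_Icc).symm
  have hc : ContinuousOn y (Set.Ioo 0 Real.pi) :=
    hy.continuousOn.mono (by rw [Set.uIcc_of_le Real.pi_pos.le]; exact Set.Ioo_subset_Icc_self)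
  have h3 : ∀ᵐ x ∂mu, y x = 0 := by
    filter_upwards [h1, Lp.coeFn_zero (EuclideanSpace ℂ (Fin 2)) 2 mu] with x hx hx'
    exact hx.symm.trans (congrArg WithLp.ofLp hx')
  rw [hI] at h3
  have h4 : Set.EqOn y (fun _ => 0) (Set.Ioo 0 Real.pi) :=
    Measure.eqOn_open_of_ae_eq h3 isOpen_Ioo hc continuousOn_const
  have h5 : ∀ᵐ x ∂mu, x ∈ Set.Ioo 0 Real.pi := by
    rw [hI]
    exact ae_restrict_mem measurableSet_Ioo
  refine (Lp.eq_zero_iff_ae_eq_zero).2 ?_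
  filter_upwards [h2, h5] with x hx hx'
  have hd : deriv y x = 0 := by
    have : y =ᶠ[nhds x] fun _ => 0 := h4.eventuallyEq_of_mem (isOpen_Ioo.mem_nhds hx')
    rw [this.deriv_eq, deriv_const]
  have h6 : (g x).ofLp = 0 := by
    rw [hx, diffExpr, hd, h4 hx']
    simp
  exact (WithLp.ofLp_eq_zero 2).1 h6

theorem graph_operator (p q : ℝ → ℂ) (t : ℂ) : (operator p q t).graph = graph p q t :=
  Submodule.toLinearPMap_graph_eq _ (graph_functional p q t)

/-- `μ` is an eigenvalue of the operator `T`. -/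
def IsEigenvalue (T : L2 →ₗ.[ℂ] L2) (μ : ℂ) : Prop :=
  ∃ f : T.domain, f ≠ 0 ∧ T f = μ • (f : L2)

/-- The kernel of `(T - μ)^k`, with its natural domain. -/
def kerPow (T : L2 →ₗ.[ℂ] L2) (μ : ℂ) : ℕ → Submodule ℂ L2
  | 0 => ⊥
  | k + 1 => ((kerPow T μ k).comap (T.toFun - μ • T.domain.subtype)).map T.domain.subtype

/-- The (algebraic) multiplicity of `μ`: the dimension of the root space, that is of the space
of all eigenfunctions and associated functions of `T` at `μ`. It is `0` if there are none. -/
def multiplicity (T : L2 →ₗ.[ℂ] L2) (μ : ℂ) : ℕ∞ :=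
  Cardinal.toENat (Module.rank ℂ (⨆ k, kerPow T μ k : Submodule ℂ L2))

/-- The set `D_h(0, 1) = D_h \ (U_h(0) ∪ U_h(1))`. -/
def region (h : ℝ) : Set ℂ :=
  {t : ℂ | |t.im| ≤ 2 * h ∧ -h ≤ t.re ∧ t.re ≤ 2 - h} \ (Metric.ball 0 h ∪ Metric.ball 1 h)

end Dirac

end

/-! The eigenvalues of `L_t(Q)` are the zeros of the entire function `charFun`, `2 cos πt -
disc(λ)`, where `disc` is the trace of the monodromy matrix of `y' = J⁻¹(λ - Q)y`. For zero
potential this function is `freeChar`, `2 cos πt - 2 cos πλ`. Its zeros `2n ± t` are simple and at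
least `2h` apart, because `t` keeps distance `h` from every integer. The theorem compares the two
functions and then identifies orders of zeros with multiplicities.

Comparison. Diagonalizing the rotation part turns the system into `u' = iλu + av`, `v' = -iλv + bu`
with `a`, `b` equal to `q ∓ ωp`. Eliminating `v` leaves a Volterra equation for `u` whose kernel
contains `∫ a(s) e^{-2iλs} ds`. Bounded variation makes it `O(1/|λ|)` with the right exponential
weight, so `disc(λ) - 2 cos πλ = O(e^{π|Im λ|}/|λ|)` (`exists_norm_disc_sub_le`). On the other side,
`|freeChar|` is at least a multiple of `h · min(1, dist) · e^{π|Im λ|}`, with the distance taken to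
some free root (`exists_le_norm_freeChar`). Rouché's theorem in one large disc and in small discs
about the remaining free roots matches the zeros with `2n ± t`. At a zero the two bounds together
give distance `O(1/|λ|)`. Uniformity is automatic: the difference of the two functions does not
contain `t`, and the lower bound depends on `t` only through `h`.

Multiplicity. Since `sin πt ≠ 0`, the boundary problem has a one-dimensional eigenspace at each
zero. A holomorphic family of solutions whose boundary defect vanishes to the order of the zero
yields, by divided differences, a Jordan chain of exactly that length (`exists_jordanChain`,
`multiplicity_eq_of_chain`, `multiplicity_operator_of_eq_zero`). -/

open scoped BoundedContinuousFunction

/-! ### Argument principle and Rouché's theorem on discs -/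

/-- The pieces `f = (z - a) ^ m * g` of an entire function at a point. -/
theorem Differentiable.exists_eq_pow_mul {f : ℂ → ℂ} (hf : Differentiable ℂ f) (a : ℂ)
    (ha : analyticOrderAt f a ≠ ⊤) :
    ∃ g : ℂ → ℂ, Differentiable ℂ g ∧ g a ≠ 0 ∧
      ∀ z, f z = (z - a) ^ analyticOrderNatAt f a * g z := by
  -- Iterated difference quotients of an entire function are entire by the removable singularity
  -- theorem, so the local factorization is global.
  have hd : ∀ (k : ℕ), Differentiable ℂ ((Function.swap dslope a)^[k] f) := by
    intro k
    induction k with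
    | zero => exact hf
    | succ k ih =>
      rw [Function.iterate_succ_apply']
      exact differentiableOn_univ.1
        ((Complex.differentiableOn_dslope (c := a) Filter.univ_mem).2 ih.differentiableOn)
  obtain ⟨p, hp⟩ := hf.analyticAt a
  have hp0 : p ≠ 0 := by
    intro h
    exact ha (analyticOrderAt_eq_top.2 (hp.locally_zero_iff.2 h))
  have hm : analyticOrderAt f a = (p.order : ℕ) := by
    refine (hf.analyticAt a).analyticOrderAt_eq_natCast.2
      ⟨_, (hd p.order).analyticAt a, hp.iterate_dslope_fslope_ne_zero hp0, .of_forall fun z => ?_⟩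
    exact hp.eq_pow_order_mul_iterate_dslope z
  have hm' : analyticOrderNatAt f a = p.order := by
    rw [analyticOrderNatAt, hm, ENat.toNat_natCast]
  refine ⟨_, hd p.order, hp.iterate_dslope_fslope_ne_zero hp0, fun z => ?_⟩
  rw [hm']
  exact hp.eq_pow_order_mul_iterate_dslope z

theorem Differentiable.analyticOrderAt_ne_top {f : ℂ → ℂ} (hf : Differentiable ℂ f) {w : ℂ}
    (hw : f w ≠ 0) (a : ℂ) : analyticOrderAt f a ≠ ⊤ := by
  intro h
  rw [analyticOrderAt_eq_top] at h
  have h1 := (Complex.analyticOnNhd_univ_iff_differentiable.2 hf).eqOn_zero_of_preconnected_of_eventuallyEq_zero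
    isPreconnected_univ (Set.mem_univ a) h
  exact hw (h1 (Set.mem_univ w))

theorem Differentiable.finite_zeros {f : ℂ → ℂ} (hf : Differentiable ℂ f) {w : ℂ}
    (hw : f w ≠ 0) {K : Set ℂ} (hK : IsCompact K) : (K ∩ {z | f z = 0}).Finite := by
  by_contra h
  have hinf : (K ∩ {z | f z = 0}).Infinite := h
  obtain ⟨x, -, hx⟩ := hinf.exists_accPt_of_subset_isCompact hK Set.inter_subset_left
  rw [accPt_iff_frequently_nhdsNE] at hx
  have h1 := (Complex.analyticOnNhd_univ_iff_differentiable.2 hf).eqOn_zero_of_preconnected_of_frequently_eq_zero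
    isPreconnected_univ (Set.mem_univ x) (hx.mono fun z hz => hz.2)
  exact hw (h1 (Set.mem_univ w))

/-- The argument principle for entire functions on a disc. -/
theorem circleIntegral_logDeriv_eq {c : ℂ} {R : ℝ} (hR : 0 < R) (Z : Finset ℂ) :
    ∀ f : ℂ → ℂ, Differentiable ℂ f → (∀ z ∈ Metric.sphere c R, f z ≠ 0) →
      (∀ z, z ∈ Z ↔ z ∈ Metric.ball c R ∧ f z = 0) →
      (∮ z in C(c, R), deriv f z / f z) =
        2 * Real.pi * Complex.I * (∑ z ∈ Z, analyticOrderNatAt f z : ℕ) := by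
  classical
  induction Z using Finset.induction_on with
  | empty =>
    intro f hf hs hZ
    have h0 : ∀ z ∈ Metric.closedBall c R, f z ≠ 0 := by
      intro z hz h
      rcases (Metric.mem_closedBall.1 hz).lt_or_eq with h1 | h1
      · exact absurd ((hZ z).2 ⟨h1, h⟩) (Finset.notMem_empty z)
      · exact hs z h1 h
    have hdd : Differentiable ℂ (deriv f) := hf.deriv
    have := Complex.circleIntegral_eq_zero_of_differentiable_on_off_countable (c := c)
      (f := fun z => deriv f z / f z) hR.le Set.countable_empty
      (hdd.continuous.continuousOn.div hf.continuous.continuousOn h0)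
      (fun z hz => (hdd z).div (hf z) (h0 z (Metric.ball_subset_closedBall hz.1)))
    simpa using this
  | insert a Z haZ ih =>
    intro f hf hs hZ
    obtain ⟨w, hw⟩ : ∃ w, f w ≠ 0 :=
      ⟨_, hs (c + R) (by simp [abs_of_pos hR])⟩
    have hab := (hZ a).1 (Finset.mem_insert_self a Z)
    obtain ⟨g, hg, hga, hfg⟩ := hf.exists_eq_pow_mul a (hf.analyticOrderAt_ne_top hw a)
    set m := analyticOrderNatAt f a with hm
    have hm0 : m ≠ 0 := by
      intro h
      have := hfg a
      rw [h, pow_zero, one_mul, hab.2] at this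
      exact hga this.symm
    have hz0 : ∀ z, f z = 0 ↔ z = a ∨ g z = 0 := by
      intro z
      rw [hfg z, mul_eq_zero, pow_eq_zero_iff hm0, sub_eq_zero]
    have hgs : ∀ z ∈ Metric.sphere c R, g z ≠ 0 := fun z hz h =>
      hs z hz ((hz0 z).2 (Or.inr h))
    have hgZ : ∀ z, z ∈ Z ↔ z ∈ Metric.ball c R ∧ g z = 0 := by
      intro z
      constructor
      · intro hz
        have h1 := (hZ z).1 (Finset.mem_insert_of_mem hz)
        refine ⟨h1.1, ((hz0 z).1 h1.2).resolve_left ?_⟩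
        rintro rfl
        exact haZ hz
      · rintro ⟨h1, h2⟩
        have h3 := (hZ z).2 ⟨h1, (hz0 z).2 (Or.inr h2)⟩
        refine (Finset.mem_insert.1 h3).resolve_left ?_
        rintro rfl
        exact hga h2
    have hord : ∀ z ∈ Z, analyticOrderNatAt f z = analyticOrderNatAt g z := by
      intro z hz
      have hza : z ≠ a := by
        rintro rfl
        exact haZ hz
      have hpa : Differentiable ℂ fun z : ℂ => (z - a) ^ m := by fun_prop
      have h1 : f = (fun z => (z - a) ^ m) * g := funext hfg
      have h2 : analyticOrderAt (fun z : ℂ => (z - a) ^ m) z = 0 := by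
        rw [(hpa.analyticAt z).analyticOrderAt_eq_zero]
        exact pow_ne_zero _ (sub_ne_zero.2 hza)
      rw [analyticOrderNatAt, analyticOrderNatAt, h1,
        analyticOrderAt_mul (hpa.analyticAt z) (hg.analyticAt z), h2, zero_add]
    have hlog : ∀ z ∈ Metric.sphere c R,
        deriv f z / f z = m * (z - a)⁻¹ + deriv g z / g z := by
      intro z hz
      have hza : z - a ≠ 0 := by
        rw [sub_ne_zero]
        rintro rfl
        exact hs z hz hab.2
      have hd : HasDerivAt f (m * (z - a) ^ (m - 1) * g z + (z - a) ^ m * deriv g z) z := by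
        have h1 : HasDerivAt (fun z => (z - a) ^ m * g z)
            ((m * (z - a) ^ (m - 1) * 1) * g z + (z - a) ^ m * deriv g z) z :=
          (((hasDerivAt_id z).sub_const a).pow m).mul (hg z).hasDerivAt
        rw [mul_one] at h1
        rwa [show f = fun z => (z - a) ^ m * g z from funext hfg]
      have h3 : (z - a) ^ m = (z - a) ^ (m - 1) * (z - a) := by
        rw [← pow_succ, Nat.sub_add_cancel (Nat.one_le_iff_ne_zero.2 hm0)]
      have h4 := hgs z hz
      have h5 : (z - a) ^ (m - 1) ≠ 0 := pow_ne_zero _ hza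
      rw [hd.deriv, hfg z, h3]
      field_simp
    rw [circleIntegral.integral_congr hR.le hlog, circleIntegral.integral_add,
      ih g hg hgs hgZ, Finset.sum_insert haZ, ← hm, Finset.sum_congr rfl hord]
    · have : (∮ z in C(c, R), (m : ℂ) * (z - a)⁻¹) = m * (2 * Real.pi * Complex.I) := by
        rw [circleIntegral.integral_const_mul, circleIntegral.integral_sub_inv_of_mem_ball hab.1]
      rw [this]
      push_cast
      ring
    · apply ContinuousOn.circleIntegrable hR.le
      refine continuousOn_const.mul (ContinuousOn.inv₀ (by fun_prop) ?_)
      intro z hz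
      rw [sub_ne_zero]
      rintro rfl
      exact hs z hz hab.2
    · apply ContinuousOn.circleIntegrable hR.le
      exact hg.deriv.continuous.continuousOn.div hg.continuous.continuousOn hgs

/-- Rouché's theorem for entire functions on a disc. -/
theorem sum_analyticOrderNatAt_eq_of_norm_sub_lt {c : ℂ} {R : ℝ} (hR : 0 < R) {f g : ℂ → ℂ}
    (hf : Differentiable ℂ f) (hg : Differentiable ℂ g)
    (hfg : ∀ z ∈ Metric.sphere c R, ‖f z - g z‖ < ‖g z‖) {Zf Zg : Finset ℂ}
    (hZf : ∀ z, z ∈ Zf ↔ z ∈ Metric.ball c R ∧ f z = 0)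
    (hZg : ∀ z, z ∈ Zg ↔ z ∈ Metric.ball c R ∧ g z = 0) :
    ∑ z ∈ Zf, analyticOrderNatAt f z = ∑ z ∈ Zg, analyticOrderNatAt g z := by
  have hg0 : ∀ z ∈ Metric.sphere c R, g z ≠ 0 := by
    intro z hz h
    have := hfg z hz
    rw [h, norm_zero] at this
    exact absurd this (norm_nonneg _).not_gt
  have hf0 : ∀ z ∈ Metric.sphere c R, f z ≠ 0 := by
    intro z hz h
    have := hfg z hz
    rw [h, zero_sub, norm_neg] at this
    exact lt_irrefl _ this
  have h1 := circleIntegral_logDeriv_eq hR Zf f hf hf0 hZf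
  have h2 := circleIntegral_logDeriv_eq hR Zg g hg hg0 hZg
  -- On the circle `f / g` stays in the disc of radius 1 about 1, so `log (f / g)` is a
  -- single-valued primitive of the difference of logarithmic derivatives.
  have h3 : (∮ z in C(c, R), (deriv f z / f z - deriv g z / g z)) = 0 := by
    refine circleIntegral.integral_eq_zero_of_hasDerivWithinAt hR.le
      (f := fun z => Complex.log (f z / g z)) fun z hz => ?_
    have hgz := hg0 z hz
    have hfz := hf0 z hz
    have hslit : f z / g z ∈ Complex.slitPlane := by
      refine Complex.ball_one_subset_slitPlane ?_
      rw [mem_ball_iff_norm, div_sub_one hgz, norm_div, div_lt_one (norm_pos_iff.2 hgz)]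
      exact hfg z hz
    have := (((hf z).hasDerivAt.div (hg z).hasDerivAt hgz).clog hslit).hasDerivWithinAt
      (s := Metric.sphere c R)
    have h4 : deriv f z / f z - deriv g z / g z =
        (deriv f z * g z - f z * deriv g z) / g z ^ 2 / (f z / g z) := by
      field_simp
    rw [h4]
    exact this
  rw [circleIntegral.integral_sub, h1, h2, sub_eq_zero] at h3
  · have h4 : (2 * Real.pi * Complex.I : ℂ) ≠ 0 := Complex.two_pi_I_ne_zero
    exact_mod_cast mul_left_cancel₀ h4 h3
  · exact ContinuousOn.circleIntegrable hR.le
      (hf.deriv.continuous.continuousOn.div hf.continuous.continuousOn hf0)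
  · exact ContinuousOn.circleIntegrable hR.le
      (hg.deriv.continuous.continuousOn.div hg.continuous.continuousOn hg0)

/-! ### Lower bounds for the sine -/

theorem Complex.norm_sin_sq (z : ℂ) :
    ‖Complex.sin z‖ ^ 2 = Real.sin z.re ^ 2 + Real.sinh z.im ^ 2 := by
  rw [← Complex.normSq_eq_norm_sq, Complex.sin_eq z, Complex.normSq_apply]
  have h1 : (Complex.sin z.re * Complex.cosh z.im + Complex.cos z.re * Complex.sinh z.im * Complex.I : ℂ)
      = ((Real.sin z.re * Real.cosh z.im : ℝ) : ℂ) + ((Real.cos z.re * Real.sinh z.im : ℝ) : ℂ) * Complex.I := by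
    push_cast; rfl
  rw [h1]
  simp only [Complex.add_re, Complex.ofReal_re, Complex.mul_re, Complex.I_re, Complex.ofReal_im,
    Complex.I_im, Complex.add_im, Complex.mul_im]
  have h2 := Real.sin_sq_add_cos_sq z.re
  have h3 := Real.cosh_sq z.im
  linear_combination (Real.sin z.re ^ 2) * h3 + (Real.sinh z.im ^ 2) * h2

/-- In `|sin|² = sin² + sinh²` the first term is at least `(Re w)²` by Jordan's inequality. With `b
= π|Im w|/2`, for `b ≤ 1` one uses `sinh b ≥ b ≥ |Im w|` and `e^b ≤ 3`; for `b ≥ 1` the term `sinh b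
≥ e^b / 3` suffices alone. -/
theorem norm_sin_half_pi_ge_of_abs_re_le {w : ℂ} (hw : |w.re| ≤ 1) :
    1 / 3 * min 1 ‖w‖ * Real.exp (Real.pi * |w.im| / 2) ≤ ‖Complex.sin (Real.pi * w / 2)‖ := by
  have hpi := Real.pi_gt_three
  set b := Real.pi * |w.im| / 2 with hb
  have hb0 : 0 ≤ b := by positivity
  have hre : (Real.pi * w / 2 : ℂ).re = Real.pi / 2 * w.re := by
    rw [show (Real.pi * w / 2 : ℂ) = ((Real.pi / 2 : ℝ) : ℂ) * w by push_cast; ring,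
      Complex.re_ofReal_mul]
  have him : (Real.pi * w / 2 : ℂ).im = Real.pi / 2 * w.im := by
    rw [show (Real.pi * w / 2 : ℂ) = ((Real.pi / 2 : ℝ) : ℂ) * w by push_cast; ring,
      Complex.im_ofReal_mul]
  have hs := Complex.norm_sin_sq (Real.pi * w / 2)
  rw [hre, him] at hs
  have hsin : w.re ^ 2 ≤ Real.sin (Real.pi / 2 * w.re) ^ 2 := by
    have h1 := Real.mul_abs_le_abs_sin (x := Real.pi / 2 * w.re) (by
      rw [abs_mul, abs_of_pos (by positivity)]
      nlinarith)
    rw [abs_mul, abs_of_pos (by positivity : 0 < Real.pi / 2)] at h1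
    have h2 : 2 / Real.pi * (Real.pi / 2 * |w.re|) = |w.re| := by field_simp
    rw [h2] at h1
    exact sq_le_sq.2 h1
  have hsinh : Real.sinh (Real.pi / 2 * w.im) ^ 2 = Real.sinh b ^ 2 := by
    rcases abs_cases w.im with ⟨h1, -⟩ | ⟨h1, -⟩
    · rw [hb, h1]; congr 2; ring
    · rw [hb, h1, ← neg_sq, ← Real.sinh_neg]; congr 2; ring
  rw [hsinh] at hs
  have hbim : w.im ^ 2 ≤ b ^ 2 := by
    rw [← sq_abs w.im]
    refine pow_le_pow_left₀ (abs_nonneg _) ?_ 2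
    rw [hb]
    nlinarith [abs_nonneg w.im]
  refine abs_le_of_sq_le_sq' ?_ (norm_nonneg _) |>.2
  rw [hs]
  have hm0 : 0 ≤ min 1 ‖w‖ := le_min zero_le_one (norm_nonneg _)
  rcases le_total b 1 with h1 | h1
  · have h2 : Real.exp b ≤ 3 :=
      (Real.exp_le_exp.2 h1).trans (Real.exp_one_lt_d9.le.trans (by norm_num))
    have h3 : 1 / 3 * min 1 ‖w‖ * Real.exp b ≤ ‖w‖ := by
      have := min_le_right 1 ‖w‖
      have := Real.exp_pos b
      nlinarith
    calc (1 / 3 * min 1 ‖w‖ * Real.exp b) ^ 2 ≤ ‖w‖ ^ 2 := pow_le_pow_left₀ (by positivity) h3 2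
      _ = w.re ^ 2 + w.im ^ 2 := by
        rw [← Complex.normSq_eq_norm_sq, Complex.normSq_apply]; ring
      _ ≤ _ := by
        have h4 : b ≤ Real.sinh b := Real.self_le_sinh_iff.2 hb0
        have h5 := pow_le_pow_left₀ hb0 h4 2
        linarith
  · have h2 : 1 / 3 * Real.exp b ≤ Real.sinh b := by
      rw [Real.sinh_eq]
      have h3 : Real.exp (-b) ≤ 1 / 3 * Real.exp b := by
        have h4 : 2 * b + 1 ≤ Real.exp (2 * b) := Real.add_one_le_exp _
        have h5 : Real.exp b = Real.exp (2 * b) * Real.exp (-b) := by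
          rw [← Real.exp_add]; congr 1; ring
        have := Real.exp_pos (-b)
        rw [h5]
        nlinarith
      linarith
    have h3 : 1 / 3 * min 1 ‖w‖ * Real.exp b ≤ Real.sinh b := by
      refine le_trans ?_ h2
      have := min_le_left 1 ‖w‖
      have := Real.exp_pos b
      nlinarith
    have h4 := pow_le_pow_left₀ (by positivity) h3 2
    nlinarith [sq_nonneg (Real.sin (Real.pi / 2 * w.re))]

/-- Translation by the nearest even integer changes the sine only by a sign and reduces to the strip
`|Re| ≤ 1`. -/
theorem exists_norm_sin_half_pi_ge (z : ℂ) : ∃ n : ℤ,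
    1 / 3 * min 1 ‖z - 2 * n‖ * Real.exp (Real.pi * |z.im| / 2) ≤
      ‖Complex.sin (Real.pi * z / 2)‖ := by
  refine ⟨round (z.re / 2), ?_⟩
  set n := round (z.re / 2)
  have h1 : |(z - 2 * n).re| ≤ 1 := by
    have := abs_sub_round (z.re / 2)
    have h2 : (z - 2 * n).re = 2 * (z.re / 2 - n) := by
      simp
      ring
    rw [h2, abs_mul, abs_two]
    linarith
  have h3 := norm_sin_half_pi_ge_of_abs_re_le h1
  have h4 : (z - 2 * n).im = z.im := by simp
  have h5 : (Real.pi * (z - 2 * n) / 2 : ℂ) = Real.pi * z / 2 - n * Real.pi := by ring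
  have h6 : ‖Complex.sin (Real.pi * z / 2 - n * Real.pi)‖ = ‖Complex.sin (Real.pi * z / 2)‖ := by
    rw [Complex.sin_antiperiodic.sub_int_mul_eq, norm_mul]
    rcases Int.units_eq_one_or n.negOnePow with h | h <;> simp [h]
  rwa [h4, h5, h6] at h3

/-! ### The free characteristic function and its roots -/

namespace Dirac

/-- The eigenvalues `2n + t` and `2n - t` of the operator with zero potential. -/
noncomputable def freeRoot (t : ℂ) : ℤ ⊕ ℤ → ℂ
  | .inl n => 2 * n + t
  | .inr n => 2 * n - t

/-- The characteristic function of the operator with zero potential. -/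
noncomputable def freeChar (t lam : ℂ) : ℂ := 2 * Complex.cos (Real.pi * t) - 2 * Complex.cos (Real.pi * lam)

theorem differentiable_freeChar (t : ℂ) : Differentiable ℂ (freeChar t) := by
  unfold freeChar
  fun_prop

/-- The product form separates the two families of roots: the first factor vanishes at `2n - t`, the
second at `2n + t`. -/
theorem freeChar_eq (t lam : ℂ) : freeChar t lam =
    4 * Complex.sin (Real.pi * (lam + t) / 2) * Complex.sin (Real.pi * (lam - t) / 2) := by
  have h1 : (Real.pi * t : ℂ) = Real.pi * (lam + t) / 2 - Real.pi * (lam - t) / 2 := by ring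
  have h2 : (Real.pi * lam : ℂ) = Real.pi * (lam + t) / 2 + Real.pi * (lam - t) / 2 := by ring
  rw [freeChar, h1, h2, Complex.cos_add, Complex.cos_sub]
  ring_nf

/-- The discs about 0 and 1 are removed from the region, and its bounds on `Re t` keep it away from
every other integer. Most later uses of the region pass through this estimate. -/
theorem le_norm_sub_int_of_mem_region {h : ℝ} (hh : h ∈ Set.Ioo (0 : ℝ) (1 / 10)) {t : ℂ}
    (ht : t ∈ region h) (m : ℤ) : h ≤ ‖t - m‖ := by
  obtain ⟨⟨-, h2, h3⟩, h4⟩ := ht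
  rw [Set.mem_union, not_or, Metric.mem_ball, Metric.mem_ball, not_lt, not_lt, dist_zero_right,
    dist_eq_norm] at h4
  have hre : |t.re - m| ≤ ‖t - m‖ := by simpa using Complex.abs_re_le_norm (t - m)
  rcases lt_trichotomy m 0 with hm | rfl | hm
  · have : (m : ℝ) ≤ -1 := by exact_mod_cast Int.le_sub_one_of_lt hm
    have := le_abs_self (t.re - m)
    linarith [hh.1, hh.2]
  · simpa using h4.1
  · rcases (Int.add_one_le_of_lt hm).eq_or_lt with h5 | h5
    · rw [zero_add] at h5
      simpa [← h5] using h4.2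
    · have : (2 : ℝ) ≤ m := by exact_mod_cast h5
      have := neg_abs_le (t.re - m)
      linarith

theorem norm_le_of_mem_region {h : ℝ} (hh : h ∈ Set.Ioo (0 : ℝ) (1 / 10)) {t : ℂ}
    (ht : t ∈ region h) : ‖t‖ ≤ 3 := by
  obtain ⟨⟨h1, h2, h3⟩, -⟩ := ht
  have h4 := Complex.norm_le_abs_re_add_abs_im t
  have h5 : |t.re| ≤ 2 := abs_le.2 ⟨by linarith [hh.1, hh.2], by linarith [hh.1]⟩
  linarith [hh.2]

variable {h : ℝ} {t : ℂ}

/-- Roots of one family differ by nonzero even integers, roots of different families by `2(t - m)`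
with `m` an integer, up to sign. -/
theorem le_norm_freeRoot_sub (h1 : h ≤ 1) (ht : ∀ m : ℤ, h ≤ ‖t - m‖) {i j : ℤ ⊕ ℤ}
    (hij : i ≠ j) : 2 * h ≤ ‖freeRoot t i - freeRoot t j‖ := by
  have key : ∀ n m : ℤ, n ≠ m → 2 * h ≤ ‖(2 * n - 2 * m : ℂ)‖ := by
    intro n m hnm
    rw [← mul_sub, norm_mul]
    have h2 : (1 : ℝ) ≤ |((n - m : ℤ) : ℝ)| := by
      exact_mod_cast Int.one_le_abs (sub_ne_zero.2 hnm)
    have h3 : ‖(n - m : ℂ)‖ = |((n - m : ℤ) : ℝ)| := by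
      rw [← Complex.norm_intCast]; push_cast; rfl
    rw [h3, Complex.norm_ofNat]
    linarith
  have key2 : ∀ n m : ℤ, 2 * h ≤ ‖(2 * n + t - (2 * m - t) : ℂ)‖ := by
    intro n m
    have : (2 * n + t - (2 * m - t) : ℂ) = 2 * (t - ((m - n : ℤ) : ℂ)) := by push_cast; ring
    rw [this, norm_mul, Complex.norm_ofNat]
    linarith [ht (m - n)]
  rcases i with n | n <;> rcases j with m | m
  · have := key n m (fun e => hij (by rw [e]))
    simpa [freeRoot] using this
  · exact key2 n m
  · rw [norm_sub_rev]
    exact key2 m n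
  · have := key n m (fun e => hij (by rw [e]))
    simpa [freeRoot] using this

/-- The two sine factors cannot both be small: the distances of `λ` to the nearest roots they detect
add up to at least `2h`. One factor therefore contributes `h` and the other the distance to its
root; `4/9` is `4 · (1/3)²`. -/
theorem exists_le_norm_freeChar (h1 : h ≤ 1) (ht : ∀ m : ℤ, h ≤ ‖t - m‖) (lam : ℂ) :
    ∃ i, 4 * h / 9 * min 1 ‖lam - freeRoot t i‖ * Real.exp (Real.pi * |lam.im|) ≤
      ‖freeChar t lam‖ := by
  obtain ⟨n, hn⟩ := exists_norm_sin_half_pi_ge (lam + t)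
  obtain ⟨m, hm⟩ := exists_norm_sin_half_pi_ge (lam - t)
  have hexp : Real.exp (Real.pi * |lam.im|) ≤
      Real.exp (Real.pi * |(lam + t).im| / 2) * Real.exp (Real.pi * |(lam - t).im| / 2) := by
    rw [← Real.exp_add, Real.exp_le_exp]
    have h2 : 2 * |lam.im| ≤ |(lam + t).im| + |(lam - t).im| := by
      have := abs_add_le (lam + t).im (lam - t).im
      have h3 : (lam + t).im + (lam - t).im = 2 * lam.im := by simp; ring
      rwa [h3, abs_mul, abs_two] at this
    nlinarith [Real.pi_pos]
  have hprod : ‖freeChar t lam‖ = 4 * ‖Complex.sin (Real.pi * (lam + t) / 2)‖ *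
      ‖Complex.sin (Real.pi * (lam - t) / 2)‖ := by
    rw [freeChar_eq, norm_mul, norm_mul, Complex.norm_ofNat]
  set d1 := ‖lam + t - 2 * n‖ with hd1
  set d2 := ‖lam - t - 2 * m‖ with hd2
  have hm1 : 0 ≤ min 1 d1 := le_min zero_le_one (norm_nonneg _)
  have hm2 : 0 ≤ min 1 d2 := le_min zero_le_one (norm_nonneg _)
  have hsum : 2 * h ≤ d1 + d2 := by
    have h2 : (lam + t - 2 * n) - (lam - t - 2 * m) = 2 * (t - ((n - m : ℤ) : ℂ)) := by
      push_cast; ring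
    have h3 := norm_sub_le (lam + t - 2 * n) (lam - t - 2 * m)
    rw [h2, norm_mul, Complex.norm_ofNat] at h3
    linarith [ht (n - m)]
  have hlow : 4 / 9 * (min 1 d1 * min 1 d2) * Real.exp (Real.pi * |lam.im|) ≤
      ‖freeChar t lam‖ := by
    rw [hprod]
    have h2 := mul_le_mul hn hm (by positivity) (norm_nonneg _)
    have h3 := mul_le_mul_of_nonneg_left hexp
      (by positivity : 0 ≤ 4 / 9 * (min 1 d1 * min 1 d2))
    nlinarith
  have hE := Real.exp_pos (Real.pi * |lam.im|)
  rcases le_total h d1 with hd | hd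
  · refine ⟨.inl m, ?_⟩
    have h2 : lam - freeRoot t (.inl m) = lam - t - 2 * m := by simp only [freeRoot]; ring
    rw [h2, ← hd2]
    refine le_trans (mul_le_mul_of_nonneg_right ?_ hE.le) hlow
    have : h ≤ min 1 d1 := le_min h1 hd
    nlinarith
  · refine ⟨.inr n, ?_⟩
    have h2 : lam - freeRoot t (.inr n) = lam + t - 2 * n := by simp only [freeRoot]; ring
    rw [h2, ← hd1]
    refine le_trans (mul_le_mul_of_nonneg_right ?_ hE.le) hlow
    have : h ≤ min 1 d2 := le_min h1 (by linarith)
    nlinarith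

theorem freeChar_freeRoot (t : ℂ) (i : ℤ ⊕ ℤ) : freeChar t (freeRoot t i) = 0 := by
  rcases i with n | n
  · have h1 : (Real.pi * (freeRoot t (.inl n) - t) / 2 : ℂ) = n * Real.pi := by
      simp only [freeRoot]; ring
    rw [freeChar_eq, h1, Complex.sin_int_mul_pi, mul_zero]
  · have h1 : (Real.pi * (freeRoot t (.inr n) + t) / 2 : ℂ) = n * Real.pi := by
      simp only [freeRoot]; ring
    rw [freeChar_eq, h1, Complex.sin_int_mul_pi, mul_zero, zero_mul]

theorem freeChar_eq_zero_iff (h0 : 0 < h) (h1 : h ≤ 1) (ht : ∀ m : ℤ, h ≤ ‖t - m‖) {lam : ℂ} :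
    freeChar t lam = 0 ↔ ∃ i, freeRoot t i = lam := by
  constructor
  · intro h2
    obtain ⟨i, hi⟩ := exists_le_norm_freeChar h1 ht lam
    refine ⟨i, ?_⟩
    by_contra hne
    have h3 : 0 < ‖lam - freeRoot t i‖ := norm_pos_iff.2 (sub_ne_zero.2 (Ne.symm hne))
    have h4 : 0 < min 1 ‖lam - freeRoot t i‖ := lt_min one_pos h3
    rw [h2, norm_zero] at hi
    have : 0 < 4 * h / 9 * min 1 ‖lam - freeRoot t i‖ * Real.exp (Real.pi * |lam.im|) := by
      positivity
    linarith
  · rintro ⟨i, rfl⟩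
    exact freeChar_freeRoot t i

theorem sin_pi_mul_ne_zero (h0 : 0 < h) (ht : ∀ m : ℤ, h ≤ ‖t - m‖) :
    Complex.sin (Real.pi * t) ≠ 0 := by
  intro h2
  obtain ⟨k, hk⟩ := Complex.sin_eq_zero_iff.1 h2
  have h3 : t = k := by
    have : (Real.pi : ℂ) ≠ 0 := by exact_mod_cast Real.pi_ne_zero
    apply mul_left_cancel₀ this
    rw [hk, mul_comm]
  have := ht k
  rw [h3, sub_self, norm_zero] at this
  linarith

/-- At a root the derivative is `±2π sin πt`, which is nonzero since `t` is not an integer. -/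
theorem analyticOrderNatAt_freeChar (h0 : 0 < h) (ht : ∀ m : ℤ, h ≤ ‖t - m‖) (i : ℤ ⊕ ℤ) :
    analyticOrderNatAt (freeChar t) (freeRoot t i) = 1 := by
  have h2 : HasDerivAt (freeChar t) (2 * Real.pi * Complex.sin (Real.pi * freeRoot t i))
      (freeRoot t i) := by
    have h3 : HasDerivAt (fun lam : ℂ => (Real.pi : ℂ) * lam) (Real.pi * 1) (freeRoot t i) :=
      (hasDerivAt_id _).const_mul _
    have h4 := (h3.ccos.const_mul 2).const_sub (2 * Complex.cos (Real.pi * t))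
    have h5 : 2 * Real.pi * Complex.sin (Real.pi * freeRoot t i) =
        -(2 * (-Complex.sin (Real.pi * freeRoot t i) * (Real.pi * 1))) := by ring
    rw [h5]
    exact h4
  have h3 : Complex.sin (Real.pi * freeRoot t i) ≠ 0 := by
    have hs := sin_pi_mul_ne_zero h0 ht
    rcases i with n | n
    · have : (Real.pi * freeRoot t (.inl n) : ℂ) = Real.pi * t + n * (2 * Real.pi) := by
        simp only [freeRoot]; ring
      rwa [this, Complex.sin_add_int_mul_two_pi]
    · have : (Real.pi * freeRoot t (.inr n) : ℂ) = -(Real.pi * t) + n * (2 * Real.pi) := by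
        simp only [freeRoot]; ring
      rwa [this, Complex.sin_add_int_mul_two_pi, Complex.sin_neg, neg_ne_zero]
  have h4 := ((differentiable_freeChar t).analyticAt
    (freeRoot t i)).analyticOrderAt_eq_one_of_zero_deriv_ne_zero (freeChar_freeRoot t i) (by
      rw [h2.deriv]
      have : (Real.pi : ℂ) ≠ 0 := by exact_mod_cast Real.pi_ne_zero
      exact mul_ne_zero (mul_ne_zero two_ne_zero this) h3)
  rw [analyticOrderNatAt, h4, ENat.toNat_one]

end Dirac

/-! ### Matching zeros with the free roots -/

/-- Rouché's theorem in a large disc gives only an equality of total counts. This turns it into a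
labelling of the zeros, repeated according to order, by the free roots in that disc. -/
theorem Finset.exists_map_card_filter_eq {ι α : Type*} [DecidableEq ι] [DecidableEq α] [Inhabited α]
    (m : α → ℕ) (Z : Finset α) : ∀ S : Finset ι, ∑ z ∈ Z, m z = S.card →
      ∃ u : ι → α, (∀ i ∈ S, u i ∈ Z) ∧ ∀ z ∈ Z, (S.filter fun i => u i = z).card = m z := by
  induction Z using Finset.induction_on with
  | empty =>
    intro S hS
    rw [Finset.sum_empty] at hS
    have : S = ∅ := Finset.card_eq_zero.1 hS.symm
    exact ⟨fun _ => default, by simp [this], by simp⟩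
  | insert a Z ha ih =>
    intro S hS
    rw [Finset.sum_insert ha] at hS
    obtain ⟨S', hS', hc⟩ := Finset.exists_subset_card_eq (show m a ≤ S.card by omega)
    obtain ⟨u, hu, hu'⟩ := ih (S \ S') (by rw [Finset.card_sdiff_of_subset hS']; omega)
    refine ⟨fun i => if i ∈ S' then a else u i, fun i hi => ?_, fun z hz => ?_⟩
    · dsimp only
      split_ifs with h
      · exact Finset.mem_insert_self a Z
      · exact Finset.mem_insert_of_mem (hu i (Finset.mem_sdiff.2 ⟨hi, h⟩))
    · rcases Finset.mem_insert.1 hz with rfl | hz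
      · rw [← hc]
        congr 1
        ext i
        simp only [Finset.mem_filter]
        constructor
        · rintro ⟨h1, h2⟩
          by_contra h
          rw [if_neg h] at h2
          have := hu i (Finset.mem_sdiff.2 ⟨h1, h⟩)
          rw [h2] at this
          exact ha this
        · intro h
          exact ⟨hS' h, if_pos h⟩
      · rw [← hu' z hz]
        congr 1
        ext i
        simp only [Finset.mem_filter, Finset.mem_sdiff]
        constructor
        · rintro ⟨h1, h2⟩
          by_cases h : i ∈ S'
          · rw [if_pos h] at h2
            rw [h2] at ha
            exact absurd hz ha
          · rw [if_neg h] at h2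
            exact ⟨⟨h1, h⟩, h2⟩
        · rintro ⟨⟨h1, h⟩, h2⟩
          exact ⟨h1, by rwa [if_neg h]⟩

namespace Dirac

variable {h : ℝ} {t : ℂ}

/-- A radius in `[2N, 2N + 1]` such that all zeros of the free characteristic function stay away
from the circle of this radius. -/
theorem exists_radius (hh : h ∈ Set.Ioo (0 : ℝ) (1 / 10)) (ht : t ∈ region h) (N : ℕ) :
    ∃ R : ℝ, 2 * N ≤ R ∧ R ≤ 2 * N + 1 ∧ ∀ i, 3 / 10 ≤ |‖freeRoot t i‖ - R| := by
  obtain ⟨⟨him, hre1, hre2⟩, -⟩ := ht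
  obtain ⟨h0, h1⟩ := hh
  -- Take `s` within `1/2` of `Re t` and the radius `k` of opposite parity. Every free root then has
  -- real part within `1/2` of an integer of the parity of `s`, hence of absolute value different
  -- from `k`.
  obtain ⟨k, s, hk1, hk2, hks, hs⟩ : ∃ (k : ℤ) (s : ℤ), 2 * N ≤ (k : ℝ) ∧ (k : ℝ) ≤ 2 * N + 1 ∧
      (Even s ↔ ¬ Even k) ∧ |t.re - s| ≤ 1 / 2 := by
    rcases le_total t.re (1 / 2) with h2 | h2
    · refine ⟨2 * N + 1, 0, by push_cast; linarith, by push_cast; linarith, ?_, ?_⟩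
      · simp
      · push_cast
        exact abs_le.2 ⟨by linarith, by linarith⟩
    · rcases le_total t.re (3 / 2) with h3 | h3
      · refine ⟨2 * N, 1, by push_cast; linarith, by push_cast; linarith, ?_, ?_⟩
        · simp
        · push_cast
          exact abs_le.2 ⟨by linarith, by linarith⟩
      · refine ⟨2 * N + 1, 2, by push_cast; linarith, by push_cast; linarith, ?_, ?_⟩
        · simp
        · push_cast
          exact abs_le.2 ⟨by linarith, by linarith⟩
  refine ⟨k, hk1, hk2, fun i => ?_⟩
  obtain ⟨m, hm1, hm2, hm3⟩ : ∃ m : ℤ, (Even m ↔ ¬ Even k) ∧ |(freeRoot t i).re - m| ≤ 1 / 2 ∧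
      |(freeRoot t i).im| ≤ 2 * h := by
    rcases i with n | n
    · refine ⟨2 * n + s, ?_, ?_, ?_⟩
      · simp [Int.even_add, hks]
      · have : (freeRoot t (.inl n)).re - ((2 * n + s : ℤ) : ℝ) = t.re - s := by
          simp [freeRoot]
        rwa [this]
      · simpa [freeRoot] using him
    · refine ⟨2 * n - s, ?_, ?_, ?_⟩
      · simp [Int.even_sub, hks]
      · have : (freeRoot t (.inr n)).re - ((2 * n - s : ℤ) : ℝ) = -(t.re - s) := by
          simp [freeRoot]
        rwa [this, abs_neg]
      · simpa [freeRoot] using him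
  -- The modulus of the real part is at least `1/2` from `k`, and the imaginary part adds at most
  -- `2h < 1/5` to the norm; this leaves `3/10`.
  have h4 := Complex.abs_re_le_norm (freeRoot t i)
  have h5 := Complex.norm_le_abs_re_add_abs_im (freeRoot t i)
  have h6 : 1 / 2 ≤ |(|(freeRoot t i).re| - k)| := by
    have h7 : 1 ≤ |(|(m : ℝ)| - k)| := by
      have h8 : |m| - k ≠ 0 := by
        intro h9
        have : Even |m| ↔ Even m := even_abs
        rw [sub_eq_zero.1 h9] at this
        tauto
      exact_mod_cast Int.one_le_abs h8
    have h8 := abs_abs_sub_abs_le (freeRoot t i).re m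
    have h9 : |(|(m : ℝ)| - k)| ≤ |(|(freeRoot t i).re| - k)| + |(|(freeRoot t i).re| - |(m : ℝ)|)| := by
      have := abs_sub (|(freeRoot t i).re| - k) (|(freeRoot t i).re| - |(m : ℝ)|)
      have e : (|(freeRoot t i).re| - k) - (|(freeRoot t i).re| - |(m : ℝ)|) = |(m : ℝ)| - k := by
        ring
      rwa [e] at this
    linarith
  rcases le_abs'.1 h6 with h7 | h7
  · refine le_abs'.2 (Or.inl ?_)
    linarith
  · refine le_abs'.2 (Or.inr ?_)
    linarith

/-- Localization of the zeros of an entire function that is close to the free characteristic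
function. -/
theorem exists_zeros_enumeration (hh : h ∈ Set.Ioo (0 : ℝ) (1 / 10)) (ht : t ∈ region h)
    {F : ℂ → ℂ} (hF : Differentiable ℂ F) {C : ℝ} (hC : 0 < C) {N : ℕ} (hN1 : 1 ≤ N)
    (hN : 9 * C / h ^ 2 ≤ N)
    (hFC : ∀ lam : ℂ, (N : ℝ) ≤ ‖lam‖ →
      ‖F lam - freeChar t lam‖ ≤ C / ‖lam‖ * Real.exp (Real.pi * |lam.im|)) :
    ∃ z : ℤ ⊕ ℤ → ℂ, (∀ μ, analyticOrderAt F μ = {i | z i = μ}.encard) ∧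
      ∀ i, 2 * (N : ℝ) + 1 < ‖freeRoot t i‖ → ‖z i - freeRoot t i‖ ≤ 1 ∧
        ‖z i - freeRoot t i‖ ≤ 9 * C / (4 * h) / ‖z i‖ := by
  classical
  have ht' := le_norm_sub_int_of_mem_region hh ht
  have h0 : 0 < h := hh.1
  have h1 : h ≤ 1 := by linarith [hh.2]
  have hN0 : (0 : ℝ) < N := by exact_mod_cast hN1
  have hN1' : (1 : ℝ) ≤ N := by exact_mod_cast hN1
  -- Discs of this radius about distinct free roots are disjoint, since the roots are `2h` apart,
  -- and `d < 3/10` keeps the large circle clear of them. On their boundary the lower bound `4h/9 ·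
  -- d = 2h²/9` beats `C/‖λ‖ ≤ h²/9`.
  set d := h / 2 with hd
  have hd0 : 0 < d := by positivity
  -- comparison away from the roots
  have hcmp : ∀ lam : ℂ, (N : ℝ) ≤ ‖lam‖ → (∀ i, d ≤ ‖lam - freeRoot t i‖) →
      ‖F lam - freeChar t lam‖ < ‖freeChar t lam‖ := by
    intro lam hlam hi
    obtain ⟨i, hi'⟩ := exists_le_norm_freeChar h1 ht' lam
    have hE := Real.exp_pos (Real.pi * |lam.im|)
    refine (hFC lam hlam).trans_lt (lt_of_lt_of_le ?_ hi')
    refine mul_lt_mul_of_pos_right ?_ hE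
    have h2 : d ≤ min 1 ‖lam - freeRoot t i‖ := le_min (by linarith) (hi i)
    have h3 : C / ‖lam‖ ≤ C / N := div_le_div_of_nonneg_left hC.le hN0 hlam
    have h4 : C / N ≤ h ^ 2 / 9 := by
      rw [div_le_iff₀ (by positivity)] at hN ⊢
      linarith
    calc C / ‖lam‖ ≤ h ^ 2 / 9 := h3.trans h4
      _ < 4 * h / 9 * d := by rw [hd]; nlinarith
      _ ≤ _ := by gcongr
  -- At a zero of `F` the upper bound `C/‖λ‖` meets the lower bound `4h/9 · min 1 dist`. This forces
  -- the minimum below `h/4`, so it is the distance itself, and solving for it gives the constant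
  -- `9C/(4h)`.
  have hloc : ∀ lam : ℂ, (N : ℝ) ≤ ‖lam‖ → F lam = 0 →
      ∃ i, ‖lam - freeRoot t i‖ < d ∧ ‖lam - freeRoot t i‖ ≤ 9 * C / (4 * h) / ‖lam‖ := by
    intro lam hlam hF0
    obtain ⟨i, hi'⟩ := exists_le_norm_freeChar h1 ht' lam
    have hE := Real.exp_pos (Real.pi * |lam.im|)
    have h2 := hFC lam hlam
    rw [hF0, zero_sub, norm_neg] at h2
    have h3 := le_of_mul_le_mul_right (hi'.trans h2) hE
    have hl0 : 0 < ‖lam‖ := hN0.trans_le hlam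
    have h4 : C / ‖lam‖ ≤ h ^ 2 / 9 := by
      refine (div_le_div_of_nonneg_left hC.le hN0 hlam).trans ?_
      rw [div_le_iff₀ (by positivity)] at hN ⊢
      linarith
    have h5 : min 1 ‖lam - freeRoot t i‖ ≤ h / 4 := by
      have : 4 * h / 9 * min 1 ‖lam - freeRoot t i‖ ≤ 4 * h / 9 * (h / 4) := by nlinarith
      exact le_of_mul_le_mul_left this (by positivity)
    have h6 : min 1 ‖lam - freeRoot t i‖ = ‖lam - freeRoot t i‖ := by
      rcases min_choice 1 ‖lam - freeRoot t i‖ with h7 | h7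
      · rw [h7] at h5
        linarith
      · exact h7
    rw [h6] at h3 h5
    refine ⟨i, by linarith, ?_⟩
    have h7 : 9 * C / (4 * h) / ‖lam‖ = C / ‖lam‖ / (4 * h / 9) := by field_simp
    rw [h7, le_div_iff₀ (by positivity)]
    linarith
  obtain ⟨R, hR1, hR2, hR3⟩ := exists_radius hh ht N
  have hR0 : 0 < R := by linarith
  obtain ⟨w, hw⟩ : ∃ w, F w ≠ 0 := by
    refine ⟨R, fun h2 => ?_⟩
    have hRn : ‖(R : ℂ)‖ = R := by rw [Complex.norm_real, Real.norm_of_nonneg hR0.le]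
    have := hcmp R (by rw [hRn]; linarith) (fun i => by
      have h3 := abs_norm_sub_norm_le (R : ℂ) (freeRoot t i)
      rw [hRn, abs_sub_comm] at h3
      linarith [hR3 i, hh.2])
    rw [h2, zero_sub, norm_neg] at this
    exact lt_irrefl _ this
  have hfree : ∃ w, freeChar t w ≠ 0 := by
    by_contra! hall
    have h3 := (freeChar_eq_zero_iff h0 h1 ht').1 (hall R)
    obtain ⟨i, hi⟩ := h3
    have := hR3 i
    rw [hi, Complex.norm_real, Real.norm_of_nonneg hR0.le, sub_self, abs_zero] at this
    linarith
  obtain ⟨w', hw'⟩ := hfree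
  have finZ : ∀ {f : ℂ → ℂ} (_ : Differentiable ℂ f) {w : ℂ} (_ : f w ≠ 0) (c : ℂ) (r : ℝ),
      ∃ Z : Finset ℂ, ∀ z, z ∈ Z ↔ z ∈ Metric.ball c r ∧ f z = 0 := by
    intro f hf w hw c r
    have h2 := (hf.finite_zeros hw (isCompact_closedBall c r)).subset
      (Set.inter_subset_inter_left _ Metric.ball_subset_closedBall)
    exact ⟨h2.toFinset, fun z => by simp⟩
  have hinj : Function.Injective (freeRoot t) := by
    intro i j hij
    by_contra hne
    have := le_norm_freeRoot_sub h1 ht' hne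
    rw [hij, sub_self, norm_zero] at this
    linarith
  -- the zeros close to the far roots
  have hfar : ∀ i, ∃ z, R < ‖freeRoot t i‖ → ‖z - freeRoot t i‖ < d ∧ F z = 0 ∧
      analyticOrderNatAt F z = 1 ∧ ∀ y, ‖y - freeRoot t i‖ < d → F y = 0 → y = z := by
    intro i
    by_cases hi : R < ‖freeRoot t i‖
    swap
    · exact ⟨0, fun h => absurd h hi⟩
    have hiR : R + 3 / 10 ≤ ‖freeRoot t i‖ := by
      have := hR3 i
      rw [abs_of_pos (by linarith)] at this
      linarith
    obtain ⟨Zf, hZf⟩ := finZ hF hw (freeRoot t i) d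
    have hZg : ∀ z, z ∈ ({freeRoot t i} : Finset ℂ) ↔
        z ∈ Metric.ball (freeRoot t i) d ∧ freeChar t z = 0 := by
      intro z
      rw [Finset.mem_singleton, freeChar_eq_zero_iff h0 h1 ht', mem_ball_iff_norm]
      constructor
      · rintro rfl
        exact ⟨by simpa using hd0, i, rfl⟩
      · rintro ⟨h2, j, rfl⟩
        by_contra hne
        have := le_norm_freeRoot_sub h1 ht' (i := j) (j := i) (fun e => hne (by rw [e]))
        linarith
    -- The only zero of `freeChar` in this disc is simple, so Rouché leaves `F` total order 1 there:
    -- one zero, of order one.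
    have hsum := sum_analyticOrderNatAt_eq_of_norm_sub_lt hd0 hF (differentiable_freeChar t)
      (c := freeRoot t i) (fun z hz => ?_) hZf hZg
    · rw [Finset.sum_singleton, analyticOrderNatAt_freeChar h0 ht'] at hsum
      have hpos : ∀ z ∈ Zf, 1 ≤ analyticOrderNatAt F z := by
        intro z hz
        rw [Nat.one_le_iff_ne_zero]
        intro h2
        have h3 := Nat.cast_analyticOrderNatAt (hF.analyticOrderAt_ne_top hw z)
        rw [h2, Nat.cast_zero] at h3
        exact (hF.analyticAt z).analyticOrderAt_eq_zero.1 h3.symm ((hZf z).1 hz).2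
      have hcard : Zf.card ≤ 1 := by
        rw [← hsum, Finset.card_eq_sum_ones]
        exact Finset.sum_le_sum hpos
      have hne : Zf.Nonempty := by
        rw [Finset.nonempty_iff_ne_empty]
        rintro rfl
        simp at hsum
      obtain ⟨z, hz⟩ := Finset.card_eq_one.1 (le_antisymm hcard hne.card_pos)
      have hzm := (hZf z).1 (by rw [hz]; exact Finset.mem_singleton_self z)
      refine ⟨z, fun _ => ⟨mem_ball_iff_norm.1 hzm.1, hzm.2, ?_, fun y hy1 hy2 => ?_⟩⟩
      · rwa [hz, Finset.sum_singleton] at hsum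
      · have := (hZf y).2 ⟨mem_ball_iff_norm.2 hy1, hy2⟩
        rw [hz] at this
        exact Finset.mem_singleton.1 this
    · rw [mem_sphere_iff_norm] at hz
      refine hcmp z ?_ fun j => ?_
      · have h2 := norm_sub_norm_le (freeRoot t i) z
        rw [norm_sub_rev, hz] at h2
        linarith
      · rcases eq_or_ne j i with rfl | hne
        · exact hz.ge
        · have h2 := le_norm_freeRoot_sub h1 ht' hne
          have h3 := norm_sub_le (z - freeRoot t i) (z - freeRoot t j)
          rw [sub_sub_sub_cancel_left] at h3
          linarith
  choose v hv using hfar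
  -- the zeros in the large disc
  obtain ⟨Zf, hZf⟩ := finZ hF hw 0 R
  obtain ⟨Zg, hZg⟩ := finZ (differentiable_freeChar t) hw' 0 R
  have hSfin : {i | ‖freeRoot t i‖ < R}.Finite := by
    refine Set.Finite.of_finite_image (f := freeRoot t) (Zg.finite_toSet.subset ?_) hinj.injOn
    rintro _ ⟨i, hi, rfl⟩
    exact (hZg _).2 ⟨mem_ball_zero_iff.2 hi, freeChar_freeRoot t i⟩
  set S := hSfin.toFinset with hS
  have hSm : ∀ i, i ∈ S ↔ ‖freeRoot t i‖ < R := fun i => by simp [hS]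
  have hZgS : Zg = S.image (freeRoot t) := by
    ext z
    rw [hZg, Finset.mem_image, freeChar_eq_zero_iff h0 h1 ht', mem_ball_zero_iff]
    constructor
    · rintro ⟨h2, i, rfl⟩
      exact ⟨i, (hSm i).2 h2, rfl⟩
    · rintro ⟨i, h2, rfl⟩
      exact ⟨(hSm i).1 h2, i, rfl⟩
  have hsum := sum_analyticOrderNatAt_eq_of_norm_sub_lt hR0 hF (differentiable_freeChar t)
      (c := 0) (fun z hz => by
        rw [mem_sphere_zero_iff_norm] at hz
        refine hcmp z (by linarith) fun i => ?_
        have h3 := abs_norm_sub_norm_le z (freeRoot t i)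
        rw [hz, abs_sub_comm] at h3
        linarith [hR3 i, hh.2]) hZf hZg
  have hcard : ∑ z ∈ Zg, analyticOrderNatAt (freeChar t) z = S.card := by
    rw [hZgS, Finset.sum_image hinj.injOn, Finset.card_eq_sum_ones]
    exact Finset.sum_congr rfl fun i _ => analyticOrderNatAt_freeChar h0 ht' i
  obtain ⟨u, hu1, hu2⟩ := Finset.exists_map_card_filter_eq _ Zf S (hsum.trans hcard)
  have hdich : ∀ i, i ∉ S → R + 3 / 10 ≤ ‖freeRoot t i‖ := by
    intro i hi
    rw [hSm, not_lt] at hi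
    have := hR3 i
    rw [abs_of_nonneg (by linarith)] at this
    linarith
  have hvR : ∀ i, i ∉ S → R < ‖v i‖ := by
    intro i hi
    have h2 := hdich i hi
    have h3 := (hv i (by linarith)).1
    have h4 := norm_sub_norm_le (freeRoot t i) (v i)
    rw [norm_sub_rev] at h4
    linarith [hh.2]
  -- Inside the large disc the labels come from counting, outside from the individual discs. The
  -- values of the first kind have norm below `R`, those of the second above it, so the two kinds
  -- never collide.
  refine ⟨fun i => if i ∈ S then u i else v i, fun μ => ?_, fun i hi => ?_⟩
  · have htop := hF.analyticOrderAt_ne_top hw μ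
    by_cases hμ : ‖μ‖ < R
    · by_cases hFμ : F μ = 0
      · have hset : {i | (if i ∈ S then u i else v i) = μ} =
            (S.filter fun i => u i = μ : Finset (ℤ ⊕ ℤ)) := by
          ext i
          rw [Set.mem_ofPred_eq, Finset.mem_coe, Finset.mem_filter]
          by_cases hi : i ∈ S
          · simp [hi]
          · simp only [hi, if_false, false_and, iff_false]
            rintro rfl
            exact lt_asymm hμ (hvR i hi)
        rw [hset, Set.encard_coe_eq_coe_finsetCard,
          hu2 μ ((hZf μ).2 ⟨mem_ball_zero_iff.2 hμ, hFμ⟩), Nat.cast_analyticOrderNatAt htop]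
      · have hset : {i | (if i ∈ S then u i else v i) = μ} = ∅ := by
          ext i
          rw [Set.mem_ofPred_eq, Set.mem_empty_iff_false, iff_false]
          by_cases hi : i ∈ S
          · rw [if_pos hi]
            rintro rfl
            exact hFμ ((hZf _).1 (hu1 i hi)).2
          · rw [if_neg hi]
            rintro rfl
            exact lt_asymm hμ (hvR i hi)
        rw [hset, Set.encard_empty, (hF.analyticAt μ).analyticOrderAt_eq_zero]
        exact hFμ
    · have hS' : ∀ i, (if i ∈ S then u i else v i) = μ → i ∉ S ∧ v i = μ := by
        intro i hi
        by_cases hiS : i ∈ S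
        · rw [if_pos hiS] at hi
          have := ((hZf _).1 (hu1 i hiS)).1
          rw [hi, mem_ball_zero_iff] at this
          exact absurd this hμ
        · rw [if_neg hiS] at hi
          exact ⟨hiS, hi⟩
      by_cases hFμ : F μ = 0
      · obtain ⟨i, hi, -⟩ := hloc μ (by linarith [not_lt.1 hμ]) hFμ
        have hiS : i ∉ S := by
          intro hiS
          have h2 := (hSm i).1 hiS
          have h3 := hR3 i
          rw [abs_of_neg (by linarith)] at h3
          have h4 := norm_sub_norm_le μ (freeRoot t i)
          linarith [not_lt.1 hμ, hh.2]
        have hvi := hv i (by linarith [hdich i hiS])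
        have hμi : v i = μ := (hvi.2.2.2 μ hi hFμ).symm
        have hset : {i | (if i ∈ S then u i else v i) = μ} = {i} := by
          ext j
          rw [Set.mem_ofPred_eq, Set.mem_singleton_iff]
          constructor
          · intro hj
            obtain ⟨hjS, hj⟩ := hS' j hj
            by_contra hne
            have h2 := le_norm_freeRoot_sub h1 ht' hne
            have h3 := (hv j (by linarith [hdich j hjS])).1
            rw [hj] at h3
            have h4 := norm_sub_le (μ - freeRoot t i) (μ - freeRoot t j)
            rw [sub_sub_sub_cancel_left] at h4
            linarith
          · rintro rfl
            rw [if_neg hiS, hμi]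
        rw [hset, Set.encard_singleton, ← Nat.cast_analyticOrderNatAt htop, ← hμi, hvi.2.2.1,
          Nat.cast_one]
      · have hset : {i | (if i ∈ S then u i else v i) = μ} = ∅ := by
          ext i
          rw [Set.mem_ofPred_eq, Set.mem_empty_iff_false, iff_false]
          intro hi
          obtain ⟨hiS, rfl⟩ := hS' i hi
          exact hFμ (hv i (by linarith [hdich i hiS])).2.1
        rw [hset, Set.encard_empty, (hF.analyticAt μ).analyticOrderAt_eq_zero]
        exact hFμ
  · have hiS : i ∉ S := by
      rw [hSm, not_lt]
      linarith
    beta_reduce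
    rw [if_neg hiS]
    have hvi := hv i (by linarith)
    refine ⟨by linarith [hvi.1, hh.2], ?_⟩
    -- `hloc` names some nearby free root; the separation of the roots shows that it is the one with
    -- index `i`.
    obtain ⟨j, hj1, hj2⟩ := hloc (v i) (by linarith [hvR i hiS]) hvi.2.1
    rcases eq_or_ne j i with rfl | hne
    · exact hj2
    · have h2 := le_norm_freeRoot_sub h1 ht' hne
      have h4 := norm_sub_le (v i - freeRoot t i) (v i - freeRoot t j)
      rw [sub_sub_sub_cancel_left] at h4
      linarith [hvi.1]

end Dirac

/-! ### Oscillatory integrals against functions of bounded variation -/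

/-- A form of the second mean value theorem. Replacing `f` by a step function on `n + 1` equal
intervals costs `O(1/(n + 1))`, because the oscillations of a monotone function telescope. Abel
summation bounds what remains by `(f b - f a) G + M G ≤ 3MG`, and `n` tends to infinity. No
continuity of `f` is needed. -/
theorem MonotoneOn.norm_integral_ofReal_mul_le {f : ℝ → ℝ} {a b : ℝ} (hab : a ≤ b)
    (hf : MonotoneOn f (Set.Icc a b)) {M : ℝ} (hM : ∀ x ∈ Set.Icc a b, |f x| ≤ M)
    {g : ℝ → ℂ} (hg : Continuous g) {G : ℝ} (hG : ∀ u ∈ Set.Icc a b, ‖∫ s in a..u, g s‖ ≤ G) :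
    ‖∫ s in a..b, (f s : ℂ) * g s‖ ≤ 3 * M * G := by
  have hM0 : 0 ≤ M := (abs_nonneg _).trans (hM a (Set.left_mem_Icc.2 hab))
  obtain ⟨K, hK⟩ := isCompact_Icc.exists_bound_of_continuousOn (hg.continuousOn (s := Set.Icc a b))
  have hK0 : 0 ≤ K := (norm_nonneg _).trans (hK a (Set.left_mem_Icc.2 hab))
  have hmain : ∀ n : ℕ, ‖∫ s in a..b, (f s : ℂ) * g s‖ ≤
      3 * M * G + (2 * M * K * (b - a)) * (1 / ((n : ℝ) + 1)) := by
    intro n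
    set e : ℝ := (b - a) / (n + 1) with he
    have hn : (0 : ℝ) < n + 1 := by positivity
    have he0 : 0 ≤ e := div_nonneg (by linarith) hn.le
    set x : ℕ → ℝ := fun i => a + i * e with hx
    have hxd : ∀ i, x i = a + i * e := fun _ => rfl
    have hxs : ∀ i, x (i + 1) - x i = e := fun i => by rw [hxd, hxd]; push_cast; ring
    have hx0 : x 0 = a := by rw [hxd, Nat.cast_zero, zero_mul, add_zero]
    have hxn : x (n + 1) = b := by
      rw [hxd, he, Nat.cast_add, Nat.cast_one, mul_div_cancel₀ _ hn.ne']
      ring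
    have hmono : ∀ i, x i ≤ x (i + 1) := fun i => by linarith [hxs i]
    have hxm : Monotone x := monotone_nat_of_le_succ hmono
    have hxI : ∀ i ≤ n + 1, x i ∈ Set.Icc a b := fun i hi =>
      ⟨hx0 ▸ hxm (Nat.zero_le i), hxn ▸ hxm hi⟩
    have hsub : ∀ i < n + 1, Set.Icc (x i) (x (i + 1)) ⊆ Set.Icc a b := fun i hi =>
      Set.Icc_subset_Icc (hxI i hi.le).1 (hxI (i + 1) hi).2
    have hfi : ∀ i < n + 1, IntervalIntegrable (fun s => (f s : ℂ)) volume (x i) (x (i + 1)) := by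
      intro i hi
      have h1 : IntervalIntegrable f volume (x i) (x (i + 1)) :=
        (hf.mono (by rw [Set.uIcc_of_le (hmono i)]; exact hsub i hi)).intervalIntegrable
      exact ⟨h1.1.ofReal, h1.2.ofReal⟩
    have hfgi : ∀ i < n + 1,
        IntervalIntegrable (fun s => (f s : ℂ) * g s) volume (x i) (x (i + 1)) := fun i hi =>
      (hfi i hi).mul_continuousOn hg.continuousOn
    have hgi : ∀ c d : ℝ, IntervalIntegrable g volume c d := fun c d => hg.intervalIntegrable c d
    have hsplit := intervalIntegral.sum_integral_adjacent_intervals hfgi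
    rw [hx0, hxn] at hsplit
    rw [← hsplit]
    set H : ℕ → ℂ := fun i => ∫ s in a..x i, g s with hH
    have hHG : ∀ i ≤ n + 1, ‖H i‖ ≤ G := fun i hi => hG _ (hxI i hi)
    have hdec : ∀ i, (∫ s in x i..x (i + 1), (f (x i) : ℂ) * g s) = f (x i) * (H (i + 1) - H i) := by
      intro i
      rw [intervalIntegral.integral_const_mul, hH]
      dsimp only
      rw [intervalIntegral.integral_interval_sub_left (hgi _ _) (hgi _ _)]
    have hdiff : ∀ i < n + 1, ‖(∫ s in x i..x (i + 1), (f s : ℂ) * g s) -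
        f (x i) * (H (i + 1) - H i)‖ ≤ (f (x (i + 1)) - f (x i)) * K * e := by
      intro i hi
      rw [← hdec, ← intervalIntegral.integral_sub (hfgi i hi) ((hgi _ _).const_mul _)]
      have h1 := intervalIntegral.norm_integral_le_of_norm_le_const
        (f := fun s => (f s : ℂ) * g s - f (x i) * g s) (a := x i) (b := x (i + 1))
        (C := (f (x (i + 1)) - f (x i)) * K) (fun s hs => by
          rw [Set.uIoc_of_le (hmono i)] at hs
          have hsI := hsub i hi ⟨hs.1.le, hs.2⟩
          have h2 := hf (hxI i hi.le) hsI hs.1.le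
          have h3 := hf hsI (hxI (i + 1) hi) hs.2
          rw [← sub_mul, norm_mul, ← Complex.ofReal_sub, Complex.norm_real,
            Real.norm_of_nonneg (by linarith)]
          exact mul_le_mul (by linarith) (hK s hsI) (norm_nonneg _) (by linarith))
      rwa [abs_of_nonneg (by linarith [hmono i]), hxs] at h1
    -- Abel summation by induction, with the boundary term split off; the increments of `f` are
    -- nonnegative, so their norms sum to `f (x m) - f (x 0)`.
    have habel : ∀ m ≤ n + 1, ‖∑ i ∈ Finset.range m, (f (x i) : ℂ) * (H (i + 1) - H i)
        - f (x m) * H m‖ ≤ (f (x m) - f (x 0)) * G := by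
      intro m
      induction m with
      | zero =>
        intro _
        have : H 0 = 0 := by simp only [hH, hx0, intervalIntegral.integral_same]
        rw [this, Finset.sum_range_zero, mul_zero, sub_zero, norm_zero, sub_self, zero_mul]
      | succ m ih =>
        intro hm
        have h1 := ih (by omega)
        have h2 : ∑ i ∈ Finset.range (m + 1), (f (x i) : ℂ) * (H (i + 1) - H i)
            - f (x (m + 1)) * H (m + 1) =
            (∑ i ∈ Finset.range m, (f (x i) : ℂ) * (H (i + 1) - H i) - f (x m) * H m) -
            ((f (x (m + 1)) - f (x m) : ℝ) : ℂ) * H (m + 1) := by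
          rw [Finset.sum_range_succ]
          push_cast
          ring
        have h3 := hf (hxI m (by omega)) (hxI (m + 1) hm) (hmono m)
        have h4 := hHG (m + 1) hm
        rw [h2]
        refine (norm_sub_le _ _).trans ?_
        rw [norm_mul, Complex.norm_real, Real.norm_of_nonneg (by linarith)]
        nlinarith
    have htel : ∑ i ∈ Finset.range (n + 1), (f (x (i + 1)) - f (x i)) * K * e =
        (f b - f a) * K * e := by
      rw [← Finset.sum_mul, ← Finset.sum_mul, Finset.sum_range_sub (fun i => f (x i)), hxn, hx0]
    have hfa := abs_le.1 (hM a (Set.left_mem_Icc.2 hab))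
    have hfb := abs_le.1 (hM b (Set.right_mem_Icc.2 hab))
    have h1 : ‖∑ i ∈ Finset.range (n + 1), (∫ s in x i..x (i + 1), (f s : ℂ) * g s) -
        ∑ i ∈ Finset.range (n + 1), (f (x i) : ℂ) * (H (i + 1) - H i)‖ ≤ (f b - f a) * K * e := by
      rw [← Finset.sum_sub_distrib, ← htel]
      exact norm_sum_le_of_le _ fun i hi => hdiff i (Finset.mem_range.1 hi)
    have h2 := habel (n + 1) le_rfl
    have hG0 : 0 ≤ G := (norm_nonneg _).trans (hHG 0 (by omega))
    have h3 : ‖(f (x (n + 1)) : ℂ) * H (n + 1)‖ ≤ M * G := by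
      rw [norm_mul, Complex.norm_real]
      exact mul_le_mul (hM _ (hxI _ le_rfl)) (hHG _ le_rfl) (norm_nonneg _) hM0
    rw [hxn, hx0] at h2
    rw [hxn] at h3
    have h4 : (f b - f a) * G ≤ 2 * M * G := by nlinarith
    have h5 : (f b - f a) * K * e ≤ 2 * M * K * (b - a) * (1 / (n + 1)) := by
      have : 2 * M * K * (b - a) * (1 / (n + 1)) = 2 * M * (K * e) := by
        rw [he]; ring
      rw [this, mul_assoc]
      exact mul_le_mul_of_nonneg_right (by linarith) (by positivity)
    set A := ∑ i ∈ Finset.range (n + 1), ∫ s in x i..x (i + 1), (f s : ℂ) * g s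
    set B := ∑ i ∈ Finset.range (n + 1), (f (x i) : ℂ) * (H (i + 1) - H i)
    have h6 : A = (A - B) + ((B - f b * H (n + 1)) + f b * H (n + 1)) := by ring
    rw [h6]
    refine (norm_add_le _ _).trans ?_
    have := norm_add_le (B - f b * H (n + 1)) (f b * H (n + 1))
    linarith
  have hlim : Filter.Tendsto (fun n : ℕ => 3 * M * G + (2 * M * K * (b - a)) * (1 / ((n : ℝ) + 1)))
      Filter.atTop (nhds (3 * M * G + (2 * M * K * (b - a)) * 0)) :=
    (tendsto_one_div_add_atTop_nhds_zero_nat.const_mul _).const_add _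
  rw [mul_zero, add_zero] at hlim
  exact ge_of_tendsto' hlim hmain

theorem BoundedVariationOn.exists_monotoneOn_decomposition {p : ℝ → ℂ} {a b : ℝ}
    (hp : BoundedVariationOn p (Set.Icc a b)) :
    ∃ f : Fin 4 → ℝ → ℝ, (∀ i, MonotoneOn (f i) (Set.Icc a b)) ∧
      ∀ x, p x = (f 0 x - f 1 x) + (f 2 x - f 3 x) * Complex.I := by
  have hre : BoundedVariationOn (fun x => (p x).re) (Set.Icc a b) :=
    (LipschitzWith.of_dist_le_mul (K := 1) fun x y => by
      rw [NNReal.coe_one, one_mul, Real.dist_eq, dist_eq_norm, ← Complex.sub_re]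
      exact Complex.abs_re_le_norm _ : LipschitzWith 1 Complex.re).comp_boundedVariationOn hp
  have him : BoundedVariationOn (fun x => (p x).im) (Set.Icc a b) :=
    (LipschitzWith.of_dist_le_mul (K := 1) fun x y => by
      rw [NNReal.coe_one, one_mul, Real.dist_eq, dist_eq_norm, ← Complex.sub_im]
      exact Complex.abs_im_le_norm _ : LipschitzWith 1 Complex.im).comp_boundedVariationOn hp
  obtain ⟨f0, f1, h0, h1, h01⟩ := hre.locallyBoundedVariationOn.exists_monotoneOn_sub_monotoneOn
  obtain ⟨f2, f3, h2, h3, h23⟩ := him.locallyBoundedVariationOn.exists_monotoneOn_sub_monotoneOn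
  refine ⟨![f0, f1, f2, f3], fun | 0 => h0 | 1 => h1 | 2 => h2 | 3 => h3, fun x => ?_⟩
  have e1 : (p x).re = f0 x - f1 x := congrFun h01 x
  have e2 : (p x).im = f2 x - f3 x := congrFun h23 x
  rw [← Complex.re_add_im (p x), e1, e2, Complex.ofReal_sub,
    Complex.ofReal_sub]
  rfl

theorem MonotoneOn.exists_abs_le {f : ℝ → ℝ} {a b : ℝ} (hf : MonotoneOn f (Set.Icc a b)) :
    ∃ M, ∀ x ∈ Set.Icc a b, |f x| ≤ M := by
  refine ⟨max |f a| |f b|, fun x hx => ?_⟩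
  have hab := hx.1.trans hx.2
  exact abs_le_max_abs_abs (hf (Set.left_mem_Icc.2 hab) hx hx.1)
    (hf hx (Set.right_mem_Icc.2 hab) hx.2)

theorem BoundedVariationOn.exists_norm_le {p : ℝ → ℂ} {a b : ℝ}
    (hp : BoundedVariationOn p (Set.Icc a b)) : ∃ M, 0 ≤ M ∧ ∀ x ∈ Set.Icc a b, ‖p x‖ ≤ M := by
  obtain ⟨f, hf, hpf⟩ := hp.exists_monotoneOn_decomposition
  choose M hM using fun i => (hf i).exists_abs_le
  refine ⟨max 0 (M 0 + M 1 + (M 2 + M 3)), le_max_left _ _, fun x hx => le_max_of_le_right ?_⟩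
  rw [hpf]
  refine (norm_add_le _ _).trans (add_le_add ?_ ?_)
  · refine (norm_sub_le _ _).trans (add_le_add ?_ ?_) <;> rw [Complex.norm_real]
    exacts [hM 0 x hx, hM 1 x hx]
  · rw [norm_mul, Complex.norm_I, mul_one]
    refine (norm_sub_le _ _).trans (add_le_add ?_ ?_) <;> rw [Complex.norm_real]
    exacts [hM 2 x hx, hM 3 x hx]

theorem BoundedVariationOn.aestronglyMeasurable_restrict {p : ℝ → ℂ} {a b : ℝ}
    (hp : BoundedVariationOn p (Set.Icc a b)) :
    AEStronglyMeasurable p (volume.restrict (Set.Icc a b)) := by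
  obtain ⟨f, hf, hpf⟩ := hp.exists_monotoneOn_decomposition
  have h : ∀ i, AEStronglyMeasurable (fun x => (f i x : ℂ)) (volume.restrict (Set.Icc a b)) :=
    fun i => (Complex.continuous_ofReal.measurable.comp_aemeasurable
      (aemeasurable_restrict_of_monotoneOn measurableSet_Icc (hf i))).aestronglyMeasurable
  rw [funext hpf]
  exact ((h 0).sub (h 1)).add (((h 2).sub (h 3)).mul_const _)

/-- Oscillatory integrals against a function of bounded variation. -/
theorem BoundedVariationOn.exists_norm_integral_mul_le {p : ℝ → ℂ} {a b : ℝ}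
    (hp : BoundedVariationOn p (Set.Icc a b)) : ∃ C, 0 ≤ C ∧ ∀ r x, a ≤ r → r ≤ x → x ≤ b →
      ∀ g : ℝ → ℂ, Continuous g → ∀ G, (∀ u ∈ Set.Icc r x, ‖∫ s in r..u, g s‖ ≤ G) →
        ‖∫ s in r..x, p s * g s‖ ≤ C * G := by
  obtain ⟨f, hf, hpf⟩ := hp.exists_monotoneOn_decomposition
  choose M hM using fun i => (hf i).exists_abs_le
  refine ⟨max 0 (3 * M 0 + 3 * M 1 + (3 * M 2 + 3 * M 3)), le_max_left _ _, ?_⟩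
  intro r x har hrx hxb g hg G hG
  have hG0 : 0 ≤ G := (norm_nonneg _).trans (hG r (Set.left_mem_Icc.2 hrx))
  have hsub : Set.Icc r x ⊆ Set.Icc a b := Set.Icc_subset_Icc har hxb
  have hi : ∀ i, IntervalIntegrable (fun s => (f i s : ℂ) * g s) volume r x := by
    intro i
    have h1 : IntervalIntegrable (f i) volume r x :=
      ((hf i).mono (by rw [Set.uIcc_of_le hrx]; exact hsub)).intervalIntegrable
    exact IntervalIntegrable.mul_continuousOn ⟨h1.1.ofReal, h1.2.ofReal⟩ hg.continuousOn
  have hb : ∀ i, ‖∫ s in r..x, (f i s : ℂ) * g s‖ ≤ 3 * M i * G := fun i =>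
    ((hf i).mono hsub).norm_integral_ofReal_mul_le hrx (fun y hy => hM i y (hsub hy)) hg hG
  have hsplit : ∫ s in r..x, p s * g s =
      ((∫ s in r..x, (f 0 s : ℂ) * g s) - ∫ s in r..x, (f 1 s : ℂ) * g s) +
      ((∫ s in r..x, (f 2 s : ℂ) * g s) - ∫ s in r..x, (f 3 s : ℂ) * g s) * Complex.I := by
    rw [← intervalIntegral.integral_sub (hi 0) (hi 1), ← intervalIntegral.integral_sub (hi 2) (hi 3),
      ← intervalIntegral.integral_mul_const, ← intervalIntegral.integral_add ((hi 0).sub (hi 1))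
        (((hi 2).sub (hi 3)).mul_const _)]
    refine intervalIntegral.integral_congr fun s _ => ?_
    rw [hpf]
    ring
  rw [hsplit]
  refine le_trans ?_ (mul_le_mul_of_nonneg_right (le_max_right _ _) hG0)
  refine (norm_add_le _ _).trans ?_
  rw [norm_mul, Complex.norm_I, mul_one]
  have h1 := norm_sub_le (∫ s in r..x, (f 0 s : ℂ) * g s) (∫ s in r..x, (f 1 s : ℂ) * g s)
  have h2 := norm_sub_le (∫ s in r..x, (f 2 s : ℂ) * g s) (∫ s in r..x, (f 3 s : ℂ) * g s)
  linarith [hb 0, hb 1, hb 2, hb 3]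

/-- The source of the factor `1/n` in the theorem: primitives of `e^{κs}` are bounded by `2M/‖κ‖`.
The bound `M` is only required on `[r, x]`, which later keeps the exponential weights sharp. -/
theorem BoundedVariationOn.exists_norm_integral_mul_exp_le {p : ℝ → ℂ} {a b : ℝ}
    (hp : BoundedVariationOn p (Set.Icc a b)) : ∃ C, 0 ≤ C ∧ ∀ r x, a ≤ r → r ≤ x → x ≤ b →
      ∀ κ : ℂ, κ ≠ 0 → ∀ M, (∀ u ∈ Set.Icc r x, ‖Complex.exp (κ * u)‖ ≤ M) →
        ‖∫ s in r..x, p s * Complex.exp (κ * s)‖ ≤ C * M / ‖κ‖ := by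
  obtain ⟨C, hC, h⟩ := hp.exists_norm_integral_mul_le
  refine ⟨2 * C, by positivity, fun r x har hrx hxb κ hκ M hM => ?_⟩
  have hκ' := norm_pos_iff.2 hκ
  refine (h r x har hrx hxb (fun s => Complex.exp (κ * s)) (by fun_prop) (2 * M / ‖κ‖)
    fun u hu => ?_).trans (le_of_eq (by ring))
  rw [integral_exp_mul_complex hκ, norm_div]
  refine div_le_div_of_nonneg_right ?_ hκ'.le
  have := norm_sub_le (Complex.exp (κ * u)) (Complex.exp (κ * r))
  linarith [hM u hu, hM r (Set.left_mem_Icc.2 hrx)]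

/-! ### Volterra integral operators -/

/-- Bounded measurable operator coefficients supported in `[0, T]`. -/
structure IsVolterraCoeff {E : Type*} [NormedAddCommGroup E] [NormedSpace ℂ E] (T : ℝ)
    (A : ℝ → E →L[ℂ] E) : Prop where
  aestronglyMeasurable : AEStronglyMeasurable A volume
  exists_norm_le : ∃ C, 0 ≤ C ∧ ∀ s, ‖A s‖ ≤ C
  eq_zero : ∀ s, s ∉ Set.Icc 0 T → A s = 0

namespace IsVolterraCoeff

variable {E : Type*} [NormedAddCommGroup E] [NormedSpace ℂ E] {T : ℝ} {A B : ℝ → E →L[ℂ] E}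

theorem add (hA : IsVolterraCoeff T A) (hB : IsVolterraCoeff T B) :
    IsVolterraCoeff T (fun s => A s + B s) := by
  refine ⟨hA.1.add hB.1, ?_, fun s hs => by rw [hA.3 s hs, hB.3 s hs, add_zero]⟩
  obtain ⟨C, hC0, hC⟩ := hA.2
  obtain ⟨D, hD0, hD⟩ := hB.2
  exact ⟨C + D, add_nonneg hC0 hD0, fun s => (norm_add_le _ _).trans (add_le_add (hC s) (hD s))⟩

theorem const_smul (hA : IsVolterraCoeff T A) (c : ℂ) : IsVolterraCoeff T (fun s => c • A s) := by
  refine ⟨hA.1.const_smul c, ?_, fun s hs => by rw [hA.3 s hs, smul_zero]⟩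
  obtain ⟨C, hC0, hC⟩ := hA.2
  refine ⟨‖c‖ * C, by positivity, fun s => ?_⟩
  rw [norm_smul]
  exact mul_le_mul_of_nonneg_left (hC s) (norm_nonneg _)

theorem integrable (hA : IsVolterraCoeff T A) (y : ℝ →ᵇ E) :
    Integrable (fun s => A s (y s)) := by
  obtain ⟨C, hC0, hC⟩ := hA.exists_norm_le
  have hi : Integrable ((Set.Icc 0 T).indicator fun _ : ℝ => C * ‖y‖) :=
    (integrable_indicator_iff measurableSet_Icc).2
      (integrableOn_const (by rw [Real.volume_Icc]; exact ENNReal.ofReal_ne_top))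
  refine hi.mono' ?_ (.of_forall fun s => ?_)
  · exact (ContinuousLinearMap.apply ℂ E : E →L[ℂ] (E →L[ℂ] E) →L[ℂ] E).aestronglyMeasurable_comp₂
      y.continuous.aestronglyMeasurable hA.1
  · by_cases hs : s ∈ Set.Icc 0 T
    · rw [Set.indicator_of_mem hs]
      exact (A s).le_of_opNorm_le_of_le (hC s) (y.norm_coe_le_norm s)
    · rw [hA.3 s hs, Set.indicator_of_notMem hs, zero_apply, norm_zero]

theorem norm_integral_le (hA : IsVolterraCoeff T A) (hT : 0 ≤ T) {C : ℝ}
    (hC : ∀ s, ‖A s‖ ≤ C) (y : ℝ →ᵇ E) (x : ℝ) :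
    ‖∫ s in (0 : ℝ)..x, A s (y s)‖ ≤ C * T * ‖y‖ := by
  have hi : Integrable ((Set.Icc 0 T).indicator fun _ : ℝ => C * ‖y‖) :=
    (integrable_indicator_iff measurableSet_Icc).2
      (integrableOn_const (by rw [Real.volume_Icc]; exact ENNReal.ofReal_ne_top))
  have hle : ∀ s, ‖A s (y s)‖ ≤ (Set.Icc 0 T).indicator (fun _ : ℝ => C * ‖y‖) s := by
    intro s
    by_cases hs : s ∈ Set.Icc 0 T
    · rw [Set.indicator_of_mem hs]
      exact (A s).le_of_opNorm_le_of_le (hC s) (y.norm_coe_le_norm s)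
    · rw [hA.3 s hs, Set.indicator_of_notMem hs, zero_apply, norm_zero]
  calc ‖∫ s in (0 : ℝ)..x, A s (y s)‖
      ≤ ∫ s in Set.uIoc 0 x, ‖A s (y s)‖ := intervalIntegral.norm_integral_le_integral_norm_uIoc
    _ ≤ ∫ s, ‖A s (y s)‖ :=
        setIntegral_le_integral (hA.integrable y).norm (.of_forall fun s => norm_nonneg _)
    _ ≤ ∫ s, (Set.Icc 0 T).indicator (fun _ : ℝ => C * ‖y‖) s :=
        integral_mono (hA.integrable y).norm hi hle
    _ = C * T * ‖y‖ := by
        rw [integral_indicator measurableSet_Icc, setIntegral_const, Real.volume_real_Icc_of_le hT,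
          smul_eq_mul]
        ring

/-- The Volterra operator `y ↦ ∫₀ˣ A(s) y(s) ds` on bounded continuous functions. -/
noncomputable def volterra (hA : IsVolterraCoeff T A) (hT : 0 ≤ T) : (ℝ →ᵇ E) →L[ℂ] (ℝ →ᵇ E) :=
  LinearMap.mkContinuousOfExistsBound
    { toFun := fun y => BoundedContinuousFunction.ofNormedAddCommGroup
        (fun x => ∫ s in (0 : ℝ)..x, A s (y s))
        (intervalIntegral.continuous_primitive (fun _ _ => (hA.integrable y).intervalIntegrable) 0)
        (hA.exists_norm_le.choose * T * ‖y‖)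
        (fun x => hA.norm_integral_le hT hA.exists_norm_le.choose_spec.2 y x)
      map_add' := fun y z => by
        ext1 x
        change ∫ s in (0 : ℝ)..x, A s ((y + z) s) = (∫ s in (0 : ℝ)..x, A s (y s)) +
          ∫ s in (0 : ℝ)..x, A s (z s)
        rw [← intervalIntegral.integral_add (hA.integrable y).intervalIntegrable
          (hA.integrable z).intervalIntegrable]
        simp only [BoundedContinuousFunction.coe_add, Pi.add_apply, map_add]
      map_smul' := fun c y => by
        ext1 x
        change ∫ s in (0 : ℝ)..x, A s ((c • y) s) = c • ∫ s in (0 : ℝ)..x, A s (y s)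
        rw [← intervalIntegral.integral_smul]
        simp only [BoundedContinuousFunction.coe_smul, map_smul] }
    ⟨hA.exists_norm_le.choose * T, fun y =>
      BoundedContinuousFunction.norm_ofNormedAddCommGroup_le _
        (mul_nonneg (mul_nonneg hA.exists_norm_le.choose_spec.1 hT) (norm_nonneg _))
        (fun x => hA.norm_integral_le hT hA.exists_norm_le.choose_spec.2 y x)⟩

theorem volterra_apply (hA : IsVolterraCoeff T A) (hT : 0 ≤ T) (y : ℝ →ᵇ E) (x : ℝ) :
    hA.volterra hT y x = ∫ s in (0 : ℝ)..x, A s (y s) := rfl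

theorem volterra_add (hA : IsVolterraCoeff T A) (hB : IsVolterraCoeff T B) (hT : 0 ≤ T) :
    (hA.add hB).volterra hT = hA.volterra hT + hB.volterra hT := by
  ext1 y
  ext1 x
  change ∫ s in (0 : ℝ)..x, (A s + B s) (y s) = (∫ s in (0 : ℝ)..x, A s (y s)) +
    ∫ s in (0 : ℝ)..x, B s (y s)
  rw [← intervalIntegral.integral_add (hA.integrable y).intervalIntegrable
    (hB.integrable y).intervalIntegrable]
  rfl

theorem volterra_const_smul (hA : IsVolterraCoeff T A) (c : ℂ) (hT : 0 ≤ T) :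
    (hA.const_smul c).volterra hT = c • hA.volterra hT := by
  ext1 y
  ext1 x
  change ∫ s in (0 : ℝ)..x, (c • A s) (y s) = c • ∫ s in (0 : ℝ)..x, A s (y s)
  rw [← intervalIntegral.integral_smul]
  rfl

/-- Coefficients vanish off `[0, T]`, so images of the operator are constant on each side of the
interval. This permits working with bounded continuous functions on the whole line. -/
theorem volterra_apply_of_nonpos (hA : IsVolterraCoeff T A) (hT : 0 ≤ T) (y : ℝ →ᵇ E) {x : ℝ}
    (hx : x ≤ 0) : hA.volterra hT y x = 0 := by
  rw [volterra_apply, intervalIntegral.integral_of_ge hx]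
  rw [setIntegral_congr_ae (g := fun _ => (0 : E)) measurableSet_Ioc]
  · simp
  · have : ∀ᵐ s : ℝ, s ≠ 0 := by simp [ae_iff, measure_singleton]
    filter_upwards [this] with s hs hs'
    rw [hA.3 s fun h => hs (le_antisymm hs'.2 h.1), zero_apply]

theorem volterra_apply_of_le (hA : IsVolterraCoeff T A) (hT : 0 ≤ T) (y : ℝ →ᵇ E) {x : ℝ}
    (hx : T ≤ x) : hA.volterra hT y x = hA.volterra hT y T := by
  rw [volterra_apply, volterra_apply, ← intervalIntegral.integral_add_adjacent_intervals
    (hA.integrable y).intervalIntegrable (hA.integrable y).intervalIntegrable (b := T),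
    add_eq_left, intervalIntegral.integral_of_le hx]
  rw [setIntegral_congr_fun (g := fun _ => (0 : E)) measurableSet_Ioc]
  · simp
  · intro s hs
    beta_reduce
    rw [hA.3 s fun h => absurd h.2 hs.1.not_ge, zero_apply]

/-- The usual factorial gain from integrating over a simplex. -/
theorem norm_volterra_pow_apply_le (hA : IsVolterraCoeff T A) (hT : 0 ≤ T) {C : ℝ}
    (hC : ∀ s, ‖A s‖ ≤ C) (y : ℝ →ᵇ E) (n : ℕ) :
    ∀ x, 0 ≤ x → ‖(hA.volterra hT ^ n) y x‖ ≤ (C * x) ^ n / n.factorial * ‖y‖ := by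
  induction n with
  | zero => intro x _; simpa using y.norm_coe_le_norm x
  | succ n ih =>
    intro x hx
    rw [pow_succ', mul_apply_eq_comp, volterra_apply]
    have hint : ∫ s in (0 : ℝ)..x, C * ((C * s) ^ n / n.factorial * ‖y‖) =
        (C * x) ^ (n + 1) / (n + 1).factorial * ‖y‖ := by
      have h1 : ∀ s : ℝ, C * ((C * s) ^ n / n.factorial * ‖y‖) =
          (C ^ (n + 1) / n.factorial * ‖y‖) * s ^ n := fun s => by ring
      simp_rw [h1]
      rw [intervalIntegral.integral_const_mul, integral_pow, zero_pow (Nat.succ_ne_zero n),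
        sub_zero, Nat.factorial_succ]
      push_cast
      field_simp
      ring
    rw [← hint]
    refine intervalIntegral.norm_integral_le_of_norm_le hx (.of_forall fun s hs => ?_)
      (by apply Continuous.intervalIntegrable; fun_prop)
    exact (A s).le_of_opNorm_le_of_le (hC s) (ih s hs.1.le)

variable [CompleteSpace E]

/-- Some power `Vⁿ` has norm below 1, so `1 - Vⁿ` is invertible. It is the product of the commuting
factors `1 - V` and `∑ Vⁱ`, so `1 - V` is invertible too. -/
theorem isUnit_one_sub_volterra (hA : IsVolterraCoeff T A) (hT : 0 ≤ T) :
    IsUnit (1 - hA.volterra hT) := by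
  obtain ⟨C, hC0, hC⟩ := hA.exists_norm_le
  have hlim := FloorSemiring.tendsto_pow_div_factorial_atTop (C * T)
  -- The exponent must be at least 1: only an image of `V` vanishes left of 0 and is constant right
  -- of `T`, which reduces the sup norm to `[0, T]`.
  obtain ⟨n, hn1, hn2⟩ := ((hlim.eventually_lt_const one_pos).and
    (Filter.eventually_ge_atTop 1)).exists
  have hnorm : ‖hA.volterra hT ^ n‖ < 1 := by
    refine lt_of_le_of_lt (ContinuousLinearMap.opNorm_le_bound _ (by positivity) fun y => ?_) hn1
    refine (BoundedContinuousFunction.norm_le (by positivity)).2 fun x => ?_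
    rcases le_total x 0 with hx | hx
    · obtain ⟨m, rfl⟩ := Nat.exists_eq_add_of_le' hn2
      rw [pow_succ', mul_apply_eq_comp, hA.volterra_apply_of_nonpos hT _ hx, norm_zero]
      positivity
    · have hTT := hA.norm_volterra_pow_apply_le hT hC y n
      rcases le_total x T with hx' | hx'
      · refine (hTT x hx).trans ?_
        gcongr
      · obtain ⟨m, rfl⟩ := Nat.exists_eq_add_of_le' hn2
        have h1 := hTT T hT
        rw [pow_succ', mul_apply_eq_comp] at h1 ⊢
        rwa [hA.volterra_apply_of_le hT _ hx']
  have h1 := isUnit_one_sub_of_norm_lt_one hnorm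
  rw [← mul_neg_geom_sum] at h1
  refine ((Commute.isUnit_mul_iff ?_).1 h1).1
  exact (Commute.one_left _).sub_left (Commute.sum_right _ _ _ fun i _ => Commute.self_pow _ i)

end IsVolterraCoeff

/-! ### Absolutely continuous functions as integrals -/

section AbsolutelyContinuous

variable {E : Type*} [NormedAddCommGroup E] [NormedSpace ℝ E]

theorem absolutelyContinuousOnInterval_const_add_integral {f : ℝ → E} {a b : ℝ} (hab : a ≤ b)
    (hf : IntervalIntegrable f volume a b) {C : ℝ} (hC0 : 0 ≤ C)
    (hC : ∀ x ∈ Set.Icc a b, ‖f x‖ ≤ C) (c : E) :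
    AbsolutelyContinuousOnInterval (fun x => c + ∫ s in a..x, f s) a b := by
  refine LipschitzOnWith.absolutelyContinuousOnInterval (K := ⟨C, hC0⟩) ?_
  rw [Set.uIcc_of_le hab]
  have hsub : ∀ x ∈ Set.Icc a b, ∀ y ∈ Set.Icc a b, IntervalIntegrable f volume x y :=
    fun x hx y hy => hf.mono_set (by
      rw [Set.uIcc_of_le hab]
      exact Set.uIcc_subset_Icc hx hy)
  refine LipschitzOnWith.of_dist_le_mul fun x hx y hy => ?_
  have ha : a ∈ Set.Icc a b := Set.left_mem_Icc.2 hab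
  rw [dist_add_left, dist_eq_norm, intervalIntegral.integral_interval_sub_left (hsub a ha x hx)
    (hsub a ha y hy), Real.dist_eq]
  refine intervalIntegral.norm_integral_le_of_norm_le_const fun s hs => hC s ?_
  exact Set.uIcc_subset_Icc hy hx (Set.uIoc_subset_uIcc hs)

variable [CompleteSpace E]

theorem ae_hasDerivAt_const_add_integral {f : ℝ → E} {a b : ℝ} (hab : a ≤ b)
    (hf : IntervalIntegrable f volume a b) (c : E) :
    ∀ᵐ x, x ∈ Set.Icc a b → HasDerivAt (fun x => c + ∫ s in a..x, f s) (f x) x := by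
  filter_upwards [hf.ae_hasDerivAt_integral] with x hx hxm
  rw [Set.uIcc_of_le hab] at hx
  exact (hx hxm a (Set.left_mem_Icc.2 hab)).const_add c

/-- The difference of the two sides is absolutely continuous with derivative zero almost everywhere,
hence constant. Boundedness of `f` makes its integral Lipschitz. -/
theorem AbsolutelyContinuousOnInterval.eq_add_integral {y f : ℝ → E} {a b : ℝ} (hab : a ≤ b)
    (hy : AbsolutelyContinuousOnInterval y a b) (hf : IntervalIntegrable f volume a b) {C : ℝ}
    (hC0 : 0 ≤ C) (hC : ∀ x ∈ Set.Icc a b, ‖f x‖ ≤ C)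
    (hd : ∀ᵐ x, x ∈ Set.Icc a b → HasDerivAt y (f x) x) :
    ∀ x ∈ Set.Icc a b, y x = y a + ∫ s in a..x, f s := by
  have h1 := absolutelyContinuousOnInterval_const_add_integral hab hf hC0 hC (y a)
  obtain ⟨c, hc⟩ := (hy.sub h1).const_of_ae_hasDerivAt_zero (by
    filter_upwards [hd, ae_hasDerivAt_const_add_integral hab hf (y a)] with x hx1 hx2 hx3
    rw [Set.uIcc_of_le hab] at hx3
    have := (hx1 hx3).sub (hx2 hx3)
    rwa [sub_self] at this)
  rw [Set.uIcc_of_le hab] at hc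
  have ha : c = 0 := by
    rw [← hc a (Set.left_mem_Icc.2 hab)]
    simp
  intro x hx
  have h2 := hc x hx
  rw [ha, Pi.sub_apply, sub_eq_zero] at h2
  exact h2

end AbsolutelyContinuous

/-- The integrating factor `e^{-κx}` applied to `u' = κu + f`; since `f` is merely integrable and
bounded, the product rule is used almost everywhere. -/
theorem exp_mul_eq_of_eq_add_integral {T : ℝ} (hT : 0 ≤ T) {u f : ℝ → ℂ} {κ c : ℂ}
    (hu : Continuous u) (hf : IntervalIntegrable f volume 0 T) {C : ℝ}
    (hC : ∀ x ∈ Set.Icc 0 T, ‖f x‖ ≤ C)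
    (huf : ∀ x ∈ Set.Icc 0 T, u x = c + ∫ s in (0 : ℝ)..x, (κ * u s + f s)) :
    ∀ x ∈ Set.Icc 0 T, Complex.exp (-κ * x) * u x =
      c + ∫ s in (0 : ℝ)..x, Complex.exp (-κ * s) * f s := by
  have h0 : (0 : ℝ) ∈ Set.Icc 0 T := Set.left_mem_Icc.2 hT
  have hC0 : 0 ≤ C := (norm_nonneg _).trans (hC 0 h0)
  obtain ⟨D, hD⟩ := isCompact_Icc.exists_bound_of_continuousOn (hu.continuousOn (s := Set.Icc 0 T))
  have hD0 : 0 ≤ D := (norm_nonneg _).trans (hD 0 h0)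
  have hecont : Continuous fun x : ℝ => Complex.exp (-κ * x) := by fun_prop
  obtain ⟨K, hK⟩ := isCompact_Icc.exists_bound_of_continuousOn
    (hecont.continuousOn (s := Set.Icc 0 T))
  have hK0 : 0 ≤ K := (norm_nonneg _).trans (hK 0 h0)
  have hi : IntervalIntegrable (fun s => κ * u s + f s) volume 0 T :=
    ((hu.const_smul κ).intervalIntegrable 0 T).add hf
  have hb : ∀ x ∈ Set.Icc 0 T, ‖κ * u x + f x‖ ≤ ‖κ‖ * D + C := fun x hx => by
    refine (norm_add_le _ _).trans (add_le_add ?_ (hC x hx))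
    rw [norm_mul]
    exact mul_le_mul_of_nonneg_left (hD x hx) (norm_nonneg _)
  have hac := absolutelyContinuousOnInterval_const_add_integral hT hi (by positivity) hb c
  have hae := ae_hasDerivAt_const_add_integral hT hi c
  have hexp : AbsolutelyContinuousOnInterval (fun x : ℝ => Complex.exp (-κ * x)) 0 T := by
    have : ContDiff ℝ 1 fun x : ℝ => Complex.exp (-κ * x) :=
      (contDiff_const.mul Complex.ofRealCLM.contDiff).cexp
    exact this.contDiffOn.absolutelyContinuousOnInterval
  have hder : ∀ x : ℝ, HasDerivAt (fun x : ℝ => Complex.exp (-κ * x))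
      (Complex.exp (-κ * x) * -κ) x := by
    intro x
    have h1 : HasDerivAt (fun x : ℂ => Complex.exp (-κ * x)) (Complex.exp (-κ * x) * (-κ * 1)) x :=
      ((hasDerivAt_id (x : ℂ)).const_mul (-κ)).cexp
    rw [mul_one] at h1
    exact h1.comp_ofReal
  have hmain := (hexp.smul hac).eq_add_integral hT (f := fun s => Complex.exp (-κ * s) * f s)
    (hf.continuousOn_mul hecont.continuousOn) (mul_nonneg hK0 hC0)
    (fun x hx => by
      rw [norm_mul]
      exact mul_le_mul (hK x hx) (hC x hx) (norm_nonneg _) hK0)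
    (by
      filter_upwards [hae] with x hx hxm
      have h1 := (hder x).smul (hx hxm)
      have h2 : Complex.exp (-κ * x) • (κ * u x + f x) +
          (Complex.exp (-κ * x) * -κ) • (c + ∫ s in (0 : ℝ)..x, (κ * u s + f s)) =
          Complex.exp (-κ * x) * f x := by
        rw [← huf x hxm, smul_eq_mul, smul_eq_mul]
        ring
      rwa [h2] at h1)
  intro x hx
  have h1 := hmain x hx
  rw [Pi.smul_apply', Pi.smul_apply', ← huf x hx] at h1
  simpa using h1

/-- Interchange of integrations over a triangle, obtained by parts: the product of `∫_r^x f` and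
`∫_0^r g` vanishes at `r = 0` and at `r = x`. -/
theorem integral_mul_integral_eq {x : ℝ} (hx : 0 ≤ x) {f g : ℝ → ℂ}
    (hf : IntervalIntegrable f volume 0 x) (hg : IntervalIntegrable g volume 0 x) {C D : ℝ}
    (hC : ∀ s ∈ Set.Icc 0 x, ‖f s‖ ≤ C) (hD : ∀ s ∈ Set.Icc 0 x, ‖g s‖ ≤ D) :
    ∫ s in (0 : ℝ)..x, f s * ∫ r in (0 : ℝ)..s, g r =
      ∫ r in (0 : ℝ)..x, g r * ∫ s in r..x, f s := by
  have h0 : (0 : ℝ) ∈ Set.Icc 0 x := Set.left_mem_Icc.2 hx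
  have hC0 : 0 ≤ C := (norm_nonneg _).trans (hC 0 h0)
  have hD0 : 0 ≤ D := (norm_nonneg _).trans (hD 0 h0)
  set c := ∫ s in (0 : ℝ)..x, f s with hc
  have hF := absolutelyContinuousOnInterval_const_add_integral hx hf.neg hC0
    (fun s hs => by rw [Pi.neg_apply, norm_neg]; exact hC s hs) c
  have hG := absolutelyContinuousOnInterval_const_add_integral hx hg hD0 hD 0
  have hF' := ae_hasDerivAt_const_add_integral hx hf.neg c
  have hG' := ae_hasDerivAt_const_add_integral hx hg 0
  set F : ℝ → ℂ := fun r => c + ∫ s in (0 : ℝ)..r, (-f) s with hFd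
  set G : ℝ → ℂ := fun r => 0 + ∫ s in (0 : ℝ)..r, g s with hGd
  obtain ⟨CF, hCF⟩ := hF.exists_bound
  obtain ⟨CG, hCG⟩ := hG.exists_bound
  have hFc := hF.continuousOn
  have hGc := hG.continuousOn
  rw [Set.uIcc_of_le hx] at hCF hCG
  have hCF0 : 0 ≤ CF := (norm_nonneg _).trans (hCF 0 h0)
  have hCG0 : 0 ≤ CG := (norm_nonneg _).trans (hCG 0 h0)
  have hFG1 : IntervalIntegrable (fun s => f s * G s) volume 0 x := hf.mul_continuousOn hGc
  have hFG2 : IntervalIntegrable (fun s => g s * F s) volume 0 x := hg.mul_continuousOn hFc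
  have hmain := (hF.smul hG).eq_add_integral hx (f := fun s => g s * F s - f s * G s)
    (hFG2.sub hFG1) (C := D * CF + C * CG) (by positivity)
    (fun s hs => by
      refine (norm_sub_le _ _).trans (add_le_add ?_ ?_) <;> rw [norm_mul]
      · exact mul_le_mul (hD s hs) (hCF s hs) (norm_nonneg _) hD0
      · exact mul_le_mul (hC s hs) (hCG s hs) (norm_nonneg _) hC0)
    (by
      filter_upwards [hF', hG'] with s h1 h2 hs
      have h3 := (h1 hs).smul (h2 hs)
      have h4 : F s • g s + (-f) s • G s = g s * F s - f s * G s := by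
        rw [Pi.neg_apply, smul_eq_mul, smul_eq_mul]
        ring
      rwa [h4] at h3)
  have h1 := hmain x (Set.right_mem_Icc.2 hx)
  have hFx : F x = 0 := by
    rw [hFd]
    beta_reduce
    rw [show (∫ s in (0 : ℝ)..x, (-f) s) = -c from intervalIntegral.integral_neg, add_neg_cancel]
  have hG0 : G 0 = 0 := by
    rw [hGd]
    beta_reduce
    rw [intervalIntegral.integral_same, add_zero]
  rw [Pi.smul_apply', Pi.smul_apply', hFx, hG0, zero_smul, smul_zero, zero_add,
    intervalIntegral.integral_sub hFG2 hFG1] at h1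
  have h2 := (sub_eq_zero.1 h1.symm).symm
  have h3 : ∀ s, G s = ∫ r in (0 : ℝ)..s, g r := fun s => zero_add _
  have h4 : ∀ r ∈ Set.uIcc 0 x, g r * F r = g r * ∫ s in r..x, f s := by
    intro r hr
    rw [Set.uIcc_of_le hx] at hr
    have hsub : ∀ a ∈ Set.Icc 0 x, ∀ b ∈ Set.Icc 0 x, IntervalIntegrable f volume a b :=
      fun a ha b hb => hf.mono_set (by
        rw [Set.uIcc_of_le hx]
        exact Set.uIcc_subset_Icc ha hb)
    have : F r = ∫ s in r..x, f s := by
      rw [hFd]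
      beta_reduce
      rw [show (∫ s in (0 : ℝ)..r, (-f) s) = -∫ s in (0 : ℝ)..r, f s from
        intervalIntegral.integral_neg, ← sub_eq_add_neg, hc]
      exact intervalIntegral.integral_interval_sub_left (hsub 0 h0 x (Set.right_mem_Icc.2 hx))
        (hsub 0 h0 r hr)
    rw [this]
  simp_rw [h3] at h2
  rw [h2]
  exact intervalIntegral.integral_congr h4

/-! ### Asymptotics of the diagonalized system -/

/-- Asymptotics of the solution `(u, v)` of `u' = iλu + av`, `v' = -iλv + bu` with initial value
`(1, 0)`, for `a` of bounded variation. -/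
theorem norm_sub_exp_le_of_canonical_system {T : ℝ} (hT : 0 ≤ T) {a b u v : ℝ → ℂ} {lam : ℂ}
    (hlam : lam ≠ 0) (hu : Continuous u) (hv : Continuous v)
    (ha : IntervalIntegrable a volume 0 T) (hb : IntervalIntegrable b volume 0 T) {Ma Mb Ca : ℝ}
    (hMa : ∀ x ∈ Set.Icc 0 T, ‖a x‖ ≤ Ma) (hMb : ∀ x ∈ Set.Icc 0 T, ‖b x‖ ≤ Mb) (hCa0 : 0 ≤ Ca)
    (hCa : ∀ r x, 0 ≤ r → r ≤ x → x ≤ T → ∀ κ : ℂ, κ ≠ 0 → ∀ M,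
      (∀ y ∈ Set.Icc r x, ‖Complex.exp (κ * y)‖ ≤ M) →
        ‖∫ s in r..x, a s * Complex.exp (κ * s)‖ ≤ Ca * M / ‖κ‖)
    (hueq : ∀ x ∈ Set.Icc 0 T,
      u x = 1 + ∫ s in (0 : ℝ)..x, (Complex.I * lam * u s + a s * v s))
    (hveq : ∀ x ∈ Set.Icc 0 T,
      v x = 0 + ∫ s in (0 : ℝ)..x, (-(Complex.I * lam) * v s + b s * u s))
    (hlarge : Ca * Mb * T ≤ ‖lam‖) :
    ‖u T - Complex.exp (Complex.I * lam * T)‖ ≤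
      Ca * Mb * T / ‖lam‖ * Real.exp (T * |lam.im|) := by
  have h0 : (0 : ℝ) ∈ Set.Icc 0 T := Set.left_mem_Icc.2 hT
  have hl0 : 0 < ‖lam‖ := norm_pos_iff.2 hlam
  have hMa0 : 0 ≤ Ma := (norm_nonneg _).trans (hMa 0 h0)
  have hMb0 : 0 ≤ Mb := (norm_nonneg _).trans (hMb 0 h0)
  obtain ⟨Cu, hCu⟩ := isCompact_Icc.exists_bound_of_continuousOn (hu.continuousOn (s := Set.Icc 0 T))
  obtain ⟨Cv, hCv⟩ := isCompact_Icc.exists_bound_of_continuousOn (hv.continuousOn (s := Set.Icc 0 T))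
  have hCu0 : 0 ≤ Cu := (norm_nonneg _).trans (hCu 0 h0)
  have hCv0 : 0 ≤ Cv := (norm_nonneg _).trans (hCv 0 h0)
  set σ := |lam.im| with hσ
  have hσ0 : 0 ≤ σ := abs_nonneg _
  have hnexp : ∀ (c : ℝ), ‖Complex.exp (Complex.I * lam * c)‖ = Real.exp (-(lam.im * c)) := by
    intro c
    rw [Complex.norm_exp]
    congr 1
    simp [Complex.mul_re]
  -- Integrating factors express `u` through `v` and `v` through `u`; substituting the second into
  -- the first eliminates `v`.
  have hu1 := exp_mul_eq_of_eq_add_integral hT (κ := Complex.I * lam) hu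
    (f := fun s => a s * v s) (ha.mul_continuousOn hv.continuousOn) (C := Ma * Cv)
    (fun x hx => by
      rw [norm_mul]
      exact mul_le_mul (hMa x hx) (hCv x hx) (norm_nonneg _) hMa0) hueq
  have hv1 := exp_mul_eq_of_eq_add_integral hT (κ := -(Complex.I * lam)) hv
    (f := fun s => b s * u s) (hb.mul_continuousOn hu.continuousOn) (C := Mb * Cu)
    (fun x hx => by
      rw [norm_mul]
      exact mul_le_mul (hMb x hx) (hCu x hx) (norm_nonneg _) hMb0) hveq
  have hbi : IntervalIntegrable (fun r : ℝ => Complex.exp (Complex.I * lam * r) * (b r * u r))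
      volume 0 T :=
    (hb.mul_continuousOn hu.continuousOn).continuousOn_mul (by fun_prop)
  have hai : IntervalIntegrable (fun r : ℝ => a r * Complex.exp (-2 * (Complex.I * lam) * r))
      volume 0 T := ha.mul_continuousOn (by fun_prop)
  have hcont1 : Continuous fun r : ℝ => Complex.exp (Complex.I * lam * r) := by fun_prop
  have hcont2 : Continuous fun r : ℝ => Complex.exp (-2 * (Complex.I * lam) * r) := by fun_prop
  obtain ⟨K1, hK1⟩ := isCompact_Icc.exists_bound_of_continuousOn
    (hcont1.continuousOn (s := Set.Icc 0 T))
  obtain ⟨K2, hK2⟩ := isCompact_Icc.exists_bound_of_continuousOn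
    (hcont2.continuousOn (s := Set.Icc 0 T))
  have hK10 : 0 ≤ K1 := (norm_nonneg _).trans (hK1 0 h0)
  -- the Volterra equation for `u` alone
  have key : ∀ x ∈ Set.Icc 0 T, u x - Complex.exp (Complex.I * lam * x) =
      ∫ r in (0 : ℝ)..x, (Complex.exp (Complex.I * lam * x) * (Complex.exp (Complex.I * lam * r) *
        (b r * u r))) * ∫ s in r..x, a s * Complex.exp (-2 * (Complex.I * lam) * s) := by
    intro x hx
    have hsub : Set.Icc 0 x ⊆ Set.Icc 0 T := Set.Icc_subset_Icc le_rfl hx.2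
    have hsub' : Set.uIcc 0 x ⊆ Set.uIcc 0 T := by
      rwa [Set.uIcc_of_le hx.1, Set.uIcc_of_le hT]
    have e1 : ∫ s in (0 : ℝ)..x, Complex.exp (-(Complex.I * lam) * s) * (a s * v s) =
        ∫ s in (0 : ℝ)..x, a s * Complex.exp (-2 * (Complex.I * lam) * s) *
          ∫ r in (0 : ℝ)..s, Complex.exp (Complex.I * lam * r) * (b r * u r) := by
      refine intervalIntegral.integral_congr fun s hs => ?_
      rw [Set.uIcc_of_le hx.1] at hs
      have h1 := hv1 s (hsub hs)
      rw [neg_neg, zero_add] at h1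
      rw [← h1]
      have h2 : Complex.exp (-(Complex.I * lam) * s) =
          Complex.exp (-2 * (Complex.I * lam) * s) * Complex.exp (Complex.I * lam * s) := by
        rw [← Complex.exp_add]
        congr 1
        ring
      rw [h2]
      ring
    -- After the interchange `a` stands in the inner integral against a pure exponential, without
    -- the unknown `u`, so the oscillatory estimate applies to it.
    rw [integral_mul_integral_eq hx.1 (hai.mono_set hsub') (hbi.mono_set hsub')
      (C := Ma * K2) (D := K1 * (Mb * Cu))
      (fun s hs => by
        rw [norm_mul]
        exact mul_le_mul (hMa s (hsub hs)) (hK2 s (hsub hs)) (norm_nonneg _) hMa0)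
      (fun s hs => by
        rw [norm_mul, norm_mul]
        exact mul_le_mul (hK1 s (hsub hs)) (mul_le_mul (hMb s (hsub hs)) (hCu s (hsub hs))
          (norm_nonneg _) hMb0) (by positivity) hK10)] at e1
    have h1 := hu1 x hx
    rw [e1] at h1
    have h2 : u x = Complex.exp (Complex.I * lam * x) *
        (Complex.exp (-(Complex.I * lam) * x) * u x) := by
      rw [← mul_assoc, ← Complex.exp_add]
      rw [show Complex.I * lam * x + -(Complex.I * lam) * x = 0 by ring, Complex.exp_zero, one_mul]
    rw [h2, h1, mul_add, mul_one, add_sub_cancel_left, ← intervalIntegral.integral_const_mul]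
    refine intervalIntegral.integral_congr fun r _ => ?_
    ring
  -- the kernel is small
  have hker : ∀ r x, 0 ≤ r → r ≤ x → x ≤ T →
      ‖Complex.exp (Complex.I * lam * x) * Complex.exp (Complex.I * lam * r) *
        ∫ s in r..x, a s * Complex.exp (-2 * (Complex.I * lam) * s)‖ ≤
      Ca / (2 * ‖lam‖) * Real.exp (σ * (x - r)) := by
    intro r x hr hrx hxT
    have hκ : -2 * (Complex.I * lam) ≠ 0 :=
      mul_ne_zero (by norm_num) (mul_ne_zero Complex.I_ne_zero hlam)
    have hκn : ‖-2 * (Complex.I * lam)‖ = 2 * ‖lam‖ := by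
      rw [norm_mul, norm_neg, Complex.norm_ofNat, norm_mul, Complex.norm_I, one_mul]
    -- For `y ∈ [r, x]` one has `|2y - x - r| ≤ x - r`, whence this bound for the exponential. Its
    -- part `Im λ (x + r)` cancels against the two prefactors and leaves the weight `e^{σ(x - r)}`.
    have h1 := hCa r x hr hrx hxT _ hκ (Real.exp (σ * (x - r) + lam.im * (x + r))) fun y hy => by
      rw [show -2 * (Complex.I * lam) * (y : ℂ) = Complex.I * lam * ((-2 * y : ℝ) : ℂ) by
        push_cast; ring, hnexp, Real.exp_le_exp]
      have h2 : lam.im * (2 * y - x - r) ≤ σ * (x - r) := by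
        refine (le_abs_self _).trans ?_
        rw [abs_mul]
        exact mul_le_mul_of_nonneg_left
          (abs_le.2 ⟨by linarith [hy.1, hy.2], by linarith [hy.1, hy.2]⟩) hσ0
      linarith
    rw [norm_mul, norm_mul, hnexp, hnexp]
    rw [hκn] at h1
    refine (mul_le_mul_of_nonneg_left h1 (by positivity)).trans (le_of_eq ?_)
    have h3 : Real.exp (σ * (x - r)) = Real.exp (-(lam.im * x)) * Real.exp (-(lam.im * r)) *
        Real.exp (σ * (x - r) + lam.im * (x + r)) := by
      rw [← Real.exp_add, ← Real.exp_add]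
      congr 1
      ring
    rw [h3]
    ring
  -- bound by the maximum of the weighted solution
  have hwc : ContinuousOn (fun x => ‖u x‖ * Real.exp (-(σ * x))) (Set.Icc 0 T) := by fun_prop
  obtain ⟨x0, hx0, hmax⟩ := isCompact_Icc.exists_isMaxOn ⟨0, h0⟩ hwc
  set S := ‖u x0‖ * Real.exp (-(σ * x0)) with hS
  have hS0 : 0 ≤ S := by positivity
  have huS : ∀ r ∈ Set.Icc 0 T, ‖u r‖ ≤ S * Real.exp (σ * r) := by
    intro r hr
    have h1 : ‖u r‖ * Real.exp (-(σ * r)) ≤ S := hmax hr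
    have h2 := mul_le_mul_of_nonneg_right h1 (Real.exp_pos (σ * r)).le
    rwa [mul_assoc, ← Real.exp_add, neg_add_cancel, Real.exp_zero, mul_one] at h2
  have hdiff : ∀ x ∈ Set.Icc 0 T, ‖u x - Complex.exp (Complex.I * lam * x)‖ ≤
      Ca * Mb * T / (2 * ‖lam‖) * S * Real.exp (σ * x) := by
    intro x hx
    rw [key x hx]
    have h1 := intervalIntegral.norm_integral_le_of_norm_le_const (a := 0) (b := x)
      (f := fun r => (Complex.exp (Complex.I * lam * x) * (Complex.exp (Complex.I * lam * r) *
        (b r * u r))) * ∫ s in r..x, a s * Complex.exp (-2 * (Complex.I * lam) * s))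
      (C := Ca / (2 * ‖lam‖) * Real.exp (σ * x) * (Mb * S)) (fun r hr => by
        rw [Set.uIoc_of_le hx.1] at hr
        have hrT : r ∈ Set.Icc 0 T := ⟨hr.1.le, hr.2.trans hx.2⟩
        have h2 := hker r x hr.1.le hr.2 hx.2
        have h3 : ‖b r * u r‖ ≤ Mb * (S * Real.exp (σ * r)) := by
          rw [norm_mul]
          exact mul_le_mul (hMb r hrT) (huS r hrT) (norm_nonneg _) hMb0
        have h4 := mul_le_mul h2 h3 (norm_nonneg _) (by positivity)
        rw [← norm_mul] at h4
        have h5 : Real.exp (σ * x) = Real.exp (σ * (x - r)) * Real.exp (σ * r) := by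
          rw [← Real.exp_add]; congr 1; ring
        rw [h5]
        calc _ = _ := by congr 1; ring
          _ ≤ _ := h4
          _ = _ := by ring)
    rw [sub_zero, abs_of_nonneg hx.1] at h1
    refine h1.trans ?_
    have h2 : Ca / (2 * ‖lam‖) * Real.exp (σ * x) * (Mb * S) * x ≤
        Ca / (2 * ‖lam‖) * Real.exp (σ * x) * (Mb * S) * T :=
      mul_le_mul_of_nonneg_left hx.2 (by positivity)
    refine h2.trans (le_of_eq (by ring))
  -- At the maximum point the equation gives `S ≤ 1 + S/2`, because `hlarge` makes the constant in
  -- `hdiff` at most `1/2`.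
  have hS2 : S ≤ 2 := by
    have h1 := hdiff x0 hx0
    have h2 : ‖u x0‖ ≤ Real.exp (σ * x0) + Ca * Mb * T / (2 * ‖lam‖) * S * Real.exp (σ * x0) := by
      have h3 : ‖Complex.exp (Complex.I * lam * x0)‖ ≤ Real.exp (σ * x0) := by
        rw [hnexp, Real.exp_le_exp]
        have := mul_le_mul_of_nonneg_right (neg_abs_le lam.im) hx0.1
        rw [← hσ] at this
        linarith
      have h4 := norm_add_le (Complex.exp (Complex.I * lam * x0))
        (u x0 - Complex.exp (Complex.I * lam * x0))
      rw [add_sub_cancel] at h4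
      linarith
    have h3 := mul_le_mul_of_nonneg_right h2 (Real.exp_pos (-(σ * x0))).le
    have h4 : Real.exp (σ * x0) * Real.exp (-(σ * x0)) = 1 := by
      rw [← Real.exp_add, add_neg_cancel, Real.exp_zero]
    have h5 : Ca * Mb * T / (2 * ‖lam‖) ≤ 1 / 2 := by
      rw [div_le_iff₀ (by positivity)]
      linarith
    rw [add_mul, mul_assoc _ (Real.exp (σ * x0)), h4, mul_one, ← hS] at h3
    have h6 := mul_le_mul_of_nonneg_right h5 hS0
    linarith
  have h1 := hdiff T (Set.right_mem_Icc.2 hT)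
  rw [mul_comm T σ]
  refine h1.trans (mul_le_mul_of_nonneg_right ?_ (Real.exp_pos _).le)
  have h2 : Ca * Mb * T / (2 * ‖lam‖) * S ≤ Ca * Mb * T / (2 * ‖lam‖) * 2 :=
    mul_le_mul_of_nonneg_left hS2 (by positivity)
  refine h2.trans (le_of_eq ?_)
  field_simp

/-! ### The solution operator, the monodromy matrix and the discriminant -/

/-- Makes solutions entire in the spectral parameter, which enters the integral operator affinely.
-/
theorem differentiable_inverse_one_sub {X : Type*} [NormedAddCommGroup X] [NormedSpace ℂ X]
    [CompleteSpace X] (A B : X →L[ℂ] X) (h : ∀ z : ℂ, IsUnit (1 - (A + z • B))) :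
    Differentiable ℂ fun z : ℂ => Ring.inverse (1 - (A + z • B)) := by
  have h1 : Differentiable ℂ fun z : ℂ => 1 - (A + z • B) := by fun_prop
  exact h1.inverse h

namespace Dirac

/-- Multiplication by a `2 × 2` matrix as a continuous linear map. -/
noncomputable def mulVecCLM (M : Matrix (Fin 2) (Fin 2) ℂ) : (Fin 2 → ℂ) →L[ℂ] (Fin 2 → ℂ) :=
  LinearMap.toContinuousLinearMap (Matrix.mulVecLin M)

theorem mulVecCLM_apply (M : Matrix (Fin 2) (Fin 2) ℂ) (v : Fin 2 → ℂ) :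
    mulVecCLM M v = Matrix.mulVec M v := rfl

/-- The potential part of the coefficient of `y' = J⁻¹ (λ - Q) y`. -/
noncomputable def potCoeff (p q : ℝ → ℂ) : ℝ → (Fin 2 → ℂ) →L[ℂ] (Fin 2 → ℂ) :=
  (Set.Icc 0 Real.pi).indicator fun s =>
    p s • mulVecCLM !![0, -1; -1, 0] + q s • mulVecCLM !![1, 0; 0, -1]

/-- The spectral part of the coefficient of `y' = J⁻¹ (λ - Q) y`. -/
noncomputable def rotCoeff : ℝ → (Fin 2 → ℂ) →L[ℂ] (Fin 2 → ℂ) :=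
  (Set.Icc 0 Real.pi).indicator fun _ => mulVecCLM !![0, -1; 1, 0]

theorem rotCoeff_apply {s : ℝ} (hs : s ∈ Set.Icc 0 Real.pi) (v : Fin 2 → ℂ) :
    rotCoeff s v = Matrix.mulVec !![0, -1; 1, 0] v := by
  rw [rotCoeff, Set.indicator_of_mem hs]
  rfl

theorem coeff_apply_zero {p q : ℝ → ℂ} {s : ℝ} (hs : s ∈ Set.Icc 0 Real.pi) (lam : ℂ)
    (v : Fin 2 → ℂ) : (potCoeff p q s + lam • rotCoeff s) v 0 = q s * v 0 - (p s + lam) * v 1 := by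
  rw [potCoeff, rotCoeff, Set.indicator_of_mem hs, Set.indicator_of_mem hs]
  simp [mulVecCLM_apply, dotProduct]
  ring

theorem coeff_apply_one {p q : ℝ → ℂ} {s : ℝ} (hs : s ∈ Set.Icc 0 Real.pi) (lam : ℂ)
    (v : Fin 2 → ℂ) : (potCoeff p q s + lam • rotCoeff s) v 1 = (lam - p s) * v 0 - q s * v 1 := by
  rw [potCoeff, rotCoeff, Set.indicator_of_mem hs, Set.indicator_of_mem hs]
  simp [mulVecCLM_apply, dotProduct]
  ring

theorem isVolterraCoeff_rotCoeff : IsVolterraCoeff Real.pi rotCoeff := by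
  refine ⟨aestronglyMeasurable_const.indicator measurableSet_Icc,
    ⟨‖mulVecCLM !![0, -1; 1, 0]‖, norm_nonneg _, fun s => norm_indicator_le_norm_self _ _⟩,
    fun s hs => Set.indicator_of_notMem hs _⟩

/-- A potential of bounded variation. -/
structure IsBVPotential (p q : ℝ → ℂ) : Prop where
  left : BoundedVariationOn p (Set.Icc 0 Real.pi)
  right : BoundedVariationOn q (Set.Icc 0 Real.pi)

variable {p q : ℝ → ℂ}

theorem IsBVPotential.isVolterraCoeff (hQ : IsBVPotential p q) :
    IsVolterraCoeff Real.pi (potCoeff p q) := by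
  obtain ⟨Mp, hp0, hp⟩ := hQ.left.exists_norm_le
  obtain ⟨Mq, hq0, hq⟩ := hQ.right.exists_norm_le
  set P := mulVecCLM !![0, -1; -1, 0]
  set R := mulVecCLM !![1, 0; 0, -1]
  refine ⟨(aestronglyMeasurable_indicator_iff measurableSet_Icc).2
    ((hQ.left.aestronglyMeasurable_restrict.smul_const P).add
      (hQ.right.aestronglyMeasurable_restrict.smul_const R)),
    ⟨Mp * ‖P‖ + Mq * ‖R‖, by positivity, fun s => ?_⟩, fun s hs => Set.indicator_of_notMem hs _⟩
  by_cases hs : s ∈ Set.Icc 0 Real.pi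
  · rw [potCoeff, Set.indicator_of_mem hs]
    refine (norm_add_le _ _).trans (add_le_add ?_ ?_) <;> rw [norm_smul]
    · exact mul_le_mul_of_nonneg_right (hp s hs) (norm_nonneg _)
    · exact mul_le_mul_of_nonneg_right (hq s hs) (norm_nonneg _)
  · rw [potCoeff, Set.indicator_of_notMem hs, norm_zero]
    positivity

/-- The integral operator of the system `y' = J⁻¹ (λ - Q) y`. -/
noncomputable def sysOp (hQ : IsBVPotential p q) (lam : ℂ) :
    (ℝ →ᵇ (Fin 2 → ℂ)) →L[ℂ] (ℝ →ᵇ (Fin 2 → ℂ)) :=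
  hQ.isVolterraCoeff.volterra Real.pi_pos.le +
    lam • isVolterraCoeff_rotCoeff.volterra Real.pi_pos.le

theorem sysOp_eq (hQ : IsBVPotential p q) (lam : ℂ) : sysOp hQ lam =
    (hQ.isVolterraCoeff.add (isVolterraCoeff_rotCoeff.const_smul lam)).volterra Real.pi_pos.le := by
  rw [IsVolterraCoeff.volterra_add _ (isVolterraCoeff_rotCoeff.const_smul lam),
    IsVolterraCoeff.volterra_const_smul, sysOp]

theorem isUnit_one_sub_sysOp (hQ : IsBVPotential p q) (lam : ℂ) : IsUnit (1 - sysOp hQ lam) := by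
  rw [sysOp_eq]
  exact IsVolterraCoeff.isUnit_one_sub_volterra _ _

/-- The solution operator of the system `y' = J⁻¹ (λ - Q) y`. -/
noncomputable def solOp (hQ : IsBVPotential p q) (lam : ℂ) :
    (ℝ →ᵇ (Fin 2 → ℂ)) →L[ℂ] (ℝ →ᵇ (Fin 2 → ℂ)) :=
  Ring.inverse (1 - sysOp hQ lam)

theorem differentiable_solOp (hQ : IsBVPotential p q) : Differentiable ℂ (solOp hQ) :=
  differentiable_inverse_one_sub _ _ (isUnit_one_sub_sysOp hQ)

theorem sub_sysOp_solOp (hQ : IsBVPotential p q) (lam : ℂ) (f : ℝ →ᵇ (Fin 2 → ℂ)) :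
    solOp hQ lam f - sysOp hQ lam (solOp hQ lam f) = f :=
  DFunLike.congr_fun (Ring.mul_inverse_cancel _ (isUnit_one_sub_sysOp hQ lam)) f

theorem solOp_sub_sysOp (hQ : IsBVPotential p q) (lam : ℂ) (y : ℝ →ᵇ (Fin 2 → ℂ)) :
    solOp hQ lam (y - sysOp hQ lam y) = y :=
  DFunLike.congr_fun (Ring.inverse_mul_cancel _ (isUnit_one_sub_sysOp hQ lam)) y

/-- Constant functions, as a continuous linear map. -/
noncomputable def constCLM : (Fin 2 → ℂ) →L[ℂ] (ℝ →ᵇ (Fin 2 → ℂ)) :=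
  LinearMap.toContinuousLinearMap
    { toFun := BoundedContinuousFunction.const ℝ
      map_add' := fun _ _ => rfl
      map_smul' := fun _ _ => rfl }

theorem constCLM_apply (c : Fin 2 → ℂ) (x : ℝ) : constCLM c x = c := rfl

/-- The solution of `y' = J⁻¹ (λ - Q) y` with initial value `c`. -/
noncomputable def sol (hQ : IsBVPotential p q) (lam : ℂ) :
    (Fin 2 → ℂ) →L[ℂ] (ℝ →ᵇ (Fin 2 → ℂ)) :=
  (solOp hQ lam).comp constCLM

theorem integrable_sysOp (hQ : IsBVPotential p q) (lam : ℂ) (y : ℝ →ᵇ (Fin 2 → ℂ)) :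
    Integrable fun s => (potCoeff p q s + lam • rotCoeff s) (y s) :=
  (hQ.isVolterraCoeff.add (isVolterraCoeff_rotCoeff.const_smul lam)).integrable y

theorem sysOp_apply (hQ : IsBVPotential p q) (lam : ℂ) (y : ℝ →ᵇ (Fin 2 → ℂ)) (x : ℝ) :
    sysOp hQ lam y x = ∫ s in (0 : ℝ)..x, (potCoeff p q s + lam • rotCoeff s) (y s) := by
  rw [sysOp_eq, IsVolterraCoeff.volterra_apply]

theorem sol_apply (hQ : IsBVPotential p q) (lam : ℂ) (c : Fin 2 → ℂ) (x : ℝ) :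
    sol hQ lam c x =
      c + ∫ s in (0 : ℝ)..x, (potCoeff p q s + lam • rotCoeff s) (sol hQ lam c s) := by
  have h := DFunLike.congr_fun (sub_sysOp_solOp hQ lam (constCLM c)) x
  rw [BoundedContinuousFunction.coe_sub, Pi.sub_apply, constCLM_apply, sysOp_apply,
    sub_eq_iff_eq_add] at h
  exact h

theorem sol_apply_zero (hQ : IsBVPotential p q) (lam : ℂ) (c : Fin 2 → ℂ) :
    sol hQ lam c 0 = c := by
  rw [sol_apply, intervalIntegral.integral_same, add_zero]

theorem sol_apply_component (hQ : IsBVPotential p q) (lam : ℂ) (c : Fin 2 → ℂ) (x : ℝ)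
    (i : Fin 2) : sol hQ lam c x i =
      c i + ∫ s in (0 : ℝ)..x, (potCoeff p q s + lam • rotCoeff s) (sol hQ lam c s) i := by
  have h1 := (ContinuousLinearMap.proj (R := ℂ) (φ := fun _ : Fin 2 => ℂ) i).intervalIntegral_comp_comm
    ((integrable_sysOp hQ lam (sol hQ lam c)).intervalIntegrable (a := 0) (b := x))
  have h2 := congrFun (sol_apply hQ lam c x) i
  rw [Pi.add_apply] at h2
  rw [h2]
  congr 1
  exact h1.symm

/-- The monodromy matrix. -/
noncomputable def monodromy (hQ : IsBVPotential p q) (lam : ℂ) : Matrix (Fin 2) (Fin 2) ℂ :=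
  Matrix.of fun i j => sol hQ lam (Pi.single j 1) Real.pi i

theorem differentiable_sol_apply (hQ : IsBVPotential p q) (c : Fin 2 → ℂ) :
    Differentiable ℂ fun lam => sol hQ lam c :=
  fun lam => (differentiable_solOp hQ lam).clm_apply (differentiableAt_const _)

theorem differentiable_monodromy (hQ : IsBVPotential p q) (i j : Fin 2) :
    Differentiable ℂ fun lam => monodromy hQ lam i j :=
  ((ContinuousLinearMap.proj (R := ℂ) (φ := fun _ : Fin 2 => ℂ) i).comp
    (BoundedContinuousFunction.evalCLM ℂ Real.pi)).differentiable.comp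
    (differentiable_sol_apply hQ (Pi.single j 1))

theorem sol_pi (hQ : IsBVPotential p q) (lam : ℂ) (c : Fin 2 → ℂ) :
    sol hQ lam c Real.pi = Matrix.mulVec (monodromy hQ lam) c := by
  have hc : c = c 0 • Pi.single 0 1 + c 1 • Pi.single 1 1 := by
    ext i
    fin_cases i <;> simp
  ext i
  conv_lhs => rw [hc]
  rw [map_add, map_smul, map_smul, Matrix.mulVec, dotProduct, Fin.sum_univ_two]
  change c 0 * sol hQ lam (Pi.single 0 1) Real.pi i + c 1 * sol hQ lam (Pi.single 1 1) Real.pi i =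
    sol hQ lam (Pi.single 0 1) Real.pi i * c 0 + sol hQ lam (Pi.single 1 1) Real.pi i * c 1
  ring

theorem exists_norm_coeff_apply_le (hQ : IsBVPotential p q) (lam : ℂ) (y : ℝ →ᵇ (Fin 2 → ℂ)) :
    ∃ C, 0 ≤ C ∧ ∀ s, ‖(potCoeff p q s + lam • rotCoeff s) (y s)‖ ≤ C := by
  obtain ⟨C, hC0, hC⟩ :=
    (hQ.isVolterraCoeff.add (isVolterraCoeff_rotCoeff.const_smul lam)).exists_norm_le
  exact ⟨C * ‖y‖, by positivity, fun s =>
    ContinuousLinearMap.le_of_opNorm_le_of_le _ (hC s) (y.norm_coe_le_norm s)⟩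

/-- The Wronskian is constant because the coefficient matrix has trace `q - q = 0`. -/
theorem det_monodromy (hQ : IsBVPotential p q) (lam : ℂ) : (monodromy hQ lam).det = 1 := by
  set y := sol hQ lam (Pi.single 0 1) with hy
  set z := sol hQ lam (Pi.single 1 1) with hz
  have hpi := Real.pi_pos.le
  have hac : ∀ (c : Fin 2 → ℂ) (i : Fin 2),
      AbsolutelyContinuousOnInterval (fun x => sol hQ lam c x i) 0 Real.pi ∧
      ∀ᵐ x, x ∈ Set.Icc 0 Real.pi → HasDerivAt (fun x => sol hQ lam c x i)
        ((potCoeff p q x + lam • rotCoeff x) (sol hQ lam c x) i) x := by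
    intro c i
    obtain ⟨C, hC0, hC⟩ := exists_norm_coeff_apply_le hQ lam (sol hQ lam c)
    have hi : IntervalIntegrable (fun s => (potCoeff p q s + lam • rotCoeff s) (sol hQ lam c s) i)
        volume 0 Real.pi :=
      ((ContinuousLinearMap.proj (R := ℂ) (φ := fun _ : Fin 2 => ℂ) i).integrable_comp
        (integrable_sysOp hQ lam (sol hQ lam c))).intervalIntegrable
    rw [show (fun x => sol hQ lam c x i) = _ from funext fun x => sol_apply_component hQ lam c x i]
    exact ⟨absolutelyContinuousOnInterval_const_add_integral hpi hi hC0
      (fun x _ => (norm_le_pi_norm _ i).trans (hC x)) _, ae_hasDerivAt_const_add_integral hpi hi _⟩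
  obtain ⟨hy0, hy0'⟩ := hac (Pi.single 0 1) 0
  obtain ⟨hy1, hy1'⟩ := hac (Pi.single 0 1) 1
  obtain ⟨hz0, hz0'⟩ := hac (Pi.single 1 1) 0
  obtain ⟨hz1, hz1'⟩ := hac (Pi.single 1 1) 1
  have hW := ((hy0.smul hz1).sub (hz0.smul hy1)).eq_add_integral hpi (f := fun _ => 0)
    (by simp) (le_refl 0) (fun x _ => by simp) (by
      filter_upwards [hy0', hy1', hz0', hz1'] with x h1 h2 h3 h4 hx
      have h5 := ((h1 hx).smul (h4 hx)).sub ((h3 hx).smul (h2 hx))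
      rw [coeff_apply_zero hx, coeff_apply_zero hx, coeff_apply_one hx, coeff_apply_one hx] at h5
      convert h5 using 1
      simp only [smul_eq_mul]
      ring)
  have h1 := hW Real.pi (Set.right_mem_Icc.2 hpi)
  rw [intervalIntegral.integral_zero, add_zero] at h1
  simp only [Pi.sub_apply, Pi.mul_apply, smul_eq_mul, sol_apply_zero] at h1
  rw [Matrix.det_fin_two]
  simp only [monodromy, Matrix.of_apply]
  simpa using h1

/-- The discriminant. -/
noncomputable def disc (hQ : IsBVPotential p q) (lam : ℂ) : ℂ := (monodromy hQ lam).trace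

theorem differentiable_disc (hQ : IsBVPotential p q) : Differentiable ℂ (disc hQ) := by
  unfold disc
  simp only [Matrix.trace_fin_two]
  exact (differentiable_monodromy hQ 0 0).add (differentiable_monodromy hQ 1 1)

/-- The combinations `q + c p` with `|c| = 1` contain the off-diagonal coefficients of the
diagonalized system; one constant serves all of them. -/
theorem IsBVPotential.exists_osc (hQ : IsBVPotential p q) : ∃ C, 0 ≤ C ∧ ∀ c : ℂ, ‖c‖ = 1 →
    ∀ r x, 0 ≤ r → r ≤ x → x ≤ Real.pi → ∀ κ : ℂ, κ ≠ 0 → ∀ M,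
      (∀ y ∈ Set.Icc r x, ‖Complex.exp (κ * y)‖ ≤ M) →
        ‖∫ s in r..x, (q s + c * p s) * Complex.exp (κ * s)‖ ≤ C * M / ‖κ‖ := by
  obtain ⟨Cp, hp0, hp⟩ := hQ.left.exists_norm_integral_mul_exp_le
  obtain ⟨Cq, hq0, hq⟩ := hQ.right.exists_norm_integral_mul_exp_le
  refine ⟨Cq + Cp, by positivity, fun c hc r x hr hrx hx κ hκ M hM => ?_⟩
  have hint : ∀ {f : ℝ → ℂ}, BoundedVariationOn f (Set.Icc 0 Real.pi) →
      IntervalIntegrable (fun s : ℝ => f s * Complex.exp (κ * s)) volume r x := by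
    intro f hf
    obtain ⟨M, -, hM⟩ := hf.exists_norm_le
    have h1 : IntegrableOn f (Set.Icc 0 Real.pi) :=
      Integrable.of_bound hf.aestronglyMeasurable_restrict M (ae_restrict_of_forall_mem measurableSet_Icc hM)
    have h2 : IntervalIntegrable f volume r x := by
      rw [intervalIntegrable_iff, Set.uIoc_of_le hrx]
      exact h1.mono_set fun s hs => ⟨hr.trans hs.1.le, hs.2.trans hx⟩
    exact h2.mul_continuousOn (by fun_prop)
  have h1 : ∫ s in r..x, (q s + c * p s) * Complex.exp (κ * s) =
      (∫ s in r..x, q s * Complex.exp (κ * s)) + c * ∫ s in r..x, p s * Complex.exp (κ * s) := by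
    rw [← intervalIntegral.integral_const_mul, ← intervalIntegral.integral_add (hint hQ.right)
      ((hint hQ.left).const_mul c)]
    refine intervalIntegral.integral_congr fun s _ => ?_
    ring
  rw [h1]
  refine (norm_add_le _ _).trans ?_
  rw [norm_mul, hc, one_mul, add_mul, add_div]
  exact add_le_add (hq r x hr hrx hx κ hκ M hM) (hp r x hr hrx hx κ hκ M hM)

end Dirac

theorem BoundedVariationOn.integrableOn_Icc {f : ℝ → ℂ} {a b : ℝ}
    (hf : BoundedVariationOn f (Set.Icc a b)) : IntegrableOn f (Set.Icc a b) := by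
  obtain ⟨M, -, hM⟩ := hf.exists_norm_le
  exact Integrable.of_bound hf.aestronglyMeasurable_restrict M
    (ae_restrict_of_forall_mem measurableSet_Icc hM)

namespace Dirac

variable {p q : ℝ → ℂ}

/-- The component `u = y₀ + ω y₁` of the solution with `y₀ + ω y₁ = 1`, `y₀ - ω y₁ = 0` at `0`. -/
theorem exists_norm_sol_sub_exp_le (hQ : IsBVPotential p q) : ∃ C, 0 < C ∧ ∀ ω lam μ : ℂ,
    ω * ω = -1 → ‖ω‖ = 1 → ω * lam = Complex.I * μ → C ≤ ‖lam‖ →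
      ‖(sol hQ lam ![1 / 2, -ω / 2] Real.pi 0 + ω * sol hQ lam ![1 / 2, -ω / 2] Real.pi 1) -
        Complex.exp (ω * lam * Real.pi)‖ ≤ C / ‖lam‖ * Real.exp (Real.pi * |μ.im|) := by
  obtain ⟨Ca, hCa0, hCa⟩ := hQ.exists_osc
  obtain ⟨Mp, hp0, hp⟩ := hQ.left.exists_norm_le
  obtain ⟨Mq, hq0, hq⟩ := hQ.right.exists_norm_le
  have hpi := Real.pi_pos
  -- The summand 1 makes the constant positive, so that `C ≤ ‖lam‖` excludes `lam = 0`.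
  refine ⟨Ca * (Mq + Mp) * Real.pi + 1, by positivity, fun ω lam μ hω hω1 hμ hle => ?_⟩
  have hl0 : 0 < ‖lam‖ := lt_of_lt_of_le (by positivity) hle
  have hnorm : ‖μ‖ = ‖lam‖ := by
    have := congrArg norm hμ
    simpa [hω1] using this.symm
  set y := sol hQ lam ![1 / 2, -ω / 2] with hy
  have hyc : ∀ i, Continuous fun x => y x i := fun i => (continuous_apply i).comp y.continuous
  have hbound : ∀ c : ℂ, ‖c‖ = 1 → ∀ x ∈ Set.Icc 0 Real.pi, ‖q x + c * p x‖ ≤ Mq + Mp := by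
    intro c hc x hx
    refine (norm_add_le _ _).trans (add_le_add (hq x hx) ?_)
    rw [norm_mul, hc, one_mul]
    exact hp x hx
  have hint : ∀ c : ℂ, IntervalIntegrable (fun x => q x + c * p x) volume 0 Real.pi := by
    intro c
    have h1 := (intervalIntegrable_iff_integrableOn_Icc_of_le hpi.le).2 hQ.right.integrableOn_Icc
    have h2 := (intervalIntegrable_iff_integrableOn_Icc_of_le hpi.le).2 hQ.left.integrableOn_Icc
    exact h1.add (h2.const_mul c)
  have hcomp : ∀ c : ℂ, ∀ x, y x 0 + c * y x 1 = (1 / 2 + c * (-ω / 2)) +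
      ∫ s in (0 : ℝ)..x, ((potCoeff p q s + lam • rotCoeff s) (y s) 0 +
        c * (potCoeff p q s + lam • rotCoeff s) (y s) 1) := by
    intro c x
    have hi : ∀ i : Fin 2, IntervalIntegrable
        (fun s => (potCoeff p q s + lam • rotCoeff s) (y s) i) volume 0 x := fun i =>
      ((ContinuousLinearMap.proj (R := ℂ) (φ := fun _ : Fin 2 => ℂ) i).integrable_comp
        (integrable_sysOp hQ lam y)).intervalIntegrable
    rw [intervalIntegral.integral_add (hi 0) ((hi 1).const_mul c),
      intervalIntegral.integral_const_mul, hy, sol_apply_component hQ lam _ x 0,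
      sol_apply_component hQ lam _ x 1]
    simp only [Matrix.cons_val_zero, Matrix.cons_val_one]
    ring
  have key : ‖(y Real.pi 0 + ω * y Real.pi 1) - Complex.exp (Complex.I * μ * Real.pi)‖ ≤
      Ca * (Mq + Mp) * Real.pi / ‖μ‖ * Real.exp (Real.pi * |μ.im|) := by
    -- The functionals `y₀ ± ω y₁` diagonalize the rotation, since `ω² = -1`. The parameter `μ` with
    -- `ωλ = iμ` lets one estimate serve `ω = i` with `μ = λ` and `ω = -i` with `μ = -λ`.
    refine norm_sub_exp_le_of_canonical_system (a := fun x => q x + -ω * p x)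
      (b := fun x => q x + ω * p x) (u := fun x => y x 0 + ω * y x 1)
      (v := fun x => y x 0 + -ω * y x 1) (Ma := Mq + Mp) hpi.le (norm_pos_iff.1 (hnorm ▸ hl0))
      ((hyc 0).add ((hyc 1).const_mul ω)) ((hyc 0).add ((hyc 1).const_mul (-ω))) (hint _) (hint _)
      (hbound _ (by rwa [norm_neg])) (hbound _ hω1) hCa0 (hCa (-ω) (by rwa [norm_neg])) ?_ ?_
      (by rw [hnorm]; linarith)
    · intro x hx
      rw [hcomp ω x]
      congr 1
      · linear_combination (-1 / 2) * hω
      · refine intervalIntegral.integral_congr fun s hs => ?_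
        rw [Set.uIcc_of_le hx.1] at hs
        have hs' : s ∈ Set.Icc 0 Real.pi := ⟨hs.1, hs.2.trans hx.2⟩
        beta_reduce
        rw [coeff_apply_zero hs', coeff_apply_one hs', ← hμ]
        linear_combination (-(lam + p s) * y s 1) * hω
    · intro x hx
      rw [hcomp (-ω) x]
      congr 1
      · linear_combination (1 / 2) * hω
      · refine intervalIntegral.integral_congr fun s hs => ?_
        rw [Set.uIcc_of_le hx.1] at hs
        have hs' : s ∈ Set.Icc 0 Real.pi := ⟨hs.1, hs.2.trans hx.2⟩
        beta_reduce
        rw [coeff_apply_zero hs', coeff_apply_one hs', ← hμ]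
        linear_combination (-(lam + p s) * y s 1) * hω
  rw [hμ]
  refine key.trans ?_
  rw [hnorm]
  gcongr
  linarith

/-- The discriminant is asymptotically that of the free operator. -/
theorem exists_norm_disc_sub_le (hQ : IsBVPotential p q) : ∃ C, 0 < C ∧ ∀ lam : ℂ, C ≤ ‖lam‖ →
    ‖disc hQ lam - 2 * Complex.cos (Real.pi * lam)‖ ≤
      C / ‖lam‖ * Real.exp (Real.pi * |lam.im|) := by
  obtain ⟨C, hC0, hC⟩ := exists_norm_sol_sub_exp_le hQ
  refine ⟨2 * C, by positivity, fun lam hlam => ?_⟩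
  have h1 := hC Complex.I lam lam Complex.I_mul_I Complex.norm_I rfl (by linarith)
  have h2 := hC (-Complex.I) lam (-lam) (by rw [neg_mul_neg, Complex.I_mul_I])
    (by rw [norm_neg, Complex.norm_I]) (by ring) (by linarith)
  rw [Complex.neg_im, abs_neg] at h2
  -- The vectors `(1/2, ∓i/2)` and the functionals `y₀ ± i y₁` are dual bases, so the trace of the
  -- monodromy matrix is the sum of the two diagonal coefficients.
  have e : disc hQ lam - 2 * Complex.cos (Real.pi * lam) =
      ((sol hQ lam ![1 / 2, -Complex.I / 2] Real.pi 0 +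
        Complex.I * sol hQ lam ![1 / 2, -Complex.I / 2] Real.pi 1) -
        Complex.exp (Complex.I * lam * Real.pi)) +
      ((sol hQ lam ![1 / 2, -(-Complex.I) / 2] Real.pi 0 +
        -Complex.I * sol hQ lam ![1 / 2, -(-Complex.I) / 2] Real.pi 1) -
        Complex.exp (-Complex.I * lam * Real.pi)) := by
    rw [Complex.two_cos, sol_pi, sol_pi, disc, Matrix.trace_fin_two,
      show (Real.pi : ℂ) * lam * Complex.I = Complex.I * lam * Real.pi by ring,
      show -((Real.pi : ℂ) * lam) * Complex.I = -Complex.I * lam * Real.pi by ring]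
    simp only [Matrix.mulVec, dotProduct, Fin.sum_univ_two, Matrix.cons_val_zero,
      Matrix.cons_val_one]
    linear_combination (monodromy hQ lam 1 1) * Complex.I_mul_I
  rw [e]
  refine (norm_add_le _ _).trans ((add_le_add h1 h2).trans (le_of_eq ?_))
  ring

end Dirac

/-! ### Root spaces spanned by a single Jordan chain -/

namespace Dirac

section RootSpace

variable {T : L2 →ₗ.[ℂ] L2} {μ : ℂ}

theorem mem_kerPow_succ {k : ℕ} {x : L2} :
    x ∈ kerPow T μ (k + 1) ↔ ∃ g ∈ kerPow T μ k, (x, μ • x + g) ∈ T.graph := by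
  simp only [kerPow, Submodule.mem_map, Submodule.mem_comap, LinearPMap.mem_graph_iff]
  constructor
  · rintro ⟨f, hf, rfl⟩
    refine ⟨_, hf, f, rfl, ?_⟩
    change T f = μ • (f : L2) + (T f - μ • (f : L2))
    abel
  · rintro ⟨g, hg, f, hf, hfg⟩
    refine ⟨f, ?_, hf⟩
    have : (T.toFun - μ • T.domain.subtype) f = g := by
      change T f - μ • (f : L2) = g
      rw [hfg, hf]
      abel
    rwa [this]

theorem isEigenvalue_iff : IsEigenvalue T μ ↔ ∃ f : L2, f ≠ 0 ∧ (f, μ • f) ∈ T.graph := by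
  simp only [IsEigenvalue, LinearPMap.mem_graph_iff]
  constructor
  · rintro ⟨f, hf0, hf⟩
    exact ⟨f, fun h => hf0 (Subtype.ext h), f, rfl, hf⟩
  · rintro ⟨f, hf0, g, rfl, hg⟩
    exact ⟨g, fun h => hf0 (by rw [h]; rfl), hg⟩

theorem multiplicity_eq_zero (h : ∀ f : L2, (f, μ • f) ∈ T.graph → f = 0) :
    multiplicity T μ = 0 := by
  have hk : ∀ k, kerPow T μ k = ⊥ := by
    intro k
    induction k with
    | zero => rfl
    | succ k ih =>
      refine (Submodule.eq_bot_iff _).2 fun x hx => ?_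
      obtain ⟨g, hg, hx⟩ := mem_kerPow_succ.1 hx
      rw [ih, Submodule.mem_bot] at hg
      rw [hg, add_zero] at hx
      exact h x hx
  simp [multiplicity, hk]

/-- The root space of an operator that has one maximal Jordan chain `d 1, …, d (n + 1)` at `μ`. -/
theorem multiplicity_eq_of_chain {n : ℕ} {d : ℕ → L2} (hd0 : d 0 = 0) (hd1 : d 1 ≠ 0)
    (hd : ∀ k < n + 1, (d (k + 1), μ • d (k + 1) + d k) ∈ T.graph)
    (hker : ∀ f : L2, (f, μ • f) ∈ T.graph → ∃ c : ℂ, f = c • d 1)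
    (hlast : ∀ (f : L2) (c : ℕ → ℂ),
      (f, μ • f + ∑ k ∈ Finset.range (n + 1), c k • d (k + 1)) ∈ T.graph → c n = 0) :
    multiplicity T μ = (n + 1 : ℕ) := by
  have hsum : ∀ j ≤ n + 1, ∀ c : ℕ → ℂ, (∑ k ∈ Finset.range j, c k • d (k + 1),
      μ • (∑ k ∈ Finset.range j, c k • d (k + 1)) + ∑ k ∈ Finset.range j, c k • d k) ∈ T.graph := by
    intro j hj c
    have h1 : (∑ k ∈ Finset.range j,
        c k • ((d (k + 1), μ • d (k + 1) + d k) : L2 × L2)) ∈ T.graph :=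
      Submodule.sum_mem _ fun k hk =>
        Submodule.smul_mem _ _ (hd k ((Finset.mem_range.1 hk).trans_le hj))
    have h2 := Prod.mk.eta (p := ∑ k ∈ Finset.range j,
      c k • ((d (k + 1), μ • d (k + 1) + d k) : L2 × L2))
    rw [Prod.fst_sum, Prod.snd_sum] at h2
    rw [← h2] at h1
    rw [Finset.smul_sum, ← Finset.sum_add_distrib]
    simpa only [Prod.smul_fst, Prod.smul_snd, smul_add, smul_comm μ] using h1
  have hzero : ∀ j ≤ n + 1, ∀ c : ℕ → ℂ, ∑ k ∈ Finset.range j, c k • d (k + 1) = 0 →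
      ∀ k < j, c k = 0 := by
    intro j
    induction j with
    | zero => intro _ c _ k hk; exact absurd hk (Nat.not_lt_zero k)
    | succ j ih =>
      intro hj c hc
      -- Applying `T - μ` to a linear relation lowers every index by one and drops `d 1`, so the
      -- shorter relation is covered by induction.
      have h1 := hsum (j + 1) hj c
      rw [hc, smul_zero, zero_add] at h1
      have h2 := T.graph_fst_eq_zero_snd h1 rfl
      rw [Finset.sum_range_succ', hd0, smul_zero, add_zero] at h2
      have h3 := ih (by omega) (fun k => c (k + 1)) h2
      rw [Finset.sum_range_succ', Finset.sum_eq_zero, zero_add] at hc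
      · rintro (_ | k) hk
        · exact (smul_eq_zero.1 hc).resolve_right hd1
        · exact h3 k (by omega)
      · intro k hk
        rw [h3 k (Finset.mem_range.1 hk), zero_smul]
  have hli : LinearIndependent ℂ fun k : Fin (n + 1) => d (k + 1) := by
    refine Fintype.linearIndependent_iff.2 fun g hg i => ?_
    have := hzero (n + 1) le_rfl (fun k => if h : k < n + 1 then g ⟨k, h⟩ else 0) (by
      rw [← hg, Finset.sum_range]
      simp only [Fin.is_lt, dite_true]) i i.2
    simpa only [Fin.is_lt, dite_true] using this
  have hspan : (⨆ k, kerPow T μ k) =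
      Submodule.span ℂ (Set.range fun k : Fin (n + 1) => d (k + 1)) := by
    have hmem : ∀ k < n + 1, d (k + 1) ∈
        Submodule.span ℂ (Set.range fun k : Fin (n + 1) => d (k + 1)) := fun k hk =>
      Submodule.subset_span ⟨⟨k, hk⟩, rfl⟩
    refine le_antisymm (iSup_le fun k => ?_) (Submodule.span_le.2 ?_)
    · induction k with
      | zero => exact bot_le
      | succ k ih =>
        intro x hx
        obtain ⟨g, hg, hx⟩ := mem_kerPow_succ.1 hx
        obtain ⟨b, hb⟩ := (Submodule.mem_span_range_iff_exists_fun ℂ).1 (ih hg)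
        set c : ℕ → ℂ := fun k => if h : k < n + 1 then b ⟨k, h⟩ else 0 with hc
        have hgc : g = ∑ k ∈ Finset.range (n + 1), c k • d (k + 1) := by
          rw [← hb, Finset.sum_range]
          simp only [hc, Fin.is_lt, dite_true]
        rw [hgc] at hx
        have hcn := hlast x c hx
        rw [Finset.sum_range_succ, hcn, zero_smul, add_zero] at hx
        -- Since `c n = 0`, raising each index of `g` by one stays inside the chain and gives `s`
        -- with `(T - μ) s = g`. Then `x - s` is killed by `T - μ`, hence is a multiple of `d 1`.
        have h1 := hsum (n + 1) le_rfl fun k => if k = 0 then 0 else c (k - 1)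
        set s := ∑ k ∈ Finset.range (n + 1), (if k = 0 then (0 : ℂ) else c (k - 1)) • d (k + 1)
          with hs
        rw [Finset.sum_range_succ'] at h1
        simp only [Nat.add_one_ne_zero, if_false, Nat.add_sub_cancel, if_true, zero_smul,
          add_zero] at h1
        have h2 := Submodule.sub_mem _ hx h1
        rw [Prod.mk_sub_mk, add_sub_add_right_eq_sub, ← smul_sub] at h2
        obtain ⟨a, ha⟩ := hker _ h2
        rw [sub_eq_iff_eq_add] at ha
        rw [ha]
        refine Submodule.add_mem _ (Submodule.smul_mem _ _ (hmem 0 (Nat.succ_pos n)))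
          (Submodule.sum_mem _ fun k hk => Submodule.smul_mem _ _ (hmem k (Finset.mem_range.1 hk)))
    · have h1 : ∀ k < n + 1, d (k + 1) ∈ kerPow T μ (k + 1) := by
        intro k
        induction k with
        | zero =>
          intro h
          exact mem_kerPow_succ.2 ⟨0, Submodule.zero_mem _, hd0 ▸ hd 0 h⟩
        | succ k ih =>
          intro h
          exact mem_kerPow_succ.2 ⟨_, ih (by omega), hd _ h⟩
      rintro _ ⟨k, rfl⟩
      exact Submodule.mem_iSup_of_mem _ (h1 k k.2)
  rw [multiplicity, hspan, rank_span hli, Cardinal.mk_range_eq _ hli.injective]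
  simp

end RootSpace

/-! ### The graph of `L_t(Q)` and the integral equation -/

section Embedding

theorem memLp_toLp (y : ℝ →ᵇ (Fin 2 → ℂ)) : MemLp (fun x => WithLp.toLp 2 (y x)) 2 mu := by
  set e := (PiLp.continuousLinearEquiv 2 ℂ (fun _ : Fin 2 => ℂ)).symm.toContinuousLinearMap
  exact MemLp.of_bound (e.compLeftContinuousBounded ℝ y).continuous.aestronglyMeasurable _
    (.of_forall (e.compLeftContinuousBounded ℝ y).norm_coe_le_norm)

/-- The class of a bounded continuous function in `L₂²[0, π]`. -/
noncomputable def toL2 : (ℝ →ᵇ (Fin 2 → ℂ)) →ₗ[ℂ] L2 where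
  toFun y := (memLp_toLp y).toLp
  map_add' _ _ := rfl
  map_smul' _ _ := rfl

theorem toL2_apply_ae (y : ℝ →ᵇ (Fin 2 → ℂ)) : ∀ᵐ x ∂mu, (toL2 y x).ofLp = y x := by
  filter_upwards [(memLp_toLp y).coeFn_toLp] with x hx
  exact congrArg WithLp.ofLp hx

/-- A continuous function that vanishes almost everywhere on the interval vanishes on its interior,
and by closure at the endpoint 0. -/
theorem toL2_ne_zero {y : ℝ →ᵇ (Fin 2 → ℂ)} (hy : y 0 ≠ 0) : toL2 y ≠ 0 := by
  intro h
  have h1 : ∀ᵐ x ∂mu, y x = 0 := by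
    filter_upwards [toL2_apply_ae y, Lp.coeFn_zero (EuclideanSpace ℂ (Fin 2)) 2 mu] with x hx hx'
    rw [← hx, h]
    exact congrArg WithLp.ofLp hx'
  rw [mu, ← Measure.restrict_congr_set Ioo_ae_eq_Icc] at h1
  have h2 := (Measure.eqOn_open_of_ae_eq h1 isOpen_Ioo y.continuous.continuousOn
    continuousOn_const).closure y.continuous continuous_const
  rw [closure_Ioo Real.pi_pos.ne] at h2
  exact hy (h2 (Set.left_mem_Icc.2 Real.pi_pos.le))

variable {p q : ℝ → ℂ}

/-- Solves `l(y, Q) = λy + w` pointwise for the derivative: `rotCoeff` is `J⁻¹` on the interval. -/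
theorem eq_coeff_iff {s : ℝ} (hs : s ∈ Set.Icc 0 Real.pi) (lam : ℂ) (v w d : Fin 2 → ℂ) :
    d = (potCoeff p q s + lam • rotCoeff s) v + rotCoeff s w ↔
      lam • v + w = Matrix.mulVec !![0, 1; -1, 0] d + Matrix.mulVec (potential p q s) v := by
  rw [funext_iff, funext_iff, Fin.forall_fin_two, Fin.forall_fin_two, rotCoeff_apply hs w,
    Pi.add_apply, Pi.add_apply, coeff_apply_zero hs, coeff_apply_one hs]
  simp only [Matrix.mulVec, dotProduct, Fin.sum_univ_two, potential, Pi.add_apply, Pi.smul_apply,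
    smul_eq_mul, Matrix.of_apply, Matrix.cons_val_zero, Matrix.cons_val_one]
  constructor
  · rintro ⟨h1, h2⟩
    rw [h1, h2]
    constructor <;> ring
  · rintro ⟨h1, h2⟩
    constructor
    · linear_combination h2
    · linear_combination -h1

/-- `(y, μ y + g)` is in the graph of `L_t(Q)` if `y` solves the integrated equation. -/
theorem toL2_mem_graph (hQ : IsBVPotential p q) {t μ : ℂ} {y g : ℝ →ᵇ (Fin 2 → ℂ)}
    (hy : ∃ c, y - sysOp hQ μ y = constCLM c +
      isVolterraCoeff_rotCoeff.volterra Real.pi_pos.le g)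
    (hb : y Real.pi = Complex.exp (Complex.I * Real.pi * t) • y 0) :
    (toL2 y, μ • toL2 y + toL2 g) ∈ graph p q t := by
  obtain ⟨c, hy⟩ := hy
  have hpi := Real.pi_pos.le
  have hiA := integrable_sysOp hQ μ y
  have hiR := isVolterraCoeff_rotCoeff.integrable g
  have hrep : ∀ x, y x = c +
      ∫ s in (0 : ℝ)..x, ((potCoeff p q s + μ • rotCoeff s) (y s) + rotCoeff s (g s)) := by
    intro x
    have h := DFunLike.congr_fun hy x
    rw [BoundedContinuousFunction.coe_sub, Pi.sub_apply, BoundedContinuousFunction.coe_add,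
      Pi.add_apply, constCLM_apply, sysOp_apply, IsVolterraCoeff.volterra_apply,
      sub_eq_iff_eq_add] at h
    rw [h, intervalIntegral.integral_add hiA.intervalIntegrable hiR.intervalIntegrable]
    abel
  have hi : IntervalIntegrable (fun s => (potCoeff p q s + μ • rotCoeff s) (y s) + rotCoeff s (g s))
    volume 0 Real.pi := (hiA.add hiR).intervalIntegrable
  obtain ⟨C, hC0, hC⟩ := exists_norm_coeff_apply_le hQ μ y
  obtain ⟨D, hD0, hD⟩ := isVolterraCoeff_rotCoeff.exists_norm_le
  have hfun := funext hrep
  refine ⟨y, ⟨?_, hb⟩, toL2_apply_ae y, ?_⟩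
  · rw [hfun]
    refine absolutelyContinuousOnInterval_const_add_integral hpi hi (C := C + D * ‖g‖)
      (by positivity) (fun x _ => (norm_add_le _ _).trans (add_le_add (hC x)
        (ContinuousLinearMap.le_of_opNorm_le_of_le _ (hD x) (g.norm_coe_le_norm x)))) c
  · have hder := ae_hasDerivAt_const_add_integral hpi hi c
    rw [← hfun, ← ae_restrict_iff' measurableSet_Icc] at hder
    filter_upwards [hder, ae_restrict_mem measurableSet_Icc, toL2_apply_ae y, toL2_apply_ae g,
      Lp.coeFn_add (μ • toL2 y) (toL2 g), Lp.coeFn_smul μ (toL2 y)] with x h1 hx h2 h3 h4 h5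
    rw [h4, Pi.add_apply, h5, Pi.smul_apply, WithLp.ofLp_add, WithLp.ofLp_smul, h2, h3, diffExpr,
      h1.deriv]
    exact (eq_coeff_iff hx μ (y x) (g x) _).1 rfl

/-- A pair `(f, μ f + g)` in the graph of `L_t(Q)` comes from the integrated equation. -/
theorem exists_of_mem_graph (hQ : IsBVPotential p q) {t μ : ℂ} {f : L2} {g : ℝ →ᵇ (Fin 2 → ℂ)}
    (hf : (f, μ • f + toL2 g) ∈ graph p q t) :
    ∃ y : ℝ →ᵇ (Fin 2 → ℂ), f = toL2 y ∧ y - sysOp hQ μ y = constCLM (y 0) +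
        isVolterraCoeff_rotCoeff.volterra Real.pi_pos.le g ∧
      y Real.pi = Complex.exp (Complex.I * Real.pi * t) • y 0 := by
  obtain ⟨y, ⟨hac, hb⟩, h1, h2⟩ := hf
  have hpi := Real.pi_pos.le
  have hyc : ContinuousOn y (Set.Icc 0 Real.pi) := by
    have := hac.continuousOn
    rwa [Set.uIcc_of_le hpi] at this
  -- The representative is controlled only on `[0, π]`, so it is continued by constants. The
  -- integral equation persists on the line because all coefficients vanish outside the interval.
  set w := (Set.Icc 0 Real.pi).domRestrict y
  have hzc : Continuous (Set.IccExtend hpi w) := hyc.domRestrict.Icc_extend'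
  obtain ⟨C, hC⟩ := isCompact_Icc.exists_bound_of_continuousOn hyc
  set z : ℝ →ᵇ (Fin 2 → ℂ) := BoundedContinuousFunction.ofNormedAddCommGroup _ hzc C
    (fun x => hC _ (Set.projIcc 0 Real.pi hpi x).2) with hz
  have hzy : ∀ x ∈ Set.Icc 0 Real.pi, z x = y x := fun x hx =>
    (Set.IccExtend_of_mem hpi w hx).trans rfl
  have hz0 : ∀ x ≤ 0, z x = y 0 := fun x hx => (Set.IccExtend_of_le_left hpi w hx).trans rfl
  have hzpi : ∀ x, Real.pi ≤ x → z x = y Real.pi := fun x hx =>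
    (Set.IccExtend_of_right_le hpi w hx).trans rfl
  have hiA := integrable_sysOp hQ μ z
  have hiR := isVolterraCoeff_rotCoeff.integrable g
  have hi : IntervalIntegrable (fun s => (potCoeff p q s + μ • rotCoeff s) (z s) + rotCoeff s (g s))
    volume 0 Real.pi := (hiA.add hiR).intervalIntegrable
  obtain ⟨C', hC0', hC'⟩ := exists_norm_coeff_apply_le hQ μ z
  obtain ⟨D, hD0, hD⟩ := isVolterraCoeff_rotCoeff.exists_norm_le
  have hrep := hac.eq_add_integral hpi hi (C := C' + D * ‖g‖) (by positivity)
    (fun x _ => (norm_add_le _ _).trans (add_le_add (hC' x)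
        (ContinuousLinearMap.le_of_opNorm_le_of_le _ (hD x) (g.norm_coe_le_norm x)))) (by
    rw [← ae_restrict_iff' measurableSet_Icc]
    filter_upwards [ae_differentiableAt hac, ae_restrict_mem measurableSet_Icc, h1, h2,
      toL2_apply_ae g, Lp.coeFn_add (μ • f) (toL2 g), Lp.coeFn_smul μ f] with x h3 hx h4 h5 h6 h7 h8
    rw [h7, Pi.add_apply, h8, Pi.smul_apply, WithLp.ofLp_add, WithLp.ofLp_smul, h4, h6,
      diffExpr] at h5
    have h9 := h3.hasDerivAt
    rw [(eq_coeff_iff hx μ (y x) (g x) _).2 h5, ← hzy x hx] at h9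
    exact h9)
  have hsplit : ∀ x, (∫ s in (0 : ℝ)..x, ((potCoeff p q s + μ • rotCoeff s) (z s) +
      rotCoeff s (g s))) = sysOp hQ μ z x +
        isVolterraCoeff_rotCoeff.volterra Real.pi_pos.le g x := by
    intro x
    rw [intervalIntegral.integral_add hiA.intervalIntegrable hiR.intervalIntegrable, sysOp_apply,
      IsVolterraCoeff.volterra_apply]
  refine ⟨z, ?_, ?_, ?_⟩
  · refine Lp.ext ?_
    filter_upwards [h1, toL2_apply_ae z, ae_restrict_mem measurableSet_Icc] with x h3 h4 hx
    rw [hzy x hx] at h4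
    exact WithLp.ofLp_injective 2 (h3.trans h4.symm)
  · have hin : ∀ x ∈ Set.Icc 0 Real.pi, z x = y 0 + (sysOp hQ μ z x +
        isVolterraCoeff_rotCoeff.volterra Real.pi_pos.le g x) := by
      intro x hx
      rw [hzy x hx, hrep x hx, hsplit]
    ext1 x
    rw [BoundedContinuousFunction.coe_sub, Pi.sub_apply, BoundedContinuousFunction.coe_add,
      Pi.add_apply, constCLM_apply, sub_eq_iff_eq_add, hz0 0 le_rfl, add_assoc,
      add_comm (isVolterraCoeff_rotCoeff.volterra Real.pi_pos.le g x)]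
    rcases le_total x 0 with hx | hx
    · rw [hz0 x hx, sysOp_eq, IsVolterraCoeff.volterra_apply_of_nonpos _ _ _ hx,
        IsVolterraCoeff.volterra_apply_of_nonpos _ _ _ hx, add_zero, add_zero]
    · rcases le_total x Real.pi with hx' | hx'
      · exact hin x ⟨hx, hx'⟩
      · have h3 := hin Real.pi (Set.right_mem_Icc.2 hpi)
        rw [sysOp_eq] at h3 ⊢
        rw [IsVolterraCoeff.volterra_apply_of_le _ _ _ hx',
          IsVolterraCoeff.volterra_apply_of_le _ _ _ hx', ← h3, hzpi x hx',
          hzpi Real.pi le_rfl]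
  · rw [hzpi Real.pi le_rfl, hz0 0 le_rfl, hb]

end Embedding

end Dirac

/-! ### Jordan chains from holomorphic families -/

theorem Continuous.eq_of_forall_ne {X Y : Type*} [TopologicalSpace X] [TopologicalSpace Y]
    [T2Space Y] {a : X} [(nhdsWithin a {a}ᶜ).NeBot] {f g : X → Y} (hf : Continuous f)
    (hg : Continuous g) (h : ∀ x, x ≠ a → f x = g x) (x : X) : f x = g x :=
  congrFun (hf.ext_on (dense_compl_singleton a) hg h) x

/-- Divided differences at `a` of a solution family `Y z = (S + z R) Y z` form a Jordan chain. -/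
theorem exists_jordanChain {X V : Type*} [NormedAddCommGroup X] [NormedSpace ℂ X] [CompleteSpace X]
    [NormedAddCommGroup V] [NormedSpace ℂ V] (S R : X →L[ℂ] X) (B : X →L[ℂ] V) {Y : ℂ → X}
    (hY : Differentiable ℂ Y) (h : ∀ z, Y z = S (Y z) + z • R (Y z)) {a : ℂ} {m : ℕ} {G : ℂ → V}
    (hG : Continuous G) (hB : ∀ z, B (Y z) = (z - a) ^ m • G z) :
    ∃ e : ℕ → X, e 0 = 0 ∧ e 1 = Y a ∧
      (∀ k, e (k + 1) = S (e (k + 1)) + a • R (e (k + 1)) + R (e k)) ∧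
      (∀ k < m, B (e (k + 1)) = 0) ∧ B (e (m + 1)) = G a := by
  set D : ℕ → ℂ → X := fun k => (Function.swap dslope a)^[k] Y with hD
  have hD1 : ∀ k, D (k + 1) = dslope (D k) a := fun k => Function.iterate_succ_apply' _ k Y
  have hDd : ∀ k, Differentiable ℂ (D k) := by
    intro k
    induction k with
    | zero => exact hY
    | succ k ih =>
      rw [hD1, ← differentiableOn_univ, Complex.differentiableOn_dslope Filter.univ_mem]
      exact ih.differentiableOn
  have hne : ∀ k z, z ≠ a → D (k + 1) z = (z - a)⁻¹ • (D k z - D k a) := fun k z hz => by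
    rw [hD1, dslope_of_ne _ hz, slope_def_module]
  -- The shift by one puts the zero vector at index 0, so that the equation for `Y` itself is the
  -- first case of the chain relation.
  set e : ℕ → X := fun k => Nat.casesOn k 0 fun k => D k a with he
  -- The relation is kept for all `z`: subtracting it at `a`, dividing by `z - a` and passing to `z
  -- = a` by continuity gives the next one.
  have hchain : ∀ k z, D k z = S (D k z) + z • R (D k z) + R (e k) := by
    intro k
    induction k with
    | zero =>
      intro z
      change Y z = S (Y z) + z • R (Y z) + R 0
      rw [map_zero, add_zero]
      exact h z
    | succ k ih =>
      have hc := (hDd (k + 1)).continuous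
      refine hc.eq_of_forall_ne (a := a) (by fun_prop) fun z hz => ?_
      have hz' : z - a ≠ 0 := sub_ne_zero.2 hz
      have e1 : D k z - D k a = S (D k z - D k a) + z • R (D k z - D k a) + (z - a) • R (D k a) := by
        conv_lhs => rw [ih z, ih a]
        rw [map_sub, map_sub, smul_sub, sub_smul]
        abel
      have e2 := congrArg (fun x => (z - a)⁻¹ • x) e1
      simp only [smul_add, smul_comm (z - a)⁻¹ z, inv_smul_smul₀ hz', ← map_smul] at e2
      rw [← hne k z hz, map_smul] at e2
      exact e2
  -- Each divided difference lowers the exponent of `z - a` by one, as the boundary value at `a` is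
  -- zero while the exponent is positive.
  have hbd : ∀ j k, j + k = m → ∀ z, B (D k z) = (z - a) ^ j • G z := by
    intro j k
    induction k generalizing j with
    | zero => rintro rfl; exact hB
    | succ k ih =>
      intro hj
      have ih' := ih (j + 1) (by omega)
      refine (B.continuous.comp (hDd (k + 1)).continuous).eq_of_forall_ne (a := a)
        (g := fun z => (z - a) ^ j • G z) (by fun_prop) fun z hz => ?_
      have hz' : z - a ≠ 0 := sub_ne_zero.2 hz
      rw [Function.comp_apply, hne k z hz, map_smul, map_sub, ih' z, ih' a, sub_self, zero_pow (Nat.succ_ne_zero j),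
        zero_smul, sub_zero, pow_succ', mul_smul, inv_smul_smul₀ hz']
  refine ⟨e, rfl, rfl, fun k => hchain k a, fun k hk => ?_, ?_⟩
  · change B (D k a) = 0
    rw [hbd (m - k) k (by omega), sub_self, zero_pow (by omega), zero_smul]
  · change B (D m a) = G a
    rw [hbd 0 m (zero_add m), pow_zero, one_smul]

/-- In dimension two the columns of the adjugate are, up to sign, the rows of `A` turned by a right
angle. A vector killed by `A` is therefore parallel to each of them. -/
theorem Matrix.exists_eq_smul_adjugate_mulVec {K : Type*} [Field K] {A : Matrix (Fin 2) (Fin 2) K}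
    {v x : Fin 2 → K} (hv : A.adjugate.mulVec v ≠ 0) (hx : A.mulVec x = 0) :
    ∃ c : K, x = c • A.adjugate.mulVec v := by
  set w := A.adjugate.mulVec v with hw
  have h0 := congrFun hx 0
  have h1 := congrFun hx 1
  have hw0 := congrFun hw 0
  have hw1 := congrFun hw 1
  simp only [Matrix.adjugate_fin_two, Matrix.mulVec, dotProduct, Fin.sum_univ_two, Pi.zero_apply,
    Matrix.of_apply, Matrix.cons_val_zero, Matrix.cons_val_one] at h0 h1 hw0 hw1
  have hxw : x 0 * w 1 = x 1 * w 0 := by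
    rw [hw0, hw1]
    linear_combination (-(v 0)) * h1 + v 1 * h0
  by_cases hz : w 0 = 0
  · have hz1 : w 1 ≠ 0 := fun hz1 => hv (funext (Fin.forall_fin_two.2 ⟨hz, hz1⟩))
    refine ⟨x 1 / w 1, funext (Fin.forall_fin_two.2 ⟨?_, ?_⟩)⟩ <;>
      rw [Pi.smul_apply, smul_eq_mul] <;> field_simp
    exact hxw
  · refine ⟨x 0 / w 0, funext (Fin.forall_fin_two.2 ⟨?_, ?_⟩)⟩ <;>
      rw [Pi.smul_apply, smul_eq_mul] <;> field_simp
    exact hxw.symm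

/-! ### Algebraic multiplicity as the order of a zero -/

namespace Dirac

variable {p q : ℝ → ℂ}

/-- The characteristic function of `L_t(Q)`. -/
noncomputable def charFun (hQ : IsBVPotential p q) (t lam : ℂ) : ℂ :=
  2 * Complex.cos (Real.pi * t) - disc hQ lam

theorem differentiable_charFun (hQ : IsBVPotential p q) (t : ℂ) :
    Differentiable ℂ (charFun hQ t) :=
  (differentiable_const _).sub (differentiable_disc hQ)

/-- The characteristic matrix of `L_t(Q)`. -/
noncomputable def charMatrix (hQ : IsBVPotential p q) (t lam : ℂ) : Matrix (Fin 2) (Fin 2) ℂ :=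
  monodromy hQ lam - Complex.exp (Complex.I * Real.pi * t) • 1

theorem charMatrix_mulVec (hQ : IsBVPotential p q) (t lam : ℂ) (c : Fin 2 → ℂ) :
    (charMatrix hQ t lam).mulVec c =
      sol hQ lam c Real.pi - Complex.exp (Complex.I * Real.pi * t) • c := by
  rw [charMatrix, Matrix.sub_mulVec, Matrix.smul_mulVec, Matrix.one_mulVec, sol_pi]

theorem exp_add_exp_neg (t : ℂ) : Complex.exp (Complex.I * Real.pi * t) +
    Complex.exp (-(Complex.I * Real.pi * t)) = 2 * Complex.cos (Real.pi * t) := by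
  rw [Complex.two_cos, show (Real.pi : ℂ) * t * Complex.I = Complex.I * Real.pi * t by ring,
    show -((Real.pi : ℂ) * t) * Complex.I = -(Complex.I * Real.pi * t) by ring]

/-- With `ρ = e^{iπt}` and determinant 1 of the monodromy matrix, the determinant is `ρ² - ρ · disc
+ 1 = ρ (ρ + ρ⁻¹ - disc)`. -/
theorem det_charMatrix (hQ : IsBVPotential p q) (t lam : ℂ) : (charMatrix hQ t lam).det =
    Complex.exp (Complex.I * Real.pi * t) * charFun hQ t lam := by
  have h1 := det_monodromy hQ lam
  have h2 : Complex.exp (Complex.I * Real.pi * t) * Complex.exp (-(Complex.I * Real.pi * t)) = 1 := by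
    rw [← Complex.exp_add, add_neg_cancel, Complex.exp_zero]
  rw [charFun, ← exp_add_exp_neg, charMatrix, disc, Matrix.trace_fin_two, Matrix.det_fin_two]
  rw [Matrix.det_fin_two] at h1
  simp only [Matrix.sub_apply, Matrix.smul_apply, Matrix.one_apply_eq, ne_eq, zero_ne_one,
    not_false_eq_true, Matrix.one_apply_ne, one_ne_zero, smul_eq_mul, mul_one, mul_zero, sub_zero]
  linear_combination h1 - h2

/-- Geometric simplicity of the eigenvalues. If the adjugate vanished, its diagonal would give trace
`2ρ` for the monodromy matrix, while `charFun = 0` gives `ρ + ρ⁻¹`; then `ρ = ρ⁻¹` and `sin πt = 0`.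
-/
theorem exists_adjugate_charMatrix_ne_zero (hQ : IsBVPotential p q) {t lam : ℂ}
    (ht : Complex.sin (Real.pi * t) ≠ 0) (h : charFun hQ t lam = 0) :
    ∃ v, (charMatrix hQ t lam).adjugate.mulVec v ≠ 0 := by
  by_contra! hv
  have h0 := congrFun (hv (Pi.single 0 1)) 0
  have h1 := congrFun (hv (Pi.single 1 1)) 1
  simp only [Matrix.mulVec_single_one, Matrix.col_apply, Matrix.adjugate_fin_two, Matrix.of_apply,
    Matrix.cons_val_zero, Matrix.cons_val_one, charMatrix, Matrix.sub_apply, Matrix.smul_apply,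
    Matrix.one_apply_eq, smul_eq_mul, mul_one, Pi.zero_apply] at h0 h1
  have h2 := Complex.two_sin (Real.pi * t)
  rw [show (Real.pi : ℂ) * t * Complex.I = Complex.I * Real.pi * t by ring,
    show -((Real.pi : ℂ) * t) * Complex.I = -(Complex.I * Real.pi * t) by ring] at h2
  rw [charFun, ← exp_add_exp_neg, disc, Matrix.trace_fin_two] at h
  have h3 : Complex.exp (-(Complex.I * Real.pi * t)) - Complex.exp (Complex.I * Real.pi * t) = 0 := by
    linear_combination h0 + h1 + h
  rw [h3, zero_mul] at h2
  exact ht ((mul_eq_zero.1 h2).resolve_left two_ne_zero)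

theorem eq_sol_of_sub_sysOp (hQ : IsBVPotential p q) {lam : ℂ} {c : Fin 2 → ℂ}
    {y : ℝ →ᵇ (Fin 2 → ℂ)} (h : y - sysOp hQ lam y = constCLM c) : y = sol hQ lam c := by
  rw [← solOp_sub_sysOp hQ lam y, h]
  rfl

theorem exists_eq_toL2_sol (hQ : IsBVPotential p q) {t lam : ℂ} {f : L2}
    (hf : (f, lam • f) ∈ graph p q t) :
    ∃ c, f = toL2 (sol hQ lam c) ∧ (charMatrix hQ t lam).mulVec c = 0 := by
  obtain ⟨y, rfl, hy, hb⟩ := exists_of_mem_graph hQ (t := t) (μ := lam) (f := f) (g := 0)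
    (by rwa [map_zero, add_zero])
  rw [ContinuousLinearMap.map_zero, add_zero] at hy
  have h := eq_sol_of_sub_sysOp hQ hy
  refine ⟨y 0, congrArg toL2 h, ?_⟩
  rw [charMatrix_mulVec, ← h, hb, sub_self]

theorem multiplicity_operator_of_ne_zero (hQ : IsBVPotential p q) {t lam : ℂ}
    (h : charFun hQ t lam ≠ 0) : multiplicity (operator p q t) lam = 0 ∧
      ¬ IsEigenvalue (operator p q t) lam := by
  have h1 : ∀ f : L2, (f, lam • f) ∈ (operator p q t).graph → f = 0 := by
    intro f hf
    rw [graph_operator] at hf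
    obtain ⟨c, rfl, hc⟩ := exists_eq_toL2_sol hQ hf
    have hdet : (charMatrix hQ t lam).det ≠ 0 := by
      rw [det_charMatrix]
      exact mul_ne_zero (Complex.exp_ne_zero _) h
    have hc0 : c = 0 := by
      by_contra hc0
      exact hdet (Matrix.exists_mulVec_eq_zero_iff.1 ⟨c, hc0, hc⟩)
    rw [hc0, ContinuousLinearMap.map_zero, map_zero]
  refine ⟨multiplicity_eq_zero h1, fun h2 => ?_⟩
  obtain ⟨f, hf0, hf⟩ := isEigenvalue_iff.1 h2
  exact hf0 (h1 f hf)

/-- The functional whose vanishing is the boundary condition. -/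
noncomputable def boundaryCLM (t : ℂ) : (ℝ →ᵇ (Fin 2 → ℂ)) →L[ℂ] (Fin 2 → ℂ) :=
  BoundedContinuousFunction.evalCLM ℂ Real.pi -
    Complex.exp (Complex.I * Real.pi * t) • BoundedContinuousFunction.evalCLM ℂ 0

theorem boundaryCLM_apply (t : ℂ) (y : ℝ →ᵇ (Fin 2 → ℂ)) :
    boundaryCLM t y = y Real.pi - Complex.exp (Complex.I * Real.pi * t) • y 0 := rfl

theorem differentiable_adjugate_charMatrix_mulVec (hQ : IsBVPotential p q) (t : ℂ)
    (v : Fin 2 → ℂ) : Differentiable ℂ fun lam => (charMatrix hQ t lam).adjugate.mulVec v := by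
  have h := differentiable_monodromy hQ
  have hd : ∀ i j, Differentiable ℂ fun lam => charMatrix hQ t lam i j := by
    intro i j
    exact (h i j).sub (differentiable_const _)
  have h00 := hd 0 0
  have h01 := hd 0 1
  have h10 := hd 1 0
  have h11 := hd 1 1
  refine differentiable_pi.2 (Fin.forall_fin_two.2 ⟨?_, ?_⟩) <;>
    simp only [Matrix.adjugate_fin_two, Matrix.mulVec, dotProduct, Fin.sum_univ_two,
      Matrix.of_apply, Matrix.cons_val_zero, Matrix.cons_val_one] <;>
    fun_prop

/-- Let `Y(λ)` be the solution with initial value `adj(λ) v`, the adjugate being that of the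
characteristic matrix. Its boundary defect is `det · v = (λ - μ)^{n+1} ρ G(λ) v` with `G(μ) ≠ 0`.
Its divided differences at `μ` give `n + 1` chain vectors satisfying the boundary condition, and the
next one fails it by `ρ G(μ) v`, so the chain cannot be prolonged. -/
theorem multiplicity_operator_of_eq_zero (hQ : IsBVPotential p q) {t μ : ℂ}
    (ht : Complex.sin (Real.pi * t) ≠ 0) (h : charFun hQ t μ = 0)
    (htop : analyticOrderAt (charFun hQ t) μ ≠ ⊤) :
    multiplicity (operator p q t) μ = analyticOrderAt (charFun hQ t) μ ∧
      IsEigenvalue (operator p q t) μ := by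
  obtain ⟨v, hv⟩ := exists_adjugate_charMatrix_ne_zero hQ ht h
  obtain ⟨G, hGd, hG0, hG⟩ := (differentiable_charFun hQ t).exists_eq_pow_mul μ htop
  set ρ := Complex.exp (Complex.I * Real.pi * t)
  have hρ0 : ρ ≠ 0 := Complex.exp_ne_zero _
  have hdet : (charMatrix hQ t μ).det = 0 := by rw [det_charMatrix, h, mul_zero]
  obtain ⟨n, hn⟩ : ∃ n, analyticOrderNatAt (charFun hQ t) μ = n + 1 := by
    refine Nat.exists_eq_succ_of_ne_zero fun h0 => hG0 ?_
    have := hG μ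
    rwa [h0, pow_zero, one_mul, h, eq_comm] at this
  rw [hn] at hG
  set c : ℂ → Fin 2 → ℂ := fun lam => (charMatrix hQ t lam).adjugate.mulVec v with hc
  set Y : ℂ → (ℝ →ᵇ (Fin 2 → ℂ)) := fun lam => sol hQ lam (c lam)
  have hY : Differentiable ℂ Y := fun lam => (differentiable_solOp hQ lam).clm_apply
    ((constCLM.differentiable.comp (differentiable_adjugate_charMatrix_mulVec hQ t v)) lam)
  -- Adding evaluation at 0 to the integral operator makes the equation homogeneous, so the initial
  -- value, which varies with `λ`, needs no separate treatment.
  set S := hQ.isVolterraCoeff.volterra Real.pi_pos.le +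
    constCLM.comp (BoundedContinuousFunction.evalCLM ℂ (0 : ℝ)) with hS
  set R := isVolterraCoeff_rotCoeff.volterra Real.pi_pos.le with hR
  have hSR : ∀ lam y, S y + lam • R y = sysOp hQ lam y + constCLM (y 0) := by
    intro lam y
    change hQ.isVolterraCoeff.volterra Real.pi_pos.le y + constCLM (y 0) + lam • R y =
      hQ.isVolterraCoeff.volterra Real.pi_pos.le y + lam • R y + constCLM (y 0)
    abel
  have hYeq : ∀ lam, Y lam = S (Y lam) + lam • R (Y lam) := by
    intro lam
    have h1 := sub_sysOp_solOp hQ lam (constCLM (c lam))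
    rw [hSR]
    have h2 : Y lam 0 = c lam := sol_apply_zero hQ lam (c lam)
    rw [h2, ← h1]
    exact (add_sub_cancel _ _).symm
  have hYB : ∀ lam, boundaryCLM t (Y lam) = (lam - μ) ^ (n + 1) • (ρ * G lam) • v := by
    intro lam
    have h2 : Y lam 0 = c lam := sol_apply_zero hQ lam (c lam)
    rw [boundaryCLM_apply, h2, ← charMatrix_mulVec, hc, Matrix.mulVec_mulVec, Matrix.mul_adjugate,
      Matrix.smul_mulVec, Matrix.one_mulVec, det_charMatrix, hG, smul_smul]
    congr 1
    ring
  obtain ⟨e, he0, he1, he, heB, heBm⟩ := exists_jordanChain S R (boundaryCLM t) hY hYeq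
    (G := fun lam => (ρ * G lam) • v) (by have := hGd.continuous; fun_prop) hYB
  have he' : ∀ k, e (k + 1) - sysOp hQ μ (e (k + 1)) = constCLM (e (k + 1) 0) + R (e k) := by
    intro k
    have h1 := he k
    rw [hSR] at h1
    rw [sub_eq_iff_eq_add]
    refine h1.trans ?_
    abel
  have hmem : ∀ k < n + 1, (toL2 (e (k + 1)), μ • toL2 (e (k + 1)) + toL2 (e k)) ∈
      (operator p q t).graph := by
    intro k hk
    rw [graph_operator]
    exact toL2_mem_graph hQ ⟨_, he' k⟩ (sub_eq_zero.1 (heB k hk))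
  have hne : toL2 (e 1) ≠ 0 := by
    refine toL2_ne_zero ?_
    rw [he1]
    exact (sol_apply_zero hQ μ (c μ)).symm ▸ hv
  constructor
  · rw [← Nat.cast_analyticOrderNatAt htop, hn]
    refine multiplicity_eq_of_chain (d := fun k => toL2 (e k)) (by rw [he0, map_zero]) hne hmem
      ?_ ?_
    · intro f hf
      rw [graph_operator] at hf
      obtain ⟨x, rfl, hx⟩ := exists_eq_toL2_sol hQ hf
      obtain ⟨a, ha⟩ := Matrix.exists_eq_smul_adjugate_mulVec hv hx
      refine ⟨a, ?_⟩
      rw [he1, ← map_smul, ha, ContinuousLinearMap.map_smul]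
    · intro f b hf
      have hsum : ∑ k ∈ Finset.range (n + 1), b k • toL2 (e (k + 1)) =
          toL2 (∑ k ∈ Finset.range (n + 1), b k • e (k + 1)) := by
        rw [map_sum]
        exact Finset.sum_congr rfl fun k _ => (map_smul _ _ _).symm
      rw [graph_operator, hsum] at hf
      obtain ⟨z, -, hz, hzb⟩ := exists_of_mem_graph hQ hf
      -- The chain raised by one index solves the same integral equation as `z`, so `z - z'` is a
      -- true solution at `μ`. Only the last term of `z'`, with `e (n + 2)`, violates the boundary
      -- condition.
      set z' := ∑ k ∈ Finset.range (n + 1), b k • e (k + 2) with hz'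
      have hz'eq : z' - sysOp hQ μ z' = constCLM (z' 0) +
          R (∑ k ∈ Finset.range (n + 1), b k • e (k + 1)) := by
        have h1 : z' = S z' + μ • R z' + R (∑ k ∈ Finset.range (n + 1), b k • e (k + 1)) := by
          rw [hz', map_sum, map_sum, map_sum, Finset.smul_sum, ← Finset.sum_add_distrib,
            ← Finset.sum_add_distrib]
          refine Finset.sum_congr rfl fun k _ => ?_
          conv_lhs => rw [he (k + 1)]
          rw [smul_add, smul_add, ContinuousLinearMap.map_smul, ContinuousLinearMap.map_smul,
            ContinuousLinearMap.map_smul, smul_comm μ]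
        rw [hSR] at h1
        rw [sub_eq_iff_eq_add]
        refine h1.trans ?_
        abel
      have hw : (z - z') - sysOp hQ μ (z - z') = constCLM ((z - z') 0) := by
        rw [ContinuousLinearMap.map_sub, sub_sub_sub_comm, hz, hz'eq, add_sub_add_right_eq_sub,
          ← ContinuousLinearMap.map_sub]
        rfl
      have hBz' : boundaryCLM t z' = (b n * (ρ * G μ)) • v := by
        rw [hz', map_sum, Finset.sum_range_succ, Finset.sum_eq_zero, zero_add,
          ContinuousLinearMap.map_smul, heBm, smul_smul]
        intro k hk
        rw [ContinuousLinearMap.map_smul, heB (k + 1) (by have := Finset.mem_range.1 hk; omega),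
          smul_zero]
      have hBw : (charMatrix hQ t μ).mulVec ((z - z') 0) = -((b n * (ρ * G μ)) • v) := by
        rw [charMatrix_mulVec, ← eq_sol_of_sub_sysOp hQ hw, ← boundaryCLM_apply,
          ContinuousLinearMap.map_sub, hBz', boundaryCLM_apply, hzb, sub_self, zero_sub]
      -- The adjugate annihilates the left side because the determinant is zero at `μ`, but it does
      -- not annihilate `v`; hence `b n = 0`.
      have h1 := congrArg (charMatrix hQ t μ).adjugate.mulVec hBw
      rw [Matrix.mulVec_mulVec, Matrix.adjugate_mul, hdet, zero_smul, Matrix.zero_mulVec,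
        Matrix.mulVec_neg, Matrix.mulVec_smul, eq_comm, neg_eq_zero] at h1
      exact (mul_eq_zero.1 ((smul_eq_zero.1 h1).resolve_right hv)).resolve_right
        (mul_ne_zero hρ0 hG0)
  · refine isEigenvalue_iff.2 ⟨toL2 (e 1), hne, ?_⟩
    have := hmem 0 (Nat.succ_pos n)
    rwa [he0, map_zero, add_zero] at this

/-- `charFun - freeChar` equals `2 cos πλ - disc(λ)`, which does not involve `t`; hence `M` and `N`
can be chosen before `t`. -/
theorem exists_enumeration (hQ : IsBVPotential p q) {h : ℝ} (hh : h ∈ Set.Ioo (0 : ℝ) (1 / 10)) :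
    ∃ (M : ℝ) (N : ℕ), ∀ t ∈ region h, ∃ z : ℤ ⊕ ℤ → ℂ,
      (∀ μ, (IsEigenvalue (operator p q t) μ ↔ ∃ i, z i = μ) ∧
        multiplicity (operator p q t) μ = {i | z i = μ}.encard) ∧
      ∀ i, 2 * (N : ℝ) + 1 < ‖freeRoot t i‖ →
        ‖z i - freeRoot t i‖ ≤ 1 ∧ ‖z i - freeRoot t i‖ ≤ M / ‖z i‖ := by
  obtain ⟨C, hC0, hC⟩ := exists_norm_disc_sub_le hQ
  obtain ⟨N, hN⟩ := exists_nat_ge (max (max 1 C) (9 * C / h ^ 2))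
  have hN1 : 1 ≤ N := by exact_mod_cast (le_max_left 1 C).trans ((le_max_left _ _).trans hN)
  refine ⟨9 * C / (4 * h), N, fun t ht => ?_⟩
  obtain ⟨z, hz, hz'⟩ := exists_zeros_enumeration hh ht (differentiable_charFun hQ t) hC0 hN1
    ((le_max_right _ _).trans hN) (fun lam hlam => by
      have h1 := hC lam (((le_max_right 1 C).trans ((le_max_left _ _).trans hN)).trans hlam)
      rwa [charFun, freeChar, sub_sub_sub_cancel_left, norm_sub_rev])
  refine ⟨z, fun μ => ?_, hz'⟩
  have hsin : Complex.sin (Real.pi * t) ≠ 0 :=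
    sin_pi_mul_ne_zero hh.1 (le_norm_sub_int_of_mem_region hh ht)
  have hzero : ∀ μ, charFun hQ t μ = 0 ↔ ∃ i, z i = μ := by
    intro μ
    rw [← not_iff_not, ← ne_eq,
      ← ((differentiable_charFun hQ t).analyticAt μ).analyticOrderAt_eq_zero, hz μ,
      Set.encard_eq_zero, Set.eq_empty_iff_forall_notMem, not_exists]
    rfl
  -- If the characteristic function vanished identically, the countable family `z` would exhaust
  -- `ℂ`.
  obtain ⟨w, hw⟩ : ∃ w, charFun hQ t w ≠ 0 := by
    by_contra! hall
    have hsurj : Function.Surjective z := fun μ => (hzero μ).1 (hall μ)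
    exact not_countable_complex (Set.countable_univ_iff.2 hsurj.countable)
  rw [← hz μ, ← hzero μ]
  by_cases h0 : charFun hQ t μ = 0
  · obtain ⟨h1, h2⟩ := multiplicity_operator_of_eq_zero hQ hsin h0
      ((differentiable_charFun hQ t).analyticOrderAt_ne_top hw μ)
    exact ⟨iff_of_true h2 h0, h1⟩
  · obtain ⟨h1, h2⟩ := multiplicity_operator_of_ne_zero hQ h0
    exact ⟨iff_of_false h2 h0, h1.trans
      (((differentiable_charFun hQ t).analyticAt μ).analyticOrderAt_eq_zero.2 h0).symm⟩

end Dirac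

/-! ### The two sequences of eigenvalues -/

theorem theorem1 (p q : ℝ → ℂ)
    (hp : Function.Periodic p Real.pi) (hq : Function.Periodic q Real.pi)
    (hpv : BoundedVariationOn p (Set.Icc 0 Real.pi))
    (hqv : BoundedVariationOn q (Set.Icc 0 Real.pi))
    (h : ℝ) (hh : h ∈ Set.Ioo (0 : ℝ) (1 / 10)) :
    ∃ lam₁ lam₂ : ℤ → ℂ → ℂ,
      (∀ t ∈ Dirac.region h,
        (∀ μ : ℂ, Dirac.IsEigenvalue (Dirac.operator p q t) μ ↔
          ∃ n : ℤ, lam₁ n t = μ ∨ lam₂ n t = μ) ∧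
        (∀ μ : ℂ, Dirac.multiplicity (Dirac.operator p q t) μ =
          {n : ℤ | lam₁ n t = μ}.encard + {n : ℤ | lam₂ n t = μ}.encard)) ∧
      ∃ (M : ℝ) (N : ℕ), ∀ t ∈ Dirac.region h, ∀ n : ℤ, (N : ℤ) < |n| →
        ‖lam₁ n t - (2 * n + t)‖ ≤ M / |(n : ℝ)| ∧
        ‖lam₂ n t - (2 * n - t)‖ ≤ M / |(n : ℝ)| := by
  obtain ⟨M, N, hMN⟩ := Dirac.exists_enumeration (p := p) (q := q) ⟨hpv, hqv⟩ hh
  choose! z hz hz' using hMN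
  -- As `‖t‖ ≤ 3`, the free roots of index `n` have norm at least `2|n| - 3`. For `|n| > 2N + 4`
  -- this exceeds `2N + 1`, and the eigenvalue, at distance at most 1, has norm at least `2|n| - 4 ≥
  -- |n|`. A nonnegative numerator `max M 0` is needed to replace that norm by `|n|`.
  refine ⟨fun n t => z t (Sum.inl n), fun n t => z t (Sum.inr n), fun t ht => ⟨fun μ => ?_,
    fun μ => ?_⟩, max M 0, 2 * N + 4, fun t ht n hn => ?_⟩
  · rw [(hz t ht μ).1, Sum.exists, exists_or]
  · rw [(hz t ht μ).2, ← Sum.inl_injective.encard_image (β := ℤ ⊕ ℤ),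
      ← Sum.inr_injective.encard_image (β := ℤ ⊕ ℤ),
      ← Set.encard_union_eq]
    · refine congrArg Set.encard (Set.ext ?_)
      rintro (n | n) <;> simp
    · rw [Set.disjoint_left]
      rintro _ ⟨n, -, rfl⟩ ⟨m, -, hm⟩
      exact Sum.inr_ne_inl hm
  · have ht3 := Dirac.norm_le_of_mem_region hh ht
    have hn' : 2 * (N : ℝ) + 4 < |(n : ℝ)| := by exact_mod_cast hn
    have hN0 : (0 : ℝ) ≤ N := N.cast_nonneg
    have key : ∀ i, 2 * |(n : ℝ)| - 3 ≤ ‖Dirac.freeRoot t i‖ →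
        ‖z t i - Dirac.freeRoot t i‖ ≤ max M 0 / |(n : ℝ)| := by
      intro i hi
      obtain ⟨h1, h2⟩ := hz' t ht i (by linarith)
      have h3 : |(n : ℝ)| ≤ ‖z t i‖ := by
        have := norm_sub_norm_le (Dirac.freeRoot t i) (z t i)
        rw [norm_sub_rev] at this
        linarith
      refine h2.trans ?_
      have h4 : 0 < |(n : ℝ)| := by linarith
      calc M / ‖z t i‖ ≤ max M 0 / ‖z t i‖ := by gcongr; exact le_max_left _ _
        _ ≤ max M 0 / |(n : ℝ)| := by gcongr
    have h2n : ‖(2 * n : ℂ)‖ = 2 * |(n : ℝ)| := by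
      rw [norm_mul, Complex.norm_ofNat, Complex.norm_intCast]
    refine ⟨key (Sum.inl n) ?_, key (Sum.inr n) ?_⟩
    · have := norm_sub_le_norm_add (2 * n : ℂ) t
      change _ ≤ ‖(2 * n + t : ℂ)‖
      linarith
    · have := norm_sub_norm_le (2 * n : ℂ) t
      change _ ≤ ‖(2 * n - t : ℂ)‖
      linarith
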